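/- **Setting.** A (finite) arena $\mathcal A=(V,V_0,V_1,E,v_I)$ consists of a finite directed graph $(V,E)$ in which every vertex has an outgoing edge, a partition $V=V_0\uplus V_1$ of the vertices between Player 0 and Player 1, and an initial vertex $v_I\in V$. A weight function is a map $w\colon E\to\mathbb Z$. A play is an infinite path $v_0v_1v_2\cdots$ with $v_0=v_I$. A strategy for Player 0 is a map $\sigma\colon V^*V_0\to V$ with $(v,\sigma(xv))\in E$ for all $x\in V^*$, $v\in V_0$; a play is consistent with $\sigma$ if $v_{n+1}=\sigma(v_0\cdots v_n)$ for every $n$ with $v_n\in V_0$. The energy level of a play prefix is $\mathrm{EL}(v_0\cdots v_n)=\sum_{i=0}^{n-1}w(v_i,v_{i+1})$. For $t\in\mathbb N$, the lower-bounded average-energy objective $\mathsf{AvgEnergy_L}(w,t)$ is the set of plays such that $$\mathrm{EL}(v_0\cdots v_n)\ge 0\ \text{ for all } n\qquad\text{and}\qquad \limsup_{n\to\infty}\frac1n\sum_{i=0}^{n-1}\mathrm{EL}(v_0\cdots v_i)\le t ,$$ where the limit superior is taken in $[-\infty,\infty]$. Player 0 wins $(\mathcal A,\mathsf{AvgEnergy_L}(w,t))$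 if she has a strategy such that every play consistent with it lies in $\mathsf{AvgEnergy_L}(w,t)$. **Threshold problem for lower-bounded average-energy games.** Input: an arena $\mathcal A$ and a weight function $w\colon E\to\mathbb Z$, with weights encoded in binary. Question: does there exist $t\in\mathbb N$ such that Player 0 wins $(\mathcal A,\mathsf{AvgEnergy_L}(w,t))$? The vertices of an input are numbered $0,\dots,n-1$, and an input is encoded, over a fixed finite alphabet, as an $n\times n$ matrix whose entry $(v,u)$ is the weight of the edge $(v,u)$ in binary, or empty if there is no such edge, where the row of $v$ also holds one bit for the owner of $v$ and one bit telling whether $v=v_I$. **Theorem.** The threshold problem for lower-bounded average-energy games is in $\textsc{2ExpTime}$: there are a deterministic multi-stack (equivalently, multi-tape) Turing machine and a polynomial $p$ such that the machine decides, for every word $x$ over the alphabet, within $2^{2^{p(|x|)}}$ steps whether $x$ is the encoding of an input for which the answer is yes. -/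

import Mathlib

namespace EnergyGame

/-! ### Arenas, plays, strategies -/

/-- An arena with vertex set `V`: a directed graph without terminal vertices, an assignment of every
vertex to one of the players `0`, `1` (so `V_i = {v | owner v = i}`), and an initial vertex.
The finite arenas are those with vertex set `Fin n`. -/
structure Arena (V : Type) where
  owner : V → Fin 2
  E : V → V → Prop
  no_terminal : ∀ v, ∃ u, E v u
  init : V

/-- The edges of an arena. -/
def Arena.Edge {V : Type} (A : Arena V) : Type := {e : V × V // A.E e.1 e.2}

/-- A play: an infinite path that starts in the initial vertex. -/
structure Arena.Play {V : Type} (A : Arena V) where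
  vert : ℕ → V
  vert_zero : vert 0 = A.init
  isPath : ∀ n, A.E (vert n) (vert (n + 1))

/-- The `n`-th edge of a play. -/
def Arena.Play.edge {V : Type} {A : Arena V} (ρ : A.Play) (n : ℕ) : A.Edge :=
  ⟨(ρ.vert n, ρ.vert (n + 1)), ρ.isPath n⟩

/-- A strategy for player `i`: `next w v` is the vertex chosen after the history `w v`. Only its
values at vertices `v` of player `i` matter, and there it has to follow an edge. -/
structure Arena.Strategy {V : Type} (A : Arena V) (i : Fin 2) where
  next : List V → V → V
  follows : ∀ w v, A.owner v = i → A.E v (next w v)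

/-- `ρ = v₀ v₁ v₂ ⋯` is consistent with `s` if `v_{n+1} = s (v₀ ⋯ v_n)` whenever player `i` owns
`v_n`. -/
def Arena.Play.Consistent {V : Type} {A : Arena V} {i : Fin 2} (ρ : A.Play)
    (s : A.Strategy i) : Prop :=
  ∀ n, A.owner (ρ.vert n) = i →
    ρ.vert (n + 1) = s.next ((List.range n).map ρ.vert) (ρ.vert n)

/-- Player `0` wins the game on `A` with objective `Win`. -/
def Arena.Player0Wins {V : Type} (A : Arena V) (Win : Set A.Play) : Prop :=
  ∃ s : A.Strategy 0, ∀ ρ : A.Play, ρ.Consistent s → ρ ∈ Win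

/-! ### Objectives -/

/-- The energy level of the prefix `v₀ ⋯ v_n` of a play. -/
def energyLevel {V : Type} {A : Arena V} (w : A.Edge → ℤ) (ρ : A.Play) (n : ℕ) : ℤ :=
  ∑ i ∈ Finset.range n, w (ρ.edge i)

/-- The lower-bounded energy objective. -/
def EnergyL {V : Type} {A : Arena V} (w : A.Edge → ℤ) : Set A.Play :=
  {ρ | ∀ n, 0 ≤ energyLevel w ρ n}

/-- The average-energy objective with threshold `t`. The limit superior is taken in the extended
reals, so it is `⊤` if the averages are unbounded from above. -/
def AvgEnergy {V : Type} {A : Arena V} (w : A.Edge → ℤ) (t : ℕ) : Set A.Play :=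
  {ρ | Filter.limsup
      (fun n : ℕ => (((1 / (n : ℝ)) * ∑ i ∈ Finset.range n, (energyLevel w ρ i : ℝ) : ℝ) : EReal))
      Filter.atTop ≤ ((t : ℝ) : EReal)}

/-- The lower-bounded average-energy objective with threshold `t`. -/
def AvgEnergyL {V : Type} {A : Arena V} (w : A.Edge → ℤ) (t : ℕ) : Set A.Play :=
  EnergyL w ∩ AvgEnergy w t

/-! ### The threshold problem -/

/-- An input of the threshold problem: a finite arena, its vertices numbered `0, …, n - 1`, with an
integer weight on every edge. -/
structure Instance where
  n : ℕ
  arena : Arena (Fin n)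
  weight : arena.Edge → ℤ

/-- There is a threshold with which player `0` wins the lower-bounded average-energy game. -/
def Instance.HasThreshold (I : Instance) : Prop :=
  ∃ t : ℕ, I.arena.Player0Wins (AvgEnergyL I.weight t)

/-! ### Encoding of the inputs -/

open Computability in
/-- An entry of the matrix of weights: nothing if there is no edge, and otherwise a sign bit
followed by the absolute value of the weight in binary. -/
def encodeEntry : Option ℤ → List Γ'
  | none => []
  | some z => Γ'.bit (decide (z < 0)) :: (encodeNat z.natAbs).map Γ'.bit

open Classical in
/-- The entry `(v, u)` of the matrix of weights. -/
noncomputable def Instance.entry (I : Instance) (v u : Fin I.n) : Option ℤ :=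
  if h : I.arena.E v u then some (I.weight ⟨(v, u), h⟩) else none

open Computability in
/-- The row of a vertex `v`: one bit for its owner, one bit that marks the initial vertex, and the
entries `(v, 0), …, (v, n - 1)`, each of them preceded by a comma. -/
noncomputable def Instance.encodeRow (I : Instance) (v : Fin I.n) : List Γ' :=
  Γ'.bit (decide (I.arena.owner v = 1)) :: Γ'.bit (decide (v = I.arena.init)) ::
    (List.ofFn fun u => Γ'.comma :: encodeEntry (I.entry v u)).flatten

open Computability in
/-- The rows of the vertices `0, …, n - 1`, each of them preceded by a bracket. -/
noncomputable def Instance.encode (I : Instance) : List Γ' :=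
  (List.ofFn fun v => Γ'.bra :: I.encodeRow v).flatten

/-- The threshold problem as a formal language: the encodings of the positive inputs. -/
def thresholdProblem : Language Computability.Γ' :=
  {x | ∃ I : Instance, I.encode = x ∧ I.HasThreshold}

/-! ### Different inputs have different encodings -/

theorem flatten_sep_injective {α : Type} (s : α) :
    ∀ L₁ L₂ : List (List α), (∀ l ∈ L₁, s ∉ l) → (∀ l ∈ L₂, s ∉ l) →
      (L₁.map (s :: ·)).flatten = (L₂.map (s :: ·)).flatten → L₁ = L₂ := by
  classical
  have key : ∀ (L : List (List α)) (a : List α), s ∉ a →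
      (a ++ (L.map (s :: ·)).flatten).takeWhile (fun x => decide (x ≠ s)) = a := by
    intro L a ha
    rw [List.takeWhile_append_of_pos]
    · cases L <;> simp
    · intro x hx
      simp only [ne_eq, decide_eq_true_eq]
      rintro rfl
      exact ha hx
  intro L₁
  induction L₁ with
  | nil => intro L₂ _ _ h; cases L₂ with
    | nil => rfl
    | cons b L₂ => simp at h
  | cons a L₁ ih =>
    intro L₂ h₁ h₂ h
    cases L₂ with
    | nil => simp at h
    | cons b L₂ =>
      simp only [List.map_cons, List.flatten_cons, List.cons_append, List.cons.injEq,
        true_and] at h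
      have hab : a = b := by
        rw [← key L₁ a (h₁ a (by simp)), h, key L₂ b (h₂ b (by simp))]
      subst hab
      rw [ih L₂ (fun l hl => h₁ l (by simp [hl])) (fun l hl => h₂ l (by simp [hl]))
        (List.append_cancel_left h)]

theorem encodeEntry_injective : Function.Injective encodeEntry := by
  intro a b h
  have hb : Function.Injective Computability.Γ'.bit := fun x y h => by cases h; rfl
  cases a with
  | none => cases b with
    | none => rfl
    | some z => simp [encodeEntry] at h
  | some y => cases b with
    | none => simp [encodeEntry] at h
    | some z =>
      simp only [encodeEntry, List.cons.injEq, Computability.Γ'.bit.injEq, decide_eq_decide] at h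
      have hn := congrArg Computability.decodeNat ((List.map_injective_iff.2 hb) h.2)
      simp only [Computability.decode_encodeNat] at hn
      congr 1
      omega

theorem encodeEntry_mem (a : Option ℤ) (x : Computability.Γ') (hx : x ∈ encodeEntry a) :
    ∃ b, x = Computability.Γ'.bit b := by
  cases a with
  | none => simp [encodeEntry] at hx
  | some z =>
    simp only [encodeEntry, List.mem_cons, List.mem_map] at hx
    rcases hx with h | ⟨b, _, h⟩
    · exact ⟨_, h⟩
    · exact ⟨b, h.symm⟩

theorem Instance.bra_notMem_encodeRow (I : Instance) (v : Fin I.n) :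
    Computability.Γ'.bra ∉ I.encodeRow v := by
  intro h
  simp only [Instance.encodeRow, List.mem_cons, List.mem_flatten, List.mem_ofFn, reduceCtorEq,
    false_or] at h
  obtain ⟨l, ⟨u, rfl⟩, h⟩ := h
  rcases List.mem_cons.1 h with h | h
  · cases h
  · obtain ⟨b, hb⟩ := encodeEntry_mem _ _ h
    cases hb

theorem Instance.encode_injective : Function.Injective Instance.encode := by
  rintro ⟨n, ⟨o₁, E₁, t₁, i₁⟩, w₁⟩ ⟨m, ⟨o₂, E₂, t₂, i₂⟩, w₂⟩ h
  have hrows := flatten_sep_injective Computability.Γ'.bra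
    (List.ofFn fun v => Instance.encodeRow ⟨n, ⟨o₁, E₁, t₁, i₁⟩, w₁⟩ v)
    (List.ofFn fun v => Instance.encodeRow ⟨m, ⟨o₂, E₂, t₂, i₂⟩, w₂⟩ v)
    (by intro l hl; obtain ⟨v, rfl⟩ := List.mem_ofFn.1 hl; exact Instance.bra_notMem_encodeRow _ v)
    (by intro l hl; obtain ⟨v, rfl⟩ := List.mem_ofFn.1 hl; exact Instance.bra_notMem_encodeRow _ v)
    (by simpa [Instance.encode, List.map_ofFn, Function.comp_def] using h)
  have hnm : n = m := by simpa using congrArg List.length hrows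
  subst hnm
  have hrow := congrFun (List.ofFn_injective hrows)
  have hent : ∀ v u, Instance.entry ⟨n, ⟨o₁, E₁, t₁, i₁⟩, w₁⟩ v u
      = Instance.entry ⟨n, ⟨o₂, E₂, t₂, i₂⟩, w₂⟩ v u := by
    intro v u
    have hv := hrow v
    simp only [Instance.encodeRow, List.cons.injEq] at hv
    have := flatten_sep_injective Computability.Γ'.comma
      (List.ofFn fun u => encodeEntry (Instance.entry ⟨n, ⟨o₁, E₁, t₁, i₁⟩, w₁⟩ v u))
      (List.ofFn fun u => encodeEntry (Instance.entry ⟨n, ⟨o₂, E₂, t₂, i₂⟩, w₂⟩ v u))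
      (by
        intro l hl h
        obtain ⟨v, rfl⟩ := List.mem_ofFn.1 hl
        obtain ⟨b, hb⟩ := encodeEntry_mem _ _ h
        cases hb)
      (by
        intro l hl h
        obtain ⟨v, rfl⟩ := List.mem_ofFn.1 hl
        obtain ⟨b, hb⟩ := encodeEntry_mem _ _ h
        cases hb)
      (by simpa [List.map_ofFn, Function.comp_def] using hv.2.2)
    exact encodeEntry_injective (congrFun (List.ofFn_injective this) u)
  have ho : o₁ = o₂ := by
    funext v
    have hv := hrow v
    simp only [Instance.encodeRow, List.cons.injEq, Computability.Γ'.bit.injEq,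
      decide_eq_decide] at hv
    have := hv.1
    omega
  have hi : i₁ = i₂ := by
    have hv := hrow i₁
    simp only [Instance.encodeRow, List.cons.injEq, Computability.Γ'.bit.injEq,
      decide_eq_decide] at hv
    exact hv.2.1.1 trivial
  have hE : E₁ = E₂ := by
    funext v u
    have := hent v u
    simp only [Instance.entry] at this
    by_cases h1 : E₁ v u <;> by_cases h2 : E₂ v u <;> simp_all
  subst ho hi hE
  have hw : w₁ = w₂ := by
    funext ⟨⟨v, u⟩, e⟩
    have := hent v u
    simp only [Instance.entry] at this
    rw [dif_pos e, dif_pos e] at this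
    exact Option.some.inj this
  subst hw
  rfl

/-! ### Doubly-exponential time -/

open Classical in
/-- `L` is in 2ExpTime: a deterministic multi-stack Turing machine decides membership in `L` of
every word `x`, within `2 ^ 2 ^ p (|x|)` steps, for some polynomial `p`. -/
def InTwoExpTime {Γ : Type} (L : Language Γ) : Prop :=
  ∃ (M : Turing.TM2ComputableInTime (id : List Γ → List Γ) Computability.encodeBool
      (fun x => decide (x ∈ L))) (p : Polynomial ℕ),
    ∀ n, M.time n ≤ 2 ^ 2 ^ p.eval n

end EnergyGame

/-! Call a configuration (vertex, level) safe for `b` if it lies in a closed set of configurations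
with levels in `[0, b]` in which Player 0 can stay forever (`SafeFrom`). The answer is yes exactly
if the initial vertex with level `0` is safe for one explicit, exponentially large `b`
(`Instance.hasThreshold_iff`), and safety for that `b` can be decided by exhaustive search.

Bounded levels have bounded averages, which gives one direction. The converse rests on two facts.
(1) If the level can be kept bounded at all, it can be kept in a window around its initial value
whose size depends only on the number of vertices and the weights (`exists_window`), by induction on
the number of edges of Player 1. Without choices of Player 1, closed walks of both signs through a
common vertex allow balancing. If Player 1 has two edges at `v`, two games that each lack one of
them are played in turns: one is frozen at `v` while the other advances, the level is the sum of
both, and the window doubles. Hence a configuration with level `c` that is safe for some bound is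
safe for `C + c`, with `C` fixed (`SafeFrom.capBound_add`). (2) If the initial configuration is safe
for no bound, Player 1 drives the level up to about `h` within a number of steps linear in `h`
(`ConsistentUpTo.exists_high`), at a configuration that is again safe for no bound. The level needs
time proportional to `h` to come down, so the average at that moment is proportional to `h`.
Repetition gives a play with arbitrarily high averages infinitely often (`safeFrom_of_player0Wins`).

For the complexity, the question becomes an arithmetical formula all of whose quantifiers are
bounded by `B = 2 ^ 2 ^ (l + 4) ^ 2`, where `l` is the length of the word (`positiveNum_iff`):
numbers below `B` code an input and a closed set, and the input must have the given encoding.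
Programs over unary counters evaluate bounded recursions in time polynomial in the values
(`Realizable.rec`), here polynomial in `B`. They compile to stack machines without any loss of time
(`Run.machineRun`). -/

namespace EnergyGame

open Computability Turing

/-! ### Counter programs and their compilation to stack machines -/

/-- Programs over counters indexed by `ℕ` with a read-only-once input word. `loop i P` repeats
"decrement counter `i`, then run `P`" as long as counter `i` is positive. -/
inductive Prog
  | skip
  | inc (i : ℕ)
  | read (i : ℕ)
  | seq (P Q : Prog)
  | loop (i : ℕ) (P : Prog)

/-- The numbers that represent the input symbols, with `0` for the end of the input. -/
def symNum : Option Γ' → ℕ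
  | none => 0
  | some Γ'.blank => 1
  | some (Γ'.bit false) => 2
  | some (Γ'.bit true) => 3
  | some Γ'.bra => 4
  | some Γ'.ket => 5
  | some Γ'.comma => 6

/-- A state of a counter program: the rest of the input and the values of the counters. -/
abbrev PState := List Γ' × (ℕ → ℕ)

/-- `Run P s s' t`: started in `s`, the program `P` terminates in `s'` after `t` steps. -/
inductive Run : Prog → PState → PState → ℕ → Prop
  | skip (s) : Run .skip s s 1
  | inc (i x s) : Run (.inc i) (x, s) (x, Function.update s i (s i + 1)) 1
  | read (i x s) : Run (.read i) (x, s) (x.tail, Function.update s i (s i + symNum x.head?)) 1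
  | seq {P Q s₁ s₂ s₃ t₁ t₂} : Run P s₁ s₂ t₁ → Run Q s₂ s₃ t₂ → Run (.seq P Q) s₁ s₃ (t₁ + t₂)
  | loop_zero {i P x s} : s i = 0 → Run (.loop i P) (x, s) (x, s) 1
  | loop_succ {i P x s s₂ s₃ n t₁ t₂} : s i = n + 1 → Run P (x, Function.update s i n) s₂ t₁ →
      Run (.loop i P) s₂ s₃ t₂ → Run (.loop i P) (x, s) s₃ (1 + t₁ + t₂)

namespace Prog

/-- All counters of the program are below `N`. -/
def Below (N : ℕ) : Prog → Prop
  | skip => True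
  | inc i => i < N
  | read i => i < N
  | seq P Q => P.Below N ∧ Q.Below N
  | loop i P => i < N ∧ P.Below N

theorem Below.mono {N M : ℕ} (h : N ≤ M) : ∀ {P : Prog}, P.Below N → P.Below M
  | skip, _ => trivial
  | inc _, h' => lt_of_lt_of_le (show _ < N from h') h
  | read _, h' => lt_of_lt_of_le (show _ < N from h') h
  | seq _ _, h' => ⟨h'.1.mono h, h'.2.mono h⟩
  | loop _ _, h' => ⟨lt_of_lt_of_le h'.1 h, h'.2.mono h⟩

theorem exists_below : ∀ P : Prog, ∃ N, P.Below N
  | skip => ⟨0, trivial⟩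
  | inc i => ⟨i + 1, Nat.lt_succ_self i⟩
  | read i => ⟨i + 1, Nat.lt_succ_self i⟩
  | seq P Q => by
    obtain ⟨N, hN⟩ := exists_below P
    obtain ⟨M, hM⟩ := exists_below Q
    exact ⟨max N M, hN.mono (le_max_left _ _), hM.mono (le_max_right _ _)⟩
  | loop i P => by
    obtain ⟨N, hN⟩ := exists_below P
    exact ⟨max N (i + 1), lt_of_lt_of_le (Nat.lt_succ_self i) (le_max_right _ _),
      hN.mono (le_max_left _ _)⟩

/-- The program points. -/
def Lab : Prog → Type
  | skip => Unit
  | inc _ => Unit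
  | read _ => Unit
  | seq P Q => P.Lab ⊕ Q.Lab
  | loop _ P => Option P.Lab

noncomputable instance instFintypeLab : ∀ P : Prog, Fintype P.Lab
  | skip => inferInstanceAs (Fintype Unit)
  | inc _ => inferInstanceAs (Fintype Unit)
  | read _ => inferInstanceAs (Fintype Unit)
  | seq P Q =>
    haveI := instFintypeLab P
    haveI := instFintypeLab Q
    inferInstanceAs (Fintype (P.Lab ⊕ Q.Lab))
  | loop _ P =>
    haveI := instFintypeLab P
    inferInstanceAs (Fintype (Option P.Lab))

/-- The first program point. -/
def start : ∀ P : Prog, P.Lab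
  | skip => ()
  | inc _ => ()
  | read _ => ()
  | seq P _ => Sum.inl P.start
  | loop _ _ => none

end Prog

/-! ### Compilation of counter programs, with counters as unary stacks -/

/-- The stack alphabets: the input stack `none`, and one unary stack for every counter. -/
abbrev stackAlphabet (N : ℕ) : Option (Fin N) → Type
  | none => Γ'
  | some _ => Bool

/-- The stacks that represent a state of a counter program. -/
def stackFam (N : ℕ) (s : PState) : ∀ k, List (stackAlphabet N k)
  | none => s.1
  | some i => List.replicate (s.2 i) true

theorem stackFam_update {N : ℕ} (x : List Γ') (s : ℕ → ℕ) (i : Fin N) (n : ℕ) :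
    stackFam N (x, Function.update s i n) =
      Function.update (stackFam N (x, s)) (some i) (List.replicate n true) := by
  funext k
  rcases k with _ | j
  · rfl
  · by_cases h : j = i
    · subst h; simp [stackFam]
    · have : (j : ℕ) ≠ i := fun e => h (Fin.ext e)
      simp [stackFam, h, this]

theorem stackFam_input {N : ℕ} (x y : List Γ') (s : ℕ → ℕ) :
    stackFam N (y, s) = Function.update (stackFam N (x, s)) none y := by
  funext k
  rcases k with _ | j
  · rfl
  · simp [stackFam]

/-- Push `symNum v - j` symbols, at most `k` many, on stack `i`, then go to `e`. -/
def pushSym {N : ℕ} {Λ : Type} (i : Fin N) (e : Λ) :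
    ℕ → ℕ → TM2.Stmt (stackAlphabet N) Λ (Option Γ')
  | 0, _ => .goto fun _ => e
  | k + 1, j => .branch (fun v => decide (symNum v ≤ j)) (.goto fun _ => e)
      (.push (some i) (fun _ => true) (pushSym i e k (j + 1)))

theorem symNum_le (a : Option Γ') : symNum a ≤ 6 := by
  rcases a with _ | (_ | (_ | _) | _ | _ | _) <;> simp [symNum]

/-- The parameter `j` counts the symbols already pushed and `k` is fuel. A statement contains no
loop, so the at most six pushes are unrolled within one machine step. -/
theorem stepAux_pushSym {N : ℕ} {Λ : Type} (i : Fin N) (e : Λ) (v : Option Γ') (x : List Γ') :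
    ∀ (k j : ℕ) (s : ℕ → ℕ), symNum v ≤ j + k →
      TM2.stepAux (pushSym i e k j) v (stackFam N (x, s)) =
        ⟨some e, v, stackFam N (x, Function.update s i (s i + (symNum v - j)))⟩ := by
  intro k
  induction k with
  | zero =>
    intro j s h
    have : symNum v - j = 0 := by omega
    simp [pushSym, this]
  | succ k ih =>
    intro j s h
    by_cases hj : symNum v ≤ j
    · have : symNum v - j = 0 := by omega
      simp [pushSym, hj, this]
    · have h1 : Function.update (stackFam N (x, s)) (some i)
          (true :: stackFam N (x, s) (some i)) = stackFam N (x, Function.update s i (s i + 1)) := by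
        rw [stackFam_update]; rfl
      simp only [pushSym, TM2.stepAux.eq_5, hj, decide_false, cond_false, TM2.stepAux.eq_1, h1]
      rw [ih (j + 1) _ (by omega)]
      congr 3
      rw [Function.update_idem]
      congr 1
      simp only [Function.update_self]
      omega

/-- The code of a program inside a machine with labels `Λ`, given an embedding of the program
points and the label of the code that follows. -/
def Prog.code {N : ℕ} {Λ : Type} : ∀ (P : Prog), P.Below N → (P.Lab → Λ) → Λ → P.Lab →
    TM2.Stmt (stackAlphabet N) Λ (Option Γ')
  | .skip, _, _, e, _ => .goto fun _ => e
  | .inc i, h, _, e, _ => .push (some ⟨i, h⟩) (fun _ => true) (.goto fun _ => e)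
  | .read i, h, _, e, _ => .pop none (fun _ a => a) (pushSym ⟨i, h⟩ e 6 0)
  | .seq P Q, h, emb, _, Sum.inl l =>
      P.code h.1 (fun l => emb (Sum.inl l)) (emb (Sum.inr Q.start)) l
  | .seq _ Q, h, emb, e, Sum.inr l => Q.code h.2 (fun l => emb (Sum.inr l)) e l
  | .loop i P, h, emb, e, none => .pop (some ⟨i, h.1⟩) (fun _ a => a.map fun _ => Γ'.blank)
      (.branch (fun v => v.isSome) (.goto fun _ => emb (some P.start)) (.goto fun _ => e))
  | .loop _ P, h, emb, _, some l => P.code h.2 (fun l => emb (some l)) (emb none) l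

/-- The machine `m` runs from `c` to `c'` in `t` steps. -/
def MachineRun {K : Type} [DecidableEq K] {Γ : K → Type} {Λ σ : Type} (m : Λ → TM2.Stmt Γ Λ σ)
    (c c' : TM2.Cfg Γ Λ σ) (t : ℕ) : Prop :=
  (flip bind (TM2.step m))^[t] (some c) = some c'

theorem MachineRun.trans {K : Type} [DecidableEq K] {Γ : K → Type} {Λ σ : Type}
    {m : Λ → TM2.Stmt Γ Λ σ} {a b c : TM2.Cfg Γ Λ σ} {t₁ t₂ : ℕ}
    (h₁ : MachineRun m a b t₁) (h₂ : MachineRun m b c t₂) : MachineRun m a c (t₁ + t₂) := by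
  unfold MachineRun at *
  rw [add_comm, Function.iterate_add_apply, h₁, h₂]

theorem MachineRun.single {K : Type} [DecidableEq K] {Γ : K → Type} {Λ σ : Type}
    {m : Λ → TM2.Stmt Γ Λ σ} {l : Λ} {v : σ} {S : ∀ k, List (Γ k)} {c : TM2.Cfg Γ Λ σ}
    (h : TM2.stepAux (m l) v S = c) : MachineRun m ⟨some l, v, S⟩ c 1 := by
  subst h; rfl

/-- One machine step executes a whole statement up to its `goto`, so every primitive and every loop
test costs exactly one step and `t` is preserved. The embedding `emb` and the exit label `e` are
arbitrary so that the induction applies to subprograms. The local state at the exit is irrelevant,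
since code that inspects it sets it first. -/
theorem Run.machineRun {N : ℕ} {Λ : Type} (m : Λ → TM2.Stmt (stackAlphabet N) Λ (Option Γ'))
    {P : Prog} {s s' : PState} {t : ℕ} (hr : Run P s s' t) :
    ∀ (h : P.Below N) (emb : P.Lab → Λ) (e : Λ), (∀ l, m (emb l) = P.code h emb e l) →
      ∀ v, ∃ v', MachineRun m ⟨some (emb P.start), v, stackFam N s⟩ ⟨some e, v', stackFam N s'⟩ t := by
  induction hr with
  | skip s =>
    intro h emb e hm v
    exact ⟨v, .single (by rw [hm]; rfl)⟩
  | inc i x s =>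
    intro h emb e hm v
    refine ⟨v, .single ?_⟩
    rw [hm, show Function.update s i (s i + 1) =
      Function.update s ((⟨i, h⟩ : Fin N) : ℕ) (s i + 1) from rfl, stackFam_update]
    rfl
  | read i x s =>
    intro h emb e hm v
    refine ⟨x.head?, .single ?_⟩
    rw [hm]
    simp only [Prog.code, TM2.stepAux.eq_3]
    have h1 : Function.update (stackFam N (x, s)) none (stackFam N (x, s) none).tail =
        stackFam N (x.tail, s) := (stackFam_input x x.tail s).symm
    rw [h1]
    exact stepAux_pushSym ⟨i, h⟩ e x.head? x.tail 6 0 s (by simpa using symNum_le _)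
  | seq _ _ ih₁ ih₂ =>
    intro h emb e hm v
    obtain ⟨v₁, h₁⟩ := ih₁ h.1 (fun l => emb (Sum.inl l)) _ (fun l => hm (Sum.inl l)) v
    obtain ⟨v₂, h₂⟩ := ih₂ h.2 (fun l => emb (Sum.inr l)) _ (fun l => hm (Sum.inr l)) v₁
    exact ⟨v₂, h₁.trans h₂⟩
  | @loop_zero i P x s hs =>
    intro h emb e hm v
    refine ⟨none, .single ?_⟩
    rw [hm]
    change TM2.stepAux (Prog.code (.loop i P) h emb e none) v _ = _
    have h0 : stackFam N (x, s) (some ⟨i, h.1⟩) = [] := by simp [stackFam, hs]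
    simp only [Prog.code, TM2.stepAux.eq_3, TM2.stepAux.eq_5]
    rw [h0]
    simp only [List.head?_nil, Option.map_none, Option.isSome_none, cond_false, List.tail_nil,
      TM2.stepAux.eq_6]
    rw [← h0, Function.update_eq_self]
  | @loop_succ i P x s s₂ s₃ n t₁ t₂ hs _ _ ih₁ ih₂ =>
    intro h emb e hm v
    obtain ⟨v₁, h₁⟩ := ih₁ h.2 (fun l => emb (some l)) _ (fun l => hm (some l)) (some Γ'.blank)
    obtain ⟨v₂, h₂⟩ := ih₂ h emb _ hm v₁
    refine ⟨v₂, (MachineRun.trans (.single ?_) h₁).trans h₂⟩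
    rw [hm]
    change TM2.stepAux (Prog.code (.loop i P) h emb e none) v _ = _
    have h0 : stackFam N (x, s) (some ⟨i, h.1⟩) = true :: List.replicate n true := by
      simp [stackFam, hs, List.replicate_succ]
    have h1 := stackFam_update x s ⟨i, h.1⟩ n
    simp only at h1
    simp only [Prog.code, TM2.stepAux.eq_3, TM2.stepAux.eq_5, h0, h1]
    simp

/-- Stacks that are empty except for the stack of counter `0`. -/
def outputStack (N : ℕ) (l : List Bool) : ∀ k, List (stackAlphabet (N + 1) k)
  | none => []
  | some i => if i = 0 then l else []

theorem update_outputStack {N : ℕ} (l l' : List Bool) :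
    Function.update (outputStack N l) (some 0) l' = outputStack N l' := by
  funext k
  rcases k with _ | i
  · rfl
  · by_cases hi : i = 0
    · subst hi; simp [outputStack]
    · simp [outputStack, hi]

/-- Replace the content of stack `0` by one symbol, which tells whether it was nonempty. -/
def outputCode (N : ℕ) (Λ : Type) : TM2.Stmt (stackAlphabet (N + 1)) Λ (Option Γ') :=
  .pop (some 0) (fun _ a => a.map fun _ => Γ'.blank)
    (.branch (fun v => v.isSome)
      (.push (some 0) (fun _ => true) (.load (fun _ => none) .halt))
      (.push (some 0) (fun _ => false) (.load (fun _ => none) .halt)))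

/-- A halting configuration must have the initial local state and only the output on its stacks,
hence the `load` and the requirement that all other stacks are empty. -/
theorem stepAux_outputCode {N : ℕ} {Λ : Type} (v : Option Γ') (b : Bool) :
    TM2.stepAux (outputCode N Λ) v (outputStack N (List.replicate (if b then 1 else 0) true)) =
      ⟨none, none, outputStack N [b]⟩ := by
  cases b
  all_goals
    simp only [outputCode, TM2.stepAux.eq_3, TM2.stepAux.eq_5, TM2.stepAux.eq_1,
      TM2.stepAux.eq_4, TM2.stepAux.eq_7, update_outputStack]
    rfl

/-- The machine that runs `P` and then outputs whether counter `0` is positive. -/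
noncomputable def Prog.machine {N : ℕ} (P : Prog) (h : P.Below (N + 1)) : FinTM2 where
  K := Option (Fin (N + 1))
  k₀ := none
  k₁ := some 0
  Γ := stackAlphabet (N + 1)
  Λ := Option P.Lab
  main := some P.start
  σ := Option Γ'
  initialState := none
  Γk₀Fin := inferInstanceAs (Fintype Γ')
  m
    | some l => P.code h some none l
    | none => outputCode N _

open Classical in
/-- If a counter program leaves `1` or `0` in counter `0` and `0` in the others, according to the
membership of its input in `L`, in a number of steps that is bounded in the length of the input,
then a stack machine decides `L` within one step more. -/
theorem exists_tm2ComputableInTime_of_run (P : Prog) (L : Language Γ') (T : ℕ → ℕ)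
    (hP : ∀ x : List Γ', ∃ t, t + 1 ≤ T x.length ∧
      Run P (x, fun _ => 0) ([], Function.update (fun _ => 0) 0 (if x ∈ L then 1 else 0)) t) :
    ∃ M : TM2ComputableInTime (id : List Γ' → List Γ') encodeBool (fun x => decide (x ∈ L)),
      M.time = T := by
  obtain ⟨N, hN⟩ := P.exists_below
  have h : P.Below (N + 1) := hN.mono (Nat.le_succ N)
  have key : ∀ x : List Γ', ∃ t ≤ T x.length,
      (flip bind (P.machine h).step)^[t] (some (initList (P.machine h) x)) =
        some (haltList (P.machine h) [decide (x ∈ L)]) := by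
    intro x
    obtain ⟨t, ht, hr⟩ := hP x
    refine ⟨t + 1, ht, ?_⟩
    obtain ⟨v', hv⟩ := hr.machineRun (P.machine h).m h some none (fun _ => rfl) none
    have hi : initList (P.machine h) x = ⟨some (some P.start), none, stackFam (N + 1) (x, fun _ => 0)⟩ := by
      unfold initList
      congr 1
      funext k
      rcases k with _ | i
      · rfl
      · rfl
    have hf : TM2.stepAux ((P.machine h).m none) v' (stackFam (N + 1)
        ([], Function.update (fun _ => 0) 0 (if x ∈ L then 1 else 0))) =
        haltList (P.machine h) [decide (x ∈ L)] := by
      have hst : ∀ n, stackFam (N + 1) ([], Function.update (fun _ => 0) 0 n) =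
          outputStack N (List.replicate n true) := by
        intro n
        funext k
        rcases k with _ | i
        · rfl
        · by_cases hi : i = 0
          · subst hi; simp [stackFam, outputStack]
          · have : (i : ℕ) ≠ 0 := fun e => hi (Fin.ext e)
            simp [stackFam, hi, this, outputStack]
      have hh : haltList (P.machine h) [decide (x ∈ L)] =
          ⟨none, none, outputStack N [decide (x ∈ L)]⟩ := by
        unfold haltList
        congr 1
        funext k
        rcases k with _ | i
        · rfl
        · by_cases hi : i = 0
          · subst hi; rfl
          · have h1 : ¬ (some i = (some 0 : Option (Fin (N + 1)))) := by simpa using hi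
            have h2 : outputStack N [decide (x ∈ L)] (some i) = [] := if_neg hi
            exact (dif_neg h1).trans h2.symm
      rw [hst, hh]
      have := stepAux_outputCode (N := N) (Λ := Option P.Lab) v' (decide (x ∈ L))
      simp only [decide_eq_true_eq] at this
      exact this
    have := MachineRun.trans hv (.single hf)
    rw [hi]
    exact this
  choose t ht1 ht2 using key
  exact ⟨{ tm := P.machine h
           inputAlphabet := Equiv.refl _
           outputAlphabet := Equiv.refl _
           time := T
           outputsFun := fun x =>
            { steps := t x
              evals_in_steps := by
                have h1 : (Equiv.refl Γ').invFun = id := rfl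
                have h2 : (Equiv.refl Bool).invFun = id := rfl
                have := ht2 x
                erw [List.map_id, List.map_id]
                exact this
              steps_le_m := ht1 x } }, rfl⟩

end EnergyGame

namespace EnergyGame

open Computability

/-! ### Basic counter programs -/

theorem Run.seq_le {P Q : Prog} {a b c : PState} {m n : ℕ} (h₁ : ∃ t ≤ m, Run P a b t)
    (h₂ : ∃ t ≤ n, Run Q b c t) : ∃ t ≤ m + n, Run (.seq P Q) a c t := by
  obtain ⟨t₁, l₁, h₁⟩ := h₁
  obtain ⟨t₂, l₂, h₂⟩ := h₂
  exact ⟨_, Nat.add_le_add l₁ l₂, h₁.seq h₂⟩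

theorem Run.inc_le (i : ℕ) {x : List Γ'} {s s' : ℕ → ℕ}
    (h : s' = Function.update s i (s i + 1)) : ∃ t ≤ 1, Run (.inc i) (x, s) (x, s') t := by
  subst h
  exact ⟨1, le_rfl, .inc i x s⟩

/-- `S k` is the state before round `k`. The body starts after the decrement, which accounts for the
`n - k - 1` and for the extra step per round. -/
theorem Run.loop_le {i : ℕ} {P : Prog} (x : List Γ') (c : ℕ) : ∀ (n : ℕ) (S : ℕ → ℕ → ℕ),
    (∀ k ≤ n, S k i = n - k) →
    (∀ k < n, ∃ t ≤ c, Run P (x, Function.update (S k) i (n - k - 1)) (x, S (k + 1)) t) →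
    ∃ t ≤ n * (c + 1) + 1, Run (.loop i P) (x, S 0) (x, S n) t := by
  intro n
  induction n with
  | zero =>
    intro S hi _
    exact ⟨1, by simp, .loop_zero (hi 0 le_rfl)⟩
  | succ n ih =>
    intro S hi hs
    obtain ⟨t₂, l₂, h₂⟩ := ih (fun k => S (k + 1)) (fun k hk => by rw [hi _ (by omega)]; omega)
      (fun k hk => by
        have := hs (k + 1) (by omega)
        rwa [show n + 1 - (k + 1) - 1 = n - k - 1 by omega] at this)
    obtain ⟨t₁, l₁, h₁⟩ := hs 0 (by omega)
    refine ⟨1 + t₁ + t₂, ?_, .loop_succ (hi 0 (by omega)) h₁ h₂⟩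
    have : (n + 1) * (c + 1) = n * (c + 1) + c + 1 := by ring
    omega

/-- Set counter `i` to zero. -/
def Prog.clear (i : ℕ) : Prog := .loop i .skip

theorem Run.clear_le (i : ℕ) {x : List Γ'} {s s' : ℕ → ℕ} (h : s' = Function.update s i 0) :
    ∃ t ≤ s i * 2 + 1, Run (.clear i) (x, s) (x, s') t := by
  have := Run.loop_le (i := i) (P := .skip) x 1 (s i)
    (fun k => Function.update s i (s i - k)) (by simp)
    (fun k _ => ⟨1, le_rfl, by
      simp only [Function.update_idem, Nat.sub_sub]
      exact .skip _⟩)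
  subst h
  simpa [Prog.clear] using this

/-- Add counter `i` to counter `j` and set counter `i` to zero. -/
def Prog.move (i j : ℕ) : Prog := .loop i (.inc j)

theorem Run.move_le {i j : ℕ} (hij : i ≠ j) {x : List Γ'} {s s' : ℕ → ℕ}
    (h : s' = Function.update (Function.update s i 0) j (s j + s i)) :
    ∃ t ≤ s i * 2 + 1, Run (.move i j) (x, s) (x, s') t := by
  have := Run.loop_le (i := i) (P := .inc j) x 1 (s i)
    (fun k => Function.update (Function.update s i (s i - k)) j (s j + k))
    (by intro k _; simp [hij])
    (fun k hk => Run.inc_le j (by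
      funext l
      by_cases h1 : l = j
      · subst h1; simp [hij.symm, add_assoc]
      · by_cases h2 : l = i
        · subst h2; simp [h1, Nat.sub_sub]
        · simp [h1, h2]))
  subst h
  simpa [Prog.move] using this

/-- Add counter `i` to counter `j` by means of the empty counter `k`. -/
def Prog.copy (i j k : ℕ) : Prog := .seq (.loop i (.seq (.inc j) (.inc k))) (.move k i)

theorem Run.copy_le {i j k : ℕ} (hij : i ≠ j) (hik : i ≠ k) (hjk : j ≠ k) {x : List Γ'}
    {s s' : ℕ → ℕ} (hk : s k = 0) (h : s' = Function.update s j (s j + s i)) :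
    ∃ t ≤ s i * 5 + 2, Run (.copy i j k) (x, s) (x, s') t := by
  have h₁ := Run.loop_le (i := i) (P := .seq (.inc j) (.inc k)) x 2 (s i)
    (fun l => Function.update (Function.update (Function.update s i (s i - l)) j (s j + l)) k l)
    (by intro l _; simp [hij, hik])
    (fun l _ => Run.seq_le (Run.inc_le j rfl) (Run.inc_le k (by
      funext q
      by_cases h1 : q = k
      · subst h1; simp [hjk.symm, hik.symm]
      · by_cases h2 : q = j
        · subst h2; simp [h1, hij.symm, add_assoc]
        · by_cases h3 : q = i
          · subst h3; simp [h1, h2, Nat.sub_sub]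
          · simp [h1, h2, h3])))
  have h₂ := Run.move_le (i := k) (j := i) hik.symm (x := x) (s := Function.update
    (Function.update (Function.update s i (s i - s i)) j (s j + s i)) k (s i)) (s' := s') (by
      subst h
      funext q
      by_cases h1 : q = k
      · subst h1; simp [hjk.symm, hik.symm, hk]
      · by_cases h2 : q = j
        · subst h2; simp [h1, hij.symm]
        · by_cases h3 : q = i
          · subst h3; simp [h1, h2]
          · simp [h1, h2, h3])
  have h₃ := Run.seq_le h₁ h₂
  have h0 : (Function.update (Function.update (Function.update s i (s i - 0)) j (s j + 0)) k 0)
      = s := by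
    funext q
    by_cases h1 : q = k
    · subst h1; simp [hk]
    · by_cases h2 : q = j
      · subst h2; simp [h1]
      · by_cases h3 : q = i
        · subst h3; simp [h1]
        · simp [h1]
  rw [h0] at h₃
  obtain ⟨t, ht, h₃⟩ := h₃
  refine ⟨t, ht.trans ?_, h₃⟩
  simp only [Function.update_self]
  omega

/-! ### Realizable functions -/

/-- Environments: tuples of natural numbers, listed with the last component first. -/
class Env (α : Type) where
  vals : α → List ℕ

instance : Env Unit := ⟨fun _ => []⟩

instance {α : Type} [Env α] : Env (α × ℕ) := ⟨fun p => p.2 :: Env.vals p.1⟩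

/-- The size of an environment. -/
def Env.size {α : Type} [Env α] (a : α) : ℕ := (Env.vals a).sum + 2

theorem Env.size_prod {α : Type} [Env α] (a : α) (n : ℕ) :
    Env.size (a, n) = Env.size a + n := by
  simp only [Env.size, Env.vals, List.sum_cons]; omega

/-- The summand `2` in the size makes its powers dominate constants and absorb the factor `2` in
sums. -/
theorem Env.two_le_size {α : Type} [Env α] (a : α) : 2 ≤ Env.size a := Nat.le_add_left _ _

/-- Functions that are bounded by a power of the size of the environment. -/
def PolyBdd {α : Type} [Env α] (f : α → ℕ) : Prop := ∃ c, ∀ a, f a ≤ Env.size a ^ c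

section
variable {α : Type} [Env α]

theorem PolyBdd.mono {f g : α → ℕ} (hg : PolyBdd g) (h : ∀ a, f a ≤ g a) : PolyBdd f :=
  hg.imp fun _ hc a => (h a).trans (hc a)

theorem PolyBdd.size : PolyBdd (fun a : α => Env.size a) := ⟨1, fun a => by simp⟩

theorem PolyBdd.const (n : ℕ) : PolyBdd (fun _ : α => n) :=
  ⟨n, fun a => n.lt_two_pow_self.le.trans (Nat.pow_le_pow_left (Env.two_le_size a) n)⟩

theorem PolyBdd.mul {f g : α → ℕ} (hf : PolyBdd f) (hg : PolyBdd g) :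
    PolyBdd (fun a => f a * g a) := by
  obtain ⟨c, hc⟩ := hf
  obtain ⟨d, hd⟩ := hg
  exact ⟨c + d, fun a => by rw [pow_add]; exact Nat.mul_le_mul (hc a) (hd a)⟩

theorem PolyBdd.add {f g : α → ℕ} (hf : PolyBdd f) (hg : PolyBdd g) :
    PolyBdd (fun a => f a + g a) := by
  obtain ⟨c, hc⟩ := hf
  obtain ⟨d, hd⟩ := hg
  refine ⟨max c d + 1, fun a => ?_⟩
  have h2 := Env.two_le_size a
  have h₁ := Nat.pow_le_pow_right (n := Env.size a) (by omega) (le_max_left c d)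
  have h₂ := Nat.pow_le_pow_right (n := Env.size a) (by omega) (le_max_right c d)
  have := hc a
  have := hd a
  rw [pow_succ]
  nlinarith

theorem PolyBdd.pow {f : α → ℕ} (hf : PolyBdd f) (c : ℕ) : PolyBdd (fun a => f a ^ c) := by
  obtain ⟨d, hd⟩ := hf
  exact ⟨d * c, fun a => by rw [pow_mul]; exact Nat.pow_le_pow_left (hd a) c⟩

theorem PolyBdd.snd : PolyBdd (fun p : α × ℕ => p.2) :=
  PolyBdd.size.mono fun p => by rw [← Prod.mk.eta (p := p), Env.size_prod]; simp

theorem PolyBdd.fst {f : α → ℕ} (hf : PolyBdd f) : PolyBdd (fun p : α × ℕ => f p.1) := by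
  obtain ⟨c, hc⟩ := hf
  refine ⟨c, fun p => (hc p.1).trans (Nat.pow_le_pow_left ?_ c)⟩
  rw [← Prod.mk.eta (p := p), Env.size_prod]; simp

/-- Functions on environments that are computed by counter programs, wherever the arguments are
stored and all of whose values and running times are bounded by a power of the size. -/
def Realizable (f : α → ℕ) : Prop :=
  PolyBdd f ∧ ∃ cost : α → ℕ, PolyBdd cost ∧ ∀ (r : List ℕ) (m : ℕ), (∀ i ∈ r, i < m) →
    ∃ P : Prog, ∀ a x s, r.map s = Env.vals a → (∀ j, m ≤ j → s j = 0) →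
      ∃ t ≤ cost a, Run P (x, s) (x, Function.update s m (f a)) t

theorem Realizable.zero : Realizable (fun _ : α => 0) :=
  ⟨.const 0, fun _ => 1, .const 1, fun r m _ => ⟨.skip, fun a x s _ hm => ⟨1, le_rfl, by
    rw [← hm m le_rfl, Function.update_eq_self]
    exact .skip _⟩⟩⟩

theorem Realizable.succ {f : α → ℕ} (hf : Realizable f) : Realizable (fun a => f a + 1) := by
  obtain ⟨hb, cost, hc, h⟩ := hf
  refine ⟨hb.add (.const 1), fun a => cost a + 1, hc.add (.const 1), fun r m hr => ?_⟩
  obtain ⟨P, hP⟩ := h r m hr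
  exact ⟨.seq P (.inc m), fun a x s hv hm => Run.seq_le (hP a x s hv hm) (Run.inc_le m (by simp))⟩

theorem Realizable.snd : Realizable (fun p : α × ℕ => p.2) := by
  refine ⟨.snd, fun p => p.2 * 5 + 2, (PolyBdd.snd.mul (.const 5)).add (.const 2),
    fun r m hr => ?_⟩
  cases r with
  | nil => exact ⟨.skip, fun a x s hv => by simp [Env.vals] at hv⟩
  | cons i r =>
    have hi : i < m := hr i (by simp)
    refine ⟨.copy i m (m + 1), fun a x s hv hm => ?_⟩
    have hv' : s i = a.2 := by simp only [Env.vals, List.map_cons, List.cons.injEq] at hv; exact hv.1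
    simp only [← hv']
    exact Run.copy_le (by omega) (by omega) (by omega) (hm _ (by omega))
      (by rw [hm m le_rfl, zero_add])

theorem Realizable.fst {f : α → ℕ} (hf : Realizable f) :
    Realizable (fun p : α × ℕ => f p.1) := by
  obtain ⟨hb, cost, hc, h⟩ := hf
  refine ⟨hb.fst, fun p => cost p.1, hc.fst, fun r m hr => ?_⟩
  cases r with
  | nil => exact ⟨.skip, fun a x s hv => by simp [Env.vals] at hv⟩
  | cons i r =>
    obtain ⟨P, hP⟩ := h r m fun j hj => hr j (by simp [hj])
    refine ⟨P, fun a x s hv hm => hP a.1 x s ?_ hm⟩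
    simp only [Env.vals, List.map_cons, List.cons.injEq] at hv
    exact hv.2

theorem Realizable.congr {f g : α → ℕ} (hf : Realizable f) (h : ∀ a, g a = f a) :
    Realizable g := by
  rwa [show g = f from funext h]

/-- The state `s` with the counters `m`, `m + 1`, `m + 2`, `m + 3` replaced. -/
def setFour (s : ℕ → ℕ) (m a b c d : ℕ) : ℕ → ℕ := fun j =>
  if j = m then a else if j = m + 1 then b else if j = m + 2 then c else if j = m + 3 then d else s j

/-- Bounded primitive recursion is the only closure principle that needs a program of its own;
arithmetic and bounded quantifiers are instances. The bound `M` on all intermediate values is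
essential, as iterating a polynomially bounded step may grow far beyond any polynomial. -/
theorem Realizable.rec {n base M : α → ℕ} {step : (α × ℕ) × ℕ → ℕ} (hn : Realizable n)
    (hbase : Realizable base) (hstep : Realizable step) (hM : PolyBdd M)
    (hle : ∀ a, ∀ i ≤ n a,
      Nat.rec (motive := fun _ => ℕ) (base a) (fun i acc => step ((a, i), acc)) i ≤ M a) :
    Realizable (fun a =>
      Nat.rec (motive := fun _ => ℕ) (base a) (fun i acc => step ((a, i), acc)) (n a)) := by
  obtain ⟨hbn, cn, hcn, hn⟩ := hn
  obtain ⟨hbb, cb, hcb, hbase⟩ := hbase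
  obtain ⟨-, cs, ⟨c, hcs⟩, hstep⟩ := hstep
  set g : α → ℕ → ℕ := fun a i =>
    Nat.rec (motive := fun _ => ℕ) (base a) (fun i acc => step ((a, i), acc)) i with hg
  change Realizable fun a => g a (n a)
  -- Bound for one round: the step program runs on an environment of size at most `Env.size a + n a
  -- + M a`, then clearing and moving the accumulator costs time linear in `M a`.
  set W : α → ℕ := fun a => (Env.size a + n a + M a) ^ c + ((M a * 2 + 1) + ((M a * 2 + 1) + 1))
    with hW
  have hWb : PolyBdd W := (((PolyBdd.size.add hbn).add hM).pow c).add
    (((hM.mul (.const 2)).add (.const 1)).add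
      (((hM.mul (.const 2)).add (.const 1)).add (.const 1)))
  refine ⟨hM.mono fun a => hle a (n a) le_rfl, fun a => cn a + (cb a + ((n a * (W a + 1) + 1) +
    ((n a * 2 + 1) + (M a * 2 + 1)))), hcn.add (hcb.add (((hbn.mul (hWb.add (.const 1))).add
      (.const 1)).add (((hbn.mul (.const 2)).add (.const 1)).add
      ((hM.mul (.const 2)).add (.const 1))))), fun r m hr => ?_⟩
  obtain ⟨Pn, hPn⟩ := hn r m hr
  obtain ⟨Pb, hPb⟩ := hbase r (m + 1) fun i hi => (hr i hi).trans (Nat.lt_succ_self m)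
  obtain ⟨Ps, hPs⟩ := hstep ((m + 1) :: (m + 2) :: r) (m + 3) (by
    intro i hi
    simp only [List.mem_cons] at hi
    rcases hi with rfl | rfl | hi
    · omega
    · omega
    · have := hr i hi; omega)
  -- Counter `m` holds the remaining rounds, `m + 1` the accumulator, `m + 2` the index and `m + 3`
  -- the next accumulator.
  refine ⟨.seq Pn (.seq Pb (.seq (.loop m (.seq Ps (.seq (.clear (m + 1))
    (.seq (.move (m + 3) (m + 1)) (.inc (m + 2)))))) (.seq (.clear (m + 2)) (.move (m + 1) m)))),
    fun a x s hv hm => ?_⟩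
  have hmap : ∀ s' : ℕ → ℕ, (∀ j < m, s' j = s j) → r.map s' = Env.vals a := by
    intro s' h
    rw [← hv]
    exact List.map_congr_left fun i hi => h i (hr i hi)
  have e1 := hPn a x s hv hm
  have e2 := hPb a x (Function.update s m (n a))
    (hmap _ fun j hj => Function.update_of_ne hj.ne _ _)
    (fun j hj => by rw [Function.update_of_ne (by omega)]; exact hm j (by omega))
  have hs2 : Function.update (Function.update s m (n a)) (m + 1) (base a) =
      setFour s m (n a - 0) (g a 0) 0 0 := by
    funext j
    simp only [Function.update_apply, setFour]
    split_ifs <;> first | rfl | omega | (rw [hm]; omega)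
  rw [hs2] at e2
  have e3 := Run.loop_le (i := m) (P := .seq Ps (.seq (.clear (m + 1))
    (.seq (.move (m + 3) (m + 1)) (.inc (m + 2))))) x (W a) (n a)
    (fun k => setFour s m (n a - k) (g a k) k 0) (by intro k _; simp [setFour]) (by
      intro k hk
      have hgk := hle a k hk.le
      have hgk1 := hle a (k + 1) hk
      have f1 := hPs ((a, k), g a k) x (Function.update (setFour s m (n a - k) (g a k) k 0) m
        (n a - k - 1)) (by
          simp only [List.map_cons, Env.vals]
          congr 1
          · simp [setFour]
          · congr 1
            · simp [setFour]
            · apply hmap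
              intro j hj
              rw [Function.update_of_ne hj.ne]
              simp only [setFour]
              split_ifs <;> first | rfl | omega) (by
          intro j hj
          rw [Function.update_of_ne (by omega)]
          simp only [setFour]
          split_ifs <;> first | rfl | omega | exact hm j (by omega))
      have hc1 : cs ((a, k), g a k) ≤ (Env.size a + n a + M a) ^ c := by
        refine (hcs _).trans (Nat.pow_le_pow_left ?_ c)
        rw [Env.size_prod, Env.size_prod]
        change g a k ≤ M a at hgk
        omega
      have h1 : Function.update (Function.update (setFour s m (n a - k) (g a k) k 0) m
          (n a - k - 1)) (m + 3) (step ((a, k), g a k)) =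
          setFour s m (n a - k - 1) (g a k) k (g a (k + 1)) := by
        funext j
        simp only [Function.update_apply, setFour]
        split_ifs <;> first | rfl | omega
      rw [h1] at f1
      obtain ⟨t1, l1, f1⟩ := f1
      obtain ⟨t2, l2, f2⟩ := Run.clear_le (m + 1) (x := x)
        (s := setFour s m (n a - k - 1) (g a k) k (g a (k + 1)))
        (s' := setFour s m (n a - k - 1) 0 k (g a (k + 1))) (by
          funext j
          simp only [Function.update_apply, setFour]
          split_ifs <;> first | rfl | omega)
      obtain ⟨t3, l3, f3⟩ := Run.move_le (i := m + 3) (j := m + 1) (by omega) (x := x)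
        (s := setFour s m (n a - k - 1) 0 k (g a (k + 1)))
        (s' := setFour s m (n a - k - 1) (g a (k + 1)) k 0) (by
          funext j
          simp only [Function.update_apply, setFour]
          split_ifs <;> first | rfl | omega)
      have f4 := Run.inc_le (m + 2) (x := x)
        (s := setFour s m (n a - k - 1) (g a (k + 1)) k 0)
        (s' := setFour s m (n a - (k + 1)) (g a (k + 1)) (k + 1) 0) (by
          funext j
          simp only [Function.update_apply, setFour]
          split_ifs <;> first | rfl | omega)
      have v2 : setFour s m (n a - k - 1) (g a k) k (g a (k + 1)) (m + 1) = g a k := by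
        simp [setFour]
      have v3 : setFour s m (n a - k - 1) 0 k (g a (k + 1)) (m + 3) = g a (k + 1) := by
        simp [setFour]
      rw [v2] at l2
      rw [v3] at l3
      change g a k ≤ M a at hgk
      change g a (k + 1) ≤ M a at hgk1
      exact Run.seq_le ⟨t1, l1.trans hc1, f1⟩ (Run.seq_le ⟨t2, by omega, f2⟩
        (Run.seq_le ⟨t3, by omega, f3⟩ f4)))
  have hgn : g a (n a) ≤ M a := hle a (n a) le_rfl
  obtain ⟨t4, l4, e4⟩ := Run.clear_le (m + 2) (x := x)
    (s := setFour s m (n a - n a) (g a (n a)) (n a) 0)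
    (s' := setFour s m 0 (g a (n a)) 0 0) (by
      funext j
      simp only [Function.update_apply, setFour]
      split_ifs <;> first | rfl | omega)
  obtain ⟨t5, l5, e5⟩ := Run.move_le (i := m + 1) (j := m) (by omega) (x := x)
    (s := setFour s m 0 (g a (n a)) 0 0)
    (s' := Function.update s m (g a (n a))) (by
      funext j
      simp only [Function.update_apply, setFour]
      split_ifs <;> first | rfl | omega | (rw [hm]; omega))
  have v4 : setFour s m (n a - n a) (g a (n a)) (n a) 0 (m + 2) = n a := by simp [setFour]
  have v5 : setFour s m 0 (g a (n a)) 0 0 (m + 1) = g a (n a) := by simp [setFour]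
  rw [v4] at l4
  rw [v5] at l5
  exact Run.seq_le e1 (Run.seq_le e2 (Run.seq_le e3 (Run.seq_le ⟨t4, l4, e4⟩ ⟨t5, by omega, e5⟩)))

end

end EnergyGame

namespace EnergyGame

/-! ### Arithmetic and bounded quantifiers -/

section
variable {α : Type} [Env α]

theorem Realizable.const (n : ℕ) : Realizable (fun _ : α => n) := by
  induction n with
  | zero => exact .zero
  | succ n ih => exact ih.succ

theorem Realizable.add {f g : α → ℕ} (hf : Realizable f) (hg : Realizable g) :
    Realizable (fun a => f a + g a) := by
  have key : ∀ a i, Nat.rec (motive := fun _ => ℕ) (f a) (fun _ acc => acc + 1) i = f a + i := by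
    intro a i
    induction i with
    | zero => rfl
    | succ i ih => simp only [ih]; ring
  refine (Realizable.rec (M := fun a => f a + g a) hg hf (Realizable.snd.succ) (hf.1.add hg.1)
    fun a i hi => ?_).congr fun a => (key a (g a)).symm
  have := key a i
  simp only at this ⊢
  omega

/-- The recursion ignores the accumulator and returns the last index. -/
theorem Realizable.pred {f : α → ℕ} (hf : Realizable f) : Realizable (fun a => f a - 1) := by
  have key : ∀ i, Nat.rec (motive := fun _ => ℕ) 0 (fun i _ => i) i = i - 1 := by
    intro i; cases i <;> rfl
  refine (Realizable.rec (M := f) hf .zero (Realizable.snd.fst) hf.1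
    fun a i hi => ?_).congr fun a => (key (f a)).symm
  have := key i
  simp only at this ⊢
  omega

theorem Realizable.sub {f g : α → ℕ} (hf : Realizable f) (hg : Realizable g) :
    Realizable (fun a => f a - g a) := by
  have key : ∀ a i, Nat.rec (motive := fun _ => ℕ) (f a) (fun _ acc => acc - 1) i = f a - i := by
    intro a i
    induction i with
    | zero => rfl
    | succ i ih => simp only [ih]; omega
  refine (Realizable.rec (M := f) hg hf (Realizable.snd.pred) hf.1
    fun a i hi => ?_).congr fun a => (key a (g a)).symm
  have := key a i
  simp only at this ⊢
  omega

theorem Realizable.mul {f g : α → ℕ} (hf : Realizable f) (hg : Realizable g) :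
    Realizable (fun a => f a * g a) := by
  have key : ∀ a i, Nat.rec (motive := fun _ => ℕ) 0 (fun _ acc => acc + f a) i = f a * i := by
    intro a i
    induction i with
    | zero => rfl
    | succ i ih => simp only [ih]; ring
  refine (Realizable.rec (M := fun a => f a * g a) hg .zero (Realizable.snd.add hf.fst.fst)
    (hf.1.mul hg.1) fun a i hi => ?_).congr fun a => (key a (g a)).symm
  have := key a i
  simp only at this ⊢
  rw [this]
  exact Nat.mul_le_mul_left _ hi

/-! ### Realizable predicates and bounded quantifiers -/

open Classical in
/-- Predicates on environments whose characteristic functions are realizable. -/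
def RealizablePred (p : α → Prop) : Prop := Realizable (fun a => if p a then 1 else 0)

theorem RealizablePred.congr {p q : α → Prop} (hp : RealizablePred p) (h : ∀ a, q a ↔ p a) :
    RealizablePred q := by
  rwa [show q = p from funext fun a => propext (h a)]

theorem RealizablePred.not {p : α → Prop} (hp : RealizablePred p) :
    RealizablePred (fun a => ¬ p a) :=
  ((Realizable.const 1).sub hp).congr fun a => by by_cases h : p a <;> simp [h]

theorem RealizablePred.and {p q : α → Prop} (hp : RealizablePred p) (hq : RealizablePred q) :
    RealizablePred (fun a => p a ∧ q a) :=
  (Realizable.mul hp hq).congr fun a => by by_cases h : p a <;> by_cases h' : q a <;> simp [h, h']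

theorem RealizablePred.or {p q : α → Prop} (hp : RealizablePred p) (hq : RealizablePred q) :
    RealizablePred (fun a => p a ∨ q a) :=
  (hp.not.and hq.not).not.congr fun a => by tauto

theorem RealizablePred.imp {p q : α → Prop} (hp : RealizablePred p) (hq : RealizablePred q) :
    RealizablePred (fun a => p a → q a) :=
  (hp.not.or hq).congr fun a => by tauto

theorem Realizable.eq_zero {f : α → ℕ} (hf : Realizable f) : RealizablePred (fun a => f a = 0) :=
  ((Realizable.const 1).sub hf).congr fun a => by
    by_cases h : f a = 0
    · simp [h]
    · simp only [h, if_false]; omega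

theorem Realizable.le {f g : α → ℕ} (hf : Realizable f) (hg : Realizable g) :
    RealizablePred (fun a => f a ≤ g a) :=
  (hf.sub hg).eq_zero.congr fun a => by omega

theorem Realizable.eq {f g : α → ℕ} (hf : Realizable f) (hg : Realizable g) :
    RealizablePred (fun a => f a = g a) :=
  ((hf.le hg).and (hg.le hf)).congr fun a => by omega

open Classical in
theorem Realizable.ite {p : α → Prop} {f g : α → ℕ} (hp : RealizablePred p) (hf : Realizable f)
    (hg : Realizable g) : Realizable (fun a => if p a then f a else g a) :=
  ((Realizable.mul hp hf).add (Realizable.mul hp.not hg)).congr fun a => by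
    by_cases h : p a <;> simp [h]

/-- The recursion counts the witnesses below `n`; the count is at most `n` and nonzero exactly if a
witness exists. -/
theorem RealizablePred.exists_lt {n : α → ℕ} {p : α × ℕ → Prop} (hn : Realizable n)
    (hp : RealizablePred p) : RealizablePred (fun a => ∃ i < n a, p (a, i)) := by
  classical
  have key : ∀ a i, Nat.rec (motive := fun _ => ℕ) 0
      (fun i acc => acc + if p (a, i) then 1 else 0) i ≤ i ∧
      (Nat.rec (motive := fun _ => ℕ) 0 (fun i acc => acc + if p (a, i) then 1 else 0) i ≠ 0 ↔
        ∃ j < i, p (a, j)) := by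
    intro a i
    induction i with
    | zero => simp
    | succ i ih =>
      simp only at ih ⊢
      constructor
      · split_ifs <;> omega
      · rw [Nat.exists_lt_succ_right, ← ih.2]
        by_cases h : p (a, i) <;> simp [h]
  have h := (Realizable.rec (M := n) hn .zero (Realizable.snd.add (Realizable.fst hp)) hn.1
    (fun a i hi => (key a i).1.trans hi)).eq_zero.not
  exact h.congr fun a => (key a (n a)).2.symm

theorem RealizablePred.forall_lt {n : α → ℕ} {p : α × ℕ → Prop} (hn : Realizable n)
    (hp : RealizablePred p) : RealizablePred (fun a => ∀ i < n a, p (a, i)) :=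
  (RealizablePred.exists_lt hn hp.not).not.congr fun a => by push Not; rfl

/-- The quotient is incremented `f a` times as long as its product with `g a` does not exceed `f a`.
For divisor `0` this would give `f a` instead of `0`, hence the final case distinction. -/
theorem Realizable.div {f g : α → ℕ} (hf : Realizable f) (hg : Realizable g) :
    Realizable (fun a => f a / g a) := by
  classical
  have key : ∀ a i, Nat.rec (motive := fun _ => ℕ) 0
      (fun _ acc => if (acc + 1) * g a ≤ f a then acc + 1 else acc) i =
      if g a = 0 then i else min i (f a / g a) := by
    intro a i
    induction i with
    | zero => simp
    | succ i ih =>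
      simp only at ih ⊢
      rw [ih]
      by_cases h : g a = 0
      · simp [h]
      · simp only [h, if_false]
        have hpos : 0 < g a := Nat.pos_of_ne_zero h
        simp only [← Nat.le_div_iff_mul_le hpos]
        split_ifs <;> omega
  have h := Realizable.rec (M := f) hf .zero (Realizable.ite
    ((Realizable.snd.succ.mul hg.fst.fst).le hf.fst.fst) Realizable.snd.succ Realizable.snd) hf.1
    (fun a i hi => by
      have := key a i
      simp only at this ⊢
      rw [this]
      split_ifs <;> omega)
  refine (Realizable.ite hg.eq_zero (.const 0) h).congr fun a => ?_
  have := key a (f a)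
  simp only at this ⊢
  rw [this]
  by_cases h : g a = 0
  · simp [h]
  · simp only [h, if_false]
    exact (min_eq_right (Nat.div_le_self _ _)).symm

theorem Realizable.mod {f g : α → ℕ} (hf : Realizable f) (hg : Realizable g) :
    Realizable (fun a => f a % g a) :=
  (hf.sub (hg.mul (hf.div hg))).congr fun a => by
    have := Nat.div_add_mod (f a) (g a)
    omega

theorem Realizable.min {f g : α → ℕ} (hf : Realizable f) (hg : Realizable g) :
    Realizable (fun a => min (f a) (g a)) :=
  (Realizable.ite (hf.le hg) hf hg).congr fun a => by
    rw [min_def]; congr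

theorem Realizable.pow {f : α → ℕ} (hf : Realizable f) (n : ℕ) :
    Realizable (fun a => f a ^ n) := by
  induction n with
  | zero => simpa using Realizable.const 1
  | succ n ih => simpa only [pow_succ] using ih.mul hf

/-- Powers, cut off at a bound. -/
theorem Realizable.min_pow {f g B : α → ℕ} (hf : Realizable f) (hg : Realizable g)
    (hB : Realizable B) (h0 : ∀ a, 0 < f a) : Realizable (fun a => Min.min (f a ^ g a) (B a)) := by
  have key : ∀ a i, Nat.rec (motive := fun _ => ℕ) (Min.min 1 (B a))
      (fun _ acc => Min.min (acc * f a) (B a)) i = Min.min (f a ^ i) (B a) := by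
    intro a i
    induction i with
    | zero => simp
    | succ i ih =>
      simp only at ih ⊢
      rw [ih, pow_succ]
      -- Since the base is positive, a product that has reached the cut-off stays there.
      rcases le_total (f a ^ i) (B a) with h | h
      · rw [min_eq_left h]
      · rw [min_eq_right h, min_eq_right (Nat.le_mul_of_pos_right _ (h0 a)),
          min_eq_right (h.trans (Nat.le_mul_of_pos_right _ (h0 a)))]
  refine (Realizable.rec (M := B) hg ((Realizable.const 1).min hB)
    ((Realizable.snd.mul hf.fst.fst).min hB.fst.fst) hB.1
    fun a i hi => ?_).congr fun a => (key a (g a)).symm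
  have := key a i
  simp only at this ⊢
  rw [this]
  exact min_le_right _ _

end

end EnergyGame

namespace EnergyGame

/-! ### Walks and closed sets of configurations -/

section
variable {V : Type}

/-- Walks inside `U` of a given length and a given total weight. -/
inductive Walk (U : Set V) (E : V → V → Prop) (w : V → V → ℤ) : ℕ → V → V → ℤ → Prop
  | nil {v} : v ∈ U → Walk U E w 0 v v 0
  | cons {n v u z s} : v ∈ U → E v u → Walk U E w n u z s → Walk U E w (n + 1) v z (w v u + s)

variable {U : Set V} {E : V → V → Prop} {w : V → V → ℤ}

theorem Walk.cast {n m : ℕ} {u v : V} {s t : ℤ} (h : Walk U E w n u v s) (hn : n = m)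
    (hs : s = t) : Walk U E w m u v t := by
  subst hn hs; exact h

theorem Walk.left_mem {n : ℕ} {u v : V} {s : ℤ} (h : Walk U E w n u v s) : u ∈ U := by
  cases h <;> assumption

theorem Walk.trans {n m : ℕ} {u v z : V} {s t : ℤ} (h₁ : Walk U E w n u v s)
    (h₂ : Walk U E w m v z t) : Walk U E w (n + m) u z (s + t) := by
  induction h₁ with
  | nil _ => simpa using h₂
  | cons hv he _ ih => exact (Walk.cons hv he (ih h₂)).cast (by omega) (by ring)

theorem Walk.repeat {n : ℕ} {v : V} {s : ℤ} (h : Walk U E w n v v s) (k : ℕ) :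
    Walk U E w (k * n) v v (k * s) := by
  induction k with
  | zero => simpa using Walk.nil h.left_mem
  | succ k ih => exact (ih.trans h).cast (by ring) (by push_cast; ring)

theorem Walk.abs_le {W : ℕ} (hW : ∀ v u, E v u → |w v u| ≤ W) {n : ℕ} {u v : V} {s : ℤ}
    (h : Walk U E w n u v s) : |s| ≤ W * n := by
  induction h with
  | nil _ => simp
  | cons _ he _ ih =>
    refine (abs_add_le _ _).trans ?_
    have := hW _ _ he
    push_cast
    linarith

theorem Walk.of_path {f : ℕ → V} {g : ℕ → ℤ} {n : ℕ} (hU : ∀ i ≤ n, f i ∈ U)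
    (hE : ∀ i < n, E (f i) (f (i + 1)) ∧ g (i + 1) = g i + w (f i) (f (i + 1))) {i k : ℕ}
    (h : i + k ≤ n) : Walk U E w k (f i) (f (i + k)) (g (i + k) - g i) := by
  induction k generalizing i with
  | zero => exact (Walk.nil (hU i (by omega))).cast rfl (by simp)
  | succ k ih =>
    have h1 := ih (i := i + 1) (by omega)
    have h2 := hE i (by omega)
    rw [show i + 1 + k = i + (k + 1) by omega] at h1
    exact (Walk.cons (hU i (by omega)) h2.1 h1).cast rfl (by rw [h2.2]; ring)

theorem Walk.exists_path {n : ℕ} {u v : V} {s : ℤ} (h : Walk U E w n u v s) :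
    ∃ (f : ℕ → V) (g : ℕ → ℤ), f 0 = u ∧ f n = v ∧ g 0 = 0 ∧ g n = s ∧ (∀ i ≤ n, f i ∈ U) ∧
      ∀ i < n, E (f i) (f (i + 1)) ∧ g (i + 1) = g i + w (f i) (f (i + 1)) := by
  induction h with
  | @nil v hv => exact ⟨fun _ => v, fun _ => 0, rfl, rfl, rfl, rfl, fun _ _ => hv, by simp⟩
  | @cons n v u z s hv he h ih =>
    obtain ⟨f, g, hf0, hfn, hg0, hgn, hU, hE⟩ := ih
    refine ⟨fun i => Nat.casesOn i v f, fun i => Nat.casesOn i 0 fun i => w v u + g i, rfl, hfn,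
      rfl, by simp [hgn], ?_, ?_⟩
    · intro i hi
      cases i with
      | zero => exact hv
      | succ i => exact hU i (by omega)
    · intro i hi
      cases i with
      | zero => simpa [hf0, hg0] using he
      | succ i =>
        have := hE i (by omega)
        refine ⟨this.1, ?_⟩
        simp only [this.2]
        ring

/-- Pigeonhole principle on the first `Fintype.card V + 1` vertices, which also bounds the length of
the cycle. -/
theorem Walk.exists_cycle [Fintype V] {n : ℕ} {u v : V} {s : ℤ} (h : Walk U E w n u v s)
    (hn : Fintype.card V ≤ n) : ∃ y a l c s₁ s₂ s₃, n = a + l + c ∧ 1 ≤ l ∧ l ≤ Fintype.card V ∧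
      Walk U E w a u y s₁ ∧ Walk U E w l y y s₂ ∧ Walk U E w c y v s₃ ∧ s = s₁ + s₂ + s₃ := by
  obtain ⟨f, g, hf0, hfn, hg0, hgn, hU, hE⟩ := h.exists_path
  have : ¬ Function.Injective (fun i : Fin (Fintype.card V + 1) => f i) := fun hinj => by
    simpa using Fintype.card_le_of_injective _ hinj
  have : ∃ i j : ℕ, i < j ∧ j ≤ Fintype.card V ∧ f i = f j := by
    simp only [Function.Injective, not_forall] at this
    obtain ⟨i, j, hij, hne⟩ := this
    have hne' : (i : ℕ) ≠ j := fun h => hne (Fin.ext h)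
    rcases lt_or_gt_of_ne hne' with h | h
    · exact ⟨i, j, h, by omega, hij⟩
    · exact ⟨j, i, h, by omega, hij.symm⟩
  obtain ⟨i, j, hij, hj, hfij⟩ := this
  have w1 := Walk.of_path (U := U) (E := E) (w := w) hU hE (i := 0) (k := i) (by omega)
  have w2 := Walk.of_path (U := U) (E := E) (w := w) hU hE (i := i) (k := j - i) (by omega)
  have w3 := Walk.of_path (U := U) (E := E) (w := w) hU hE (i := j) (k := n - j) (by omega)
  rw [zero_add, hf0] at w1
  rw [show i + (j - i) = j by omega, ← hfij] at w2
  rw [show j + (n - j) = n by omega, ← hfij, hfn] at w3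
  exact ⟨f i, i, j - i, n - j, _, _, _, by omega, by omega, by omega, w1, w2, w3,
    by rw [hg0, hgn]; ring⟩

theorem Walk.shorten [Fintype V] : ∀ {n : ℕ} {u v : V} {s : ℤ}, Walk U E w n u v s →
    ∃ m ≤ Fintype.card V, ∃ t, Walk U E w m u v t := by
  intro n
  induction n using Nat.strong_induction_on with
  | _ n ih =>
    intro u v s h
    by_cases hn : n ≤ Fintype.card V
    · exact ⟨n, hn, s, h⟩
    · obtain ⟨y, a, l, c, s₁, s₂, s₃, hac, hl, -, h₁, -, h₃, -⟩ := h.exists_cycle (by omega)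
      exact ih (a + c) (by omega) (h₁.trans h₃)

/-- A closed walk of nonpositive weight (with respect to the sign `ε`) visits a vertex with a short
closed walk of nonpositive weight. -/
theorem Walk.exists_short_cycle [Fintype V] (ε : ℤ) : ∀ {n : ℕ} {x : V} {s : ℤ},
    Walk U E w n x x s → 1 ≤ n → ε * s ≤ 0 →
    ∃ y a l c s₁ s₂ s₃, 1 ≤ l ∧ l ≤ Fintype.card V ∧
      Walk U E w a x y s₁ ∧ Walk U E w l y y s₂ ∧ Walk U E w c y x s₃ ∧ ε * s₂ ≤ 0 := by
  intro n
  induction n using Nat.strong_induction_on with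
  | _ n ih =>
    intro x s h hn1 hs
    by_cases hn : n ≤ Fintype.card V
    · exact ⟨x, 0, n, 0, 0, s, 0, hn1, hn, .nil h.left_mem, h, .nil h.left_mem, hs⟩
    · obtain ⟨y, a, l, c, s₁, s₂, s₃, hac, hl, hl', h₁, h₂, h₃, hss⟩ := h.exists_cycle (by omega)
      by_cases h2 : ε * s₂ ≤ 0
      · exact ⟨y, a, l, c, s₁, s₂, s₃, hl, hl', h₁, h₂, h₃, h2⟩
      -- Removing a cycle of positive signed weight leaves a closed walk of nonpositive signed
      -- weight, and it is nonempty because `n` exceeds the length of the cycle.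
      · exact ih (a + c) (by omega) (h₁.trans h₃) (by omega) (by
          subst hss; push Not at h2; linarith)

/-! ### Keeping the energy level in a window -/

/-- A set of configurations, that is, vertices with an energy level, in which Player 0 can stay. -/
def ClosedSet (own : V → Fin 2) (E : V → V → Prop) (w : V → V → ℤ) (S : Set (V × ℤ)) : Prop :=
  ∀ v e, (v, e) ∈ S → (own v = 0 → ∃ u, E v u ∧ (u, e + w v u) ∈ S) ∧
    (own v = 1 → ∀ u, E v u → (u, e + w v u) ∈ S)

variable {own : V → Fin 2}

theorem fin_two_cases (a : Fin 2) : a = 0 ∨ a = 1 := by omega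

/-- If Player 1 has no choice and a vertex with short closed walks of both signs is near `x`,
then the energy level can be kept in a small window. -/
theorem exists_closedSet_of_hub {W L : ℕ} (hW : ∀ v u, E v u → |w v u| ≤ W)
    (huniq : ∀ v ∈ U, own v = 1 → ∀ u u', E v u → E v u' → u = u') {x z : V}
    (hx : ∃ n ≤ L, ∃ s, Walk U E w n x z s)
    (hneg : ∃ n, 1 ≤ n ∧ n ≤ L ∧ ∃ s ≤ 0, Walk U E w n z z s)
    (hpos : ∃ n, 1 ≤ n ∧ n ≤ L ∧ ∃ s, 0 ≤ s ∧ Walk U E w n z z s) :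
    ∃ S, ClosedSet own E w S ∧ (x, 0) ∈ S ∧
      ∀ p ∈ S, p.1 ∈ U ∧ |p.2| ≤ ((2 * (W * L) : ℕ) : ℤ) := by
  have bound : ∀ {n u v s}, n ≤ L → Walk U E w n u v s → |s| ≤ ((W * L : ℕ) : ℤ) := by
    intro n u v s hn h
    refine (h.abs_le hW).trans ?_
    exact_mod_cast Nat.mul_le_mul_left W hn
  set D : ℤ := ((W * L : ℕ) : ℤ) with hD
  have hD2 : ((2 * (W * L) : ℕ) : ℤ) = 2 * D := by rw [hD]; push_cast; ring
  -- Configurations from which some short walk reaches the hub `z` with level in `[-D, D]`. The walk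
  -- itself has weight at most `D` in absolute value, so all levels are at most `2 * D`.
  refine ⟨{p | ∃ n ≤ L, ∃ s, Walk U E w n p.1 z s ∧ |p.2 + s| ≤ D}, ?_, ?_, ?_⟩
  · intro v e hve
    have key : v ∈ U ∧ ∃ u, E v u ∧ ∃ n ≤ L, ∃ s, Walk U E w n u z s ∧ |e + w v u + s| ≤ D := by
      have step : ∀ {n s}, 1 ≤ n → n ≤ L → Walk U E w n v z s → |e + s| ≤ D →
          v ∈ U ∧ ∃ u, E v u ∧ ∃ n ≤ L, ∃ s, Walk U E w n u z s ∧ |e + w v u + s| ≤ D := by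
        intro n s hn1 hn h he
        cases h with
        | nil _ => omega
        | @cons m _ u _ s' hv hvu h =>
          exact ⟨hv, u, hvu, m, by omega, s', h, by rwa [← add_assoc] at he⟩
      obtain ⟨n, hn, s, h, he⟩ := hve
      by_cases hn1 : 1 ≤ n
      · exact step hn1 hn h he
      · have : n = 0 := by omega
        subst this
        cases h
        rw [add_zero] at he
        have he' := abs_le.1 he
        -- At the hub the next closed walk has sign opposite to the level, so its end is again in
        -- `[-D, D]`.
        by_cases h0 : 0 ≤ e
        · obtain ⟨n, hn1, hn, s, hs, h⟩ := hneg
          have := abs_le.1 (bound hn h)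
          exact step hn1 hn h (abs_le.2 ⟨by linarith, by linarith⟩)
        · obtain ⟨n, hn1, hn, s, hs, h⟩ := hpos
          have := abs_le.1 (bound hn h)
          exact step hn1 hn h (abs_le.2 ⟨by linarith, by linarith⟩)
    obtain ⟨hv, u, hvu, hu⟩ := key
    refine ⟨fun _ => ⟨u, hvu, hu⟩, fun h1 u' hu' => ?_⟩
    rw [huniq v hv h1 u' u hu' hvu]
    exact hu
  · obtain ⟨n, hn, s, h⟩ := hx
    exact ⟨n, hn, s, h, by simpa using bound hn h⟩
  · rintro ⟨v, e⟩ ⟨n, hn, s, h, he⟩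
    refine ⟨h.left_mem, ?_⟩
    have h1 := abs_le.1 (bound hn h)
    have h2 := abs_le.1 he
    rw [hD2]
    exact abs_le.2 ⟨by simp only at h2; linarith, by simp only at h2; linarith⟩

/-- The length of walks that suffice if Player 1 has no choice. -/
def walkBound (N W : ℕ) : ℕ := 2 * N + (2 * N * W + 1) * N

/-- When Player 1 has no choice, any walk inside the projection `U` of `S₀` can be realized by
Player 0. It therefore suffices to find a vertex near `x` with short closed walks of both signs. -/
theorem exists_closedSet_of_unique [Fintype V] {W : ℕ} (hW : ∀ v u, E v u → |w v u| ≤ W)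
    (hE : ∀ v, ∃ u, E v u) {S₀ : Set (V × ℤ)} (hS₀ : ClosedSet own E w S₀) {b : ℤ}
    (hb : ∀ p ∈ S₀, |p.2| ≤ b)
    (huniq : ∀ v, (∃ e, (v, e) ∈ S₀) → own v = 1 → ∀ u u', E v u → E v u' → u = u')
    {x : V} {e : ℤ} (hx : (x, e) ∈ S₀) :
    ∃ S, ClosedSet own E w S ∧ (x, 0) ∈ S ∧ ∀ p ∈ S, (∃ e, (p.1, e) ∈ S₀) ∧
      |p.2| ≤ ((2 * (W * walkBound (Fintype.card V) W) : ℕ) : ℤ) := by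
  have hnext : ∀ p : S₀, ∃ q : S₀, E p.1.1 q.1.1 ∧ q.1.2 = p.1.2 + w p.1.1 q.1.1 := by
    rintro ⟨⟨v, e⟩, hp⟩
    rcases fin_two_cases (own v) with h | h
    · obtain ⟨u, hu, hu'⟩ := (hS₀ v e hp).1 h
      exact ⟨⟨(u, e + w v u), hu'⟩, hu, rfl⟩
    · obtain ⟨u, hu⟩ := hE v
      exact ⟨⟨(u, e + w v u), (hS₀ v e hp).2 h u hu⟩, hu, rfl⟩
  choose nx hnx using hnext
  set F : ℕ → S₀ := fun i => nx^[i] ⟨(x, e), hx⟩ with hF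
  have hFs : ∀ i, F (i + 1) = nx (F i) := fun i => Function.iterate_succ_apply' _ _ _
  have hfin : Finite S₀ := by
    refine Set.Finite.subset ((Set.finite_univ (α := V)).prod (Set.finite_Icc (-b) b)) ?_
    intro p hp
    exact ⟨trivial, abs_le.1 (hb p hp)⟩
  -- A repeated configuration in the finite set `S₀` yields a closed walk of weight `0`, possibly
  -- very long.
  obtain ⟨i, j, hij, hFij⟩ : ∃ i j, i < j ∧ F i = F j := by
    obtain ⟨i, j, hne, h⟩ := Finite.exists_ne_map_eq_of_infinite F
    rcases lt_or_gt_of_ne hne with h' | h'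
    · exact ⟨i, j, h', h⟩
    · exact ⟨j, i, h', h.symm⟩
  set U : Set V := {v | ∃ e, (v, e) ∈ S₀} with hU
  have hpath : ∀ i k, Walk U E w k (F i).1.1 (F (i + k)).1.1 ((F (i + k)).1.2 - (F i).1.2) :=
    fun i k => Walk.of_path (f := fun i => (F i).1.1) (g := fun i => (F i).1.2) (n := i + k)
      (fun i _ => show ∃ e, ((F i).1.1, e) ∈ S₀ from ⟨(F i).1.2, (F i).2⟩) (fun i _ => by rw [hFs]; exact hnx _) le_rfl
  have w0 := hpath 0 i
  have w1 := hpath i (j - i)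
  rw [show i + (j - i) = j by omega, ← hFij, sub_self] at w1
  rw [zero_add] at w0
  change Walk U E w i x _ _ at w0
  set z := (F i).1.1
  set N := Fintype.card V with hN
  have hLN : N ≤ walkBound N W := by unfold walkBound; omega
  -- A short closed walk of weight `0` serves as both the negative and the positive one. Otherwise
  -- every short cycle reachable from `x` has nonzero weight, and cutting up the long closed walk
  -- gives cycles of both signs.
  by_cases hz : ∃ c a s, Walk U E w a x c s ∧ ∃ l, 1 ≤ l ∧ l ≤ N ∧ Walk U E w l c c 0
  · obtain ⟨c, a, s, h, l, hl, hl', hc⟩ := hz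
    obtain ⟨m, hm, t, h⟩ := h.shorten
    exact exists_closedSet_of_hub hW huniq ⟨m, hm.trans hLN, t, h⟩
      ⟨l, hl, hl'.trans hLN, 0, le_rfl, hc⟩ ⟨l, hl, hl'.trans hLN, 0, le_rfl, hc⟩
  · have key : ∀ ε : ℤ, |ε| = 1 →
        ∃ n, 1 ≤ n ∧ n ≤ walkBound N W ∧ ∃ s, ε * s ≤ 0 ∧ Walk U E w n z z s := by
      intro ε hε
      obtain ⟨y, a, l, c, s₁, s₂, s₃, hl, hl', h₁, h₂, h₃, hs⟩ :=
        w1.exists_short_cycle ε (by omega) (by simp)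
      obtain ⟨n₁, hn₁, t₁, k₁⟩ := h₁.shorten
      obtain ⟨n₃, hn₃, t₃, k₃⟩ := h₃.shorten
      have hs0 : s₂ ≠ 0 := by
        rintro rfl
        exact hz ⟨y, _, _, w0.trans h₁, l, hl, hl', h₂⟩
      have hε0 : ε ≠ 0 := by rintro rfl; simp at hε
      have hs1 : ε * s₂ ≤ -1 := by
        have : ε * s₂ ≠ 0 := mul_ne_zero hε0 hs0
        omega
      have hb1 : ε * t₁ ≤ W * N := by
        refine (le_abs_self _).trans ?_
        rw [abs_mul, hε, one_mul]
        refine (k₁.abs_le hW).trans ?_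
        exact_mod_cast Nat.mul_le_mul_left W hn₁
      have hb3 : ε * t₃ ≤ W * N := by
        refine (le_abs_self _).trans ?_
        rw [abs_mul, hε, one_mul]
        refine (k₃.abs_le hW).trans ?_
        exact_mod_cast Nat.mul_le_mul_left W hn₃
      -- The short ways from `z` to the cycle and back weigh at most `2 * N * W` together, so `2 * N
      -- * W + 1` rounds of a cycle of signed weight at most `-1` compensate for them.
      refine ⟨_, ?_, ?_, _, ?_, (k₁.trans (h₂.repeat (2 * N * W + 1))).trans k₃⟩
      · have : 0 < (2 * N * W + 1) * l := Nat.mul_pos (Nat.succ_pos _) hl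
        omega
      · unfold walkBound
        have : (2 * N * W + 1) * l ≤ (2 * N * W + 1) * N := Nat.mul_le_mul_left _ hl'
        omega
      · have : ((2 * N * W + 1 : ℕ) : ℤ) * (ε * s₂) ≤ ((2 * N * W + 1 : ℕ) : ℤ) * (-1) :=
          mul_le_mul_of_nonneg_left hs1 (by positivity)
        push_cast at this ⊢
        nlinarith
    obtain ⟨m, hm, t, h⟩ := w0.shorten
    refine exists_closedSet_of_hub (U := U) hW huniq ⟨m, hm.trans hLN, t, h⟩ ?_ ?_
    · simpa using key 1 (by simp)
    · obtain ⟨n, h1, h2, s, h3, h4⟩ := key (-1) (by simp)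
      exact ⟨n, h1, h2, s, by linarith, h4⟩

/-- The size of the windows that suffice with `k` edges of Player 1. -/
def windowBound (N W k : ℕ) : ℕ := 2 ^ k * (2 * (W * walkBound N W))

/-- Used to pass to games with fewer edges of Player 1: these only weaken the demands on a closed
set. -/
theorem ClosedSet.mono_edges {E' : V → V → Prop} {S : Set (V × ℤ)} (h : ClosedSet own E w S)
    (h0 : ∀ v u, own v = 0 → E v u → E' v u) (h1 : ∀ v u, own v = 1 → E' v u → E v u) :
    ClosedSet own E' w S := fun v e hve =>
  ⟨fun h' => by
    obtain ⟨u, hu, hu'⟩ := (h v e hve).1 h'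
    exact ⟨u, h0 v u h' hu, hu'⟩, fun h' u hu => (h v e hve).2 h' u (h1 v u h' hu)⟩

/-- If every edge belongs to one of two games that differ only in the edges of `v`, which belongs
to Player 1, then plays in the two games can be interleaved. -/
theorem ClosedSet.interleave {E₁ E₂ : V → V → Prop} {S₁ S₂ : Set (V × ℤ)}
    (h₁ : ClosedSet own E₁ w S₁) (h₂ : ClosedSet own E₂ w S₂) {v : V} (hv : own v = 1)
    (hE₁ : ∀ y u, y ≠ v → (E₁ y u ↔ E y u)) (hE₂ : ∀ y u, y ≠ v → (E₂ y u ↔ E y u))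
    (hEv : ∀ u, E v u → E₁ v u ∨ E₂ v u) :
    ClosedSet own E w ({p | ∃ e₁ e₂, p.2 = e₁ + e₂ ∧ (p.1, e₁) ∈ S₁ ∧ (v, e₂) ∈ S₂} ∪
      {p | ∃ e₁ e₂, p.2 = e₁ + e₂ ∧ (v, e₁) ∈ S₁ ∧ (p.1, e₂) ∈ S₂}) := by
  have atv : ∀ e₁ e₂, (v, e₁) ∈ S₁ → (v, e₂) ∈ S₂ → ∀ u, E v u →
      (u, e₁ + e₂ + w v u) ∈ ({p | ∃ e₁ e₂, p.2 = e₁ + e₂ ∧ (p.1, e₁) ∈ S₁ ∧ (v, e₂) ∈ S₂} ∪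
      {p | ∃ e₁ e₂, p.2 = e₁ + e₂ ∧ (v, e₁) ∈ S₁ ∧ (p.1, e₂) ∈ S₂} : Set (V × ℤ)) := by
    intro e₁ e₂ m₁ m₂ u hu
    rcases hEv u hu with h | h
    · exact Or.inl ⟨e₁ + w v u, e₂, by ring, (h₁ v e₁ m₁).2 hv u h, m₂⟩
    · exact Or.inr ⟨e₁, e₂ + w v u, by ring, m₁, (h₂ v e₂ m₂).2 hv u h⟩
  have hv0 : own v ≠ 0 := by rw [hv]; decide
  rintro y e (⟨e₁, e₂, he, m₁, m₂⟩ | ⟨e₁, e₂, he, m₁, m₂⟩)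
  · simp only at he m₁
    subst he
    refine ⟨fun h => ?_, fun h u hu => ?_⟩
    · have hy : y ≠ v := fun e => hv0 (e ▸ h)
      obtain ⟨u, hu, hu'⟩ := (h₁ y e₁ m₁).1 h
      exact ⟨u, (hE₁ y u hy).1 hu, Or.inl ⟨_, e₂, by ring, hu', m₂⟩⟩
    · by_cases hy : y = v
      · subst hy; exact atv e₁ e₂ m₁ m₂ u hu
      · exact Or.inl ⟨_, e₂, by ring, (h₁ y e₁ m₁).2 h u ((hE₁ y u hy).2 hu), m₂⟩
  · simp only at he m₂
    subst he
    refine ⟨fun h => ?_, fun h u hu => ?_⟩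
    · have hy : y ≠ v := fun e => hv0 (e ▸ h)
      obtain ⟨u, hu, hu'⟩ := (h₂ y e₂ m₂).1 h
      exact ⟨u, (hE₂ y u hy).1 hu, Or.inr ⟨e₁, _, by ring, m₁, hu'⟩⟩
    · by_cases hy : y = v
      · subst hy; exact atv e₁ e₂ m₁ m₂ u hu
      · exact Or.inr ⟨e₁, _, by ring, m₁, (h₂ y e₂ m₂).2 h u ((hE₂ y u hy).2 hu)⟩

/-- If Player 0 can keep the energy level bounded, then she can keep it in a window around the
initial level whose size does not depend on the given bound. -/
theorem exists_window [Fintype V] {W : ℕ} {b : ℤ} : ∀ (k : ℕ) (E : V → V → Prop),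
    {p : V × V | own p.1 = 1 ∧ E p.1 p.2}.ncard ≤ k → (∀ v u, E v u → |w v u| ≤ W) →
    (∀ v, ∃ u, E v u) → ∀ S₀ : Set (V × ℤ), ClosedSet own E w S₀ → (∀ p ∈ S₀, |p.2| ≤ b) →
    ∀ x e, (x, e) ∈ S₀ → ∃ S, ClosedSet own E w S ∧ (x, 0) ∈ S ∧ ∀ p ∈ S, (∃ e, (p.1, e) ∈ S₀) ∧
      |p.2| ≤ (windowBound (Fintype.card V) W k : ℤ) := by
  intro k
  induction k with
  | zero =>
    intro E hk hW hE S₀ hS₀ hb x e hx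
    rw [windowBound, pow_zero, one_mul]
    refine exists_closedSet_of_unique hW hE hS₀ hb (fun v _ hv u u' hu _ => ?_) hx
    have h0 := (Set.ncard_eq_zero (Set.toFinite _)).1 (Nat.le_zero.1 hk)
    have : (v, u) ∈ {p : V × V | own p.1 = 1 ∧ E p.1 p.2} := ⟨hv, hu⟩
    rw [h0] at this
    exact this.elim
  | succ k ih =>
    intro E hk hW hE S₀ hS₀ hb x e hx
    by_cases huniq : ∀ v, (∃ e, (v, e) ∈ S₀) → own v = 1 → ∀ u u', E v u → E v u' → u = u'
    · obtain ⟨S, h1, h2, h3⟩ := exists_closedSet_of_unique hW hE hS₀ hb huniq hx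
      refine ⟨S, h1, h2, fun p hp => ⟨(h3 p hp).1, (h3 p hp).2.trans ?_⟩⟩
      rw [windowBound]
      exact_mod_cast Nat.le_mul_of_pos_left _ (by positivity)
    · push Not at huniq
      obtain ⟨v, ⟨e', hv'⟩, hv, u₁, u₂, hu₁, hu₂, hne⟩ := huniq
      -- Deleting one of two edges of Player 1 keeps the arena free of terminal vertices and `S₀`
      -- closed, and lowers the count for the induction.
      have sub : ∀ u₁ u₂, E v u₁ → E v u₂ → u₁ ≠ u₂ → ∀ x e, (x, e) ∈ S₀ →
          ∃ S, ClosedSet own (fun y u => E y u ∧ ¬ (y = v ∧ u = u₁)) w S ∧ (x, 0) ∈ S ∧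
            ∀ p ∈ S, (∃ e, (p.1, e) ∈ S₀) ∧
              |p.2| ≤ (windowBound (Fintype.card V) W k : ℤ) := by
        intro u₁ u₂ hu₁ hu₂ hne x e hx
        refine ih (fun y u => E y u ∧ ¬ (y = v ∧ u = u₁)) ?_ (fun y u h => hW y u h.1) ?_ S₀
          (hS₀.mono_edges ?_ fun y u _ h => h.1) hb x e hx
        · refine Nat.lt_succ_iff.1 (lt_of_lt_of_le ?_ hk)
          refine Set.ncard_lt_ncard ⟨fun p hp => ⟨hp.1, hp.2.1⟩, fun h => ?_⟩ (Set.toFinite _)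
          exact (h (show (v, u₁) ∈ _ from ⟨hv, hu₁⟩)).2.2 ⟨rfl, rfl⟩
        · intro y
          by_cases hy : y = v
          · exact ⟨u₂, hy ▸ hu₂, fun h => hne h.2.symm⟩
          · obtain ⟨u, hu⟩ := hE y
            exact ⟨u, hu, fun h => hy h.1⟩
        · intro y u hy hu
          refine ⟨hu, ?_⟩
          rintro ⟨rfl, -⟩
          rw [hv] at hy
          exact absurd hy (by decide)
      obtain ⟨S₁, c₁, m₁, b₁⟩ := sub u₁ u₂ hu₁ hu₂ hne x e hx
      -- The second game starts frozen at `v`, which is possible because `v` occurs in `S₀`.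
      obtain ⟨S₂, c₂, m₂, b₂⟩ := sub u₂ u₁ hu₂ hu₁ hne.symm v e' hv'
      have hwb : (windowBound (Fintype.card V) W (k + 1) : ℤ) =
          windowBound (Fintype.card V) W k + windowBound (Fintype.card V) W k := by
        unfold windowBound
        rw [pow_succ]
        push_cast
        ring
      refine ⟨_, c₁.interleave c₂ (E := E) hv (fun y u hy => by simp [hy])
        (fun y u hy => by simp [hy]) ?_, ?_, ?_⟩
      · intro u hu
        by_cases h : u = u₁
        · exact Or.inr ⟨hu, fun h' => hne (h.symm.trans h'.2)⟩
        · exact Or.inl ⟨hu, fun h' => h h'.2⟩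
      · exact Or.inl ⟨0, 0, by simp, m₁, m₂⟩
      · rw [hwb]
        rintro p (⟨e₁, e₂, he, h₁, h₂⟩ | ⟨e₁, e₂, he, h₁, h₂⟩)
        · refine ⟨(b₁ _ h₁).1, ?_⟩
          rw [he]
          exact (abs_add_le _ _).trans (add_le_add (b₁ _ h₁).2 (b₂ _ h₂).2)
        · refine ⟨(b₂ _ h₂).1, ?_⟩
          rw [he]
          exact (abs_add_le _ _).trans (add_le_add (b₁ _ h₁).2 (b₂ _ h₂).2)

end

end EnergyGame

namespace EnergyGame

/-! ### Bounded energy levels -/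

section
variable {V : Type} {E : V → V → Prop} {w : V → V → ℤ} {own : V → Fin 2}

/-- From vertex `v` and energy level `c`, Player 0 can keep the energy level between `0` and `b`. -/
def SafeFrom (own : V → Fin 2) (E : V → V → Prop) (w : V → V → ℤ) (b : ℤ) (v : V) (c : ℤ) : Prop :=
  ∃ S, ClosedSet own E w S ∧ (∀ p ∈ S, 0 ≤ p.2 ∧ p.2 ≤ b) ∧ (v, c) ∈ S

theorem SafeFrom.mono {b b' : ℤ} (hb : b ≤ b') {v : V} {c : ℤ} (h : SafeFrom own E w b v c) :
    SafeFrom own E w b' v c := by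
  obtain ⟨S, h1, h2, h3⟩ := h
  exact ⟨S, h1, fun p hp => ⟨(h2 p hp).1, (h2 p hp).2.trans hb⟩, h3⟩

/-- An upper bound that suffices if any upper bound suffices. -/
def capBound (N W : ℕ) : ℕ := 2 * windowBound N W (N * N) + W

/-- Player 0 stays in `S₀` while the level is below `R`. Once it is some `r ≥ R`, a switch to a
window of radius `R` around `r` keeps it nonnegative and below `r + R`. Here `r ≤ R + W` if the
level has just crossed `R`, and `r = c` if it starts there. The additive dependence on `c` is what
lets Player 1 repeat the attack. -/
theorem SafeFrom.capBound_add [Fintype V] {W : ℕ} (hW : ∀ v u, E v u → |w v u| ≤ W)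
    (hE : ∀ v, ∃ u, E v u) {b : ℤ} {v : V} {c : ℤ} (h : SafeFrom own E w b v c) :
    SafeFrom own E w (capBound (Fintype.card V) W + c) v c := by
  obtain ⟨S₀, hS₀, hb, hv⟩ := h
  set R : ℤ := ((windowBound (Fintype.card V) W (Fintype.card V * Fintype.card V) : ℕ) : ℤ) with hR
  have hcap : (capBound (Fintype.card V) W : ℤ) = 2 * R + W := by
    rw [hR, capBound]; push_cast; ring
  have hc := (hb _ hv).1
  simp only at hc
  have hR0 : 0 ≤ R := by rw [hR]; positivity
  have hk : {p : V × V | own p.1 = 1 ∧ E p.1 p.2}.ncard ≤ Fintype.card V * Fintype.card V := by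
    refine (Set.ncard_le_ncard (Set.subset_univ _)).trans ?_
    rw [Set.ncard_univ, Nat.card_eq_fintype_card, Fintype.card_prod]
  have win : ∀ x e, (x, e) ∈ S₀ → ∃ S, ClosedSet own E w S ∧ (∀ p ∈ S, |p.2| ≤ R) ∧ (x, 0) ∈ S := by
    intro x e hx
    obtain ⟨S, h1, h2, h3⟩ := exists_window (b := b) _ E hk hW hE S₀ hS₀
      (fun p hp => by rw [abs_of_nonneg (hb p hp).1]; exact (hb p hp).2) x e hx
    exact ⟨S, h1, fun p hp => (h3 p hp).2, h2⟩
  refine ⟨{p | (p ∈ S₀ ∧ p.2 < R) ∨ ∃ r, R ≤ r ∧ r ≤ R + W + c ∧ ∃ S, ClosedSet own E w S ∧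
    (∀ p ∈ S, |p.2| ≤ R) ∧ (p.1, p.2 - r) ∈ S}, ?_, ?_, ?_⟩
  · rintro x e (⟨hx, he⟩ | ⟨r, hr, hr', S, h1, h2, h3⟩)
    · simp only at he
      have aux : ∀ u, E x u → (u, e + w x u) ∈ S₀ → (u, e + w x u) ∈ {p : V × ℤ | (p ∈ S₀ ∧ p.2 < R) ∨
          ∃ r, R ≤ r ∧ r ≤ R + W + c ∧ ∃ S, ClosedSet own E w S ∧
          (∀ p ∈ S, |p.2| ≤ R) ∧ (p.1, p.2 - r) ∈ S} := by
        intro u hu hu'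
        by_cases h : e + w x u < R
        · exact Or.inl ⟨hu', h⟩
        · obtain ⟨S, h1, h2, h3⟩ := win _ _ hu'
          have := abs_le.1 (hW x u hu)
          exact Or.inr ⟨e + w x u, by linarith, by linarith, S, h1, h2, by simpa using h3⟩
      refine ⟨fun h0 => ?_, fun h1 u hu => aux u hu ((hS₀ x e hx).2 h1 u hu)⟩
      obtain ⟨u, hu, hu'⟩ := (hS₀ x e hx).1 h0
      exact ⟨u, hu, aux u hu hu'⟩
    · refine ⟨fun h0 => ?_, fun h4 u hu => Or.inr ⟨r, hr, hr', S, h1, h2, ?_⟩⟩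
      · obtain ⟨u, hu, hu'⟩ := (h1 x (e - r) h3).1 h0
        exact ⟨u, hu, Or.inr ⟨r, hr, hr', S, h1, h2, by rwa [sub_add_eq_add_sub] at hu'⟩⟩
      · have := (h1 x (e - r) h3).2 h4 u hu
        rwa [sub_add_eq_add_sub] at this
  · rintro ⟨x, e⟩ (⟨hx, he⟩ | ⟨r, hr, hr', S, h1, h2, h3⟩)
    · exact ⟨(hb _ hx).1, by simp only at he ⊢; rw [hcap]; have : (0 : ℤ) ≤ W := by positivity
                             linarith⟩
    · have := abs_le.1 (h2 _ h3)
      simp only at this ⊢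
      rw [hcap]
      exact ⟨by linarith, by linarith⟩
  · by_cases h : c < R
    · exact Or.inl ⟨hv, h⟩
    · obtain ⟨S, h1, h2, h3⟩ := win _ _ hv
      refine Or.inr ⟨c, by linarith, ?_, S, h1, h2, by simpa using h3⟩
      have : (0 : ℤ) ≤ W := by positivity
      linarith

/-- The configurations from which Player 1 can force the energy level out of `[0, b]` within `i`
steps. -/
def Attr (own : V → Fin 2) (E : V → V → Prop) (w : V → V → ℤ) (b : ℤ) : ℕ → Set (V × ℤ)
  | 0 => {p | ¬ (0 ≤ p.2 ∧ p.2 ≤ b)}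
  | i + 1 => Attr own E w b i ∪ {p | (own p.1 = 0 ∧ ∀ u, E p.1 u → (u, p.2 + w p.1 u) ∈ Attr own E w b i) ∨
      (own p.1 = 1 ∧ ∃ u, E p.1 u ∧ (u, p.2 + w p.1 u) ∈ Attr own E w b i)}

theorem Attr.not_safeFrom {b : ℤ} : ∀ {i : ℕ} {v : V} {c : ℤ}, (v, c) ∈ Attr own E w b i →
    ¬ SafeFrom own E w b v c := by
  intro i
  induction i with
  | zero =>
    rintro v c h ⟨S, -, h2, h3⟩
    exact h (h2 _ h3)
  | succ i ih =>
    rintro v c (h | ⟨h0, h⟩ | ⟨h1, u, hu, h⟩) hs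
    · exact ih h hs
    · obtain ⟨S, hS, h2, h3⟩ := hs
      obtain ⟨u, hu, hu'⟩ := (hS v c h3).1 h0
      exact ih (h u hu) ⟨S, hS, h2, hu'⟩
    · obtain ⟨S, hS, h2, h3⟩ := hs
      exact ih h ⟨S, hS, h2, (hS v c h3).2 h1 u hu⟩

/-- Inside the box of `Fintype.card V * (b + 1)` configurations the stages grow strictly until they
stabilize. The complement of a stable stage is closed and lies in the box, so it witnesses safety.
-/
theorem exists_attr [Fintype V] (b : ℕ) : ∃ i ≤ Fintype.card V * (b + 1), ∀ (v : V) (c : ℤ),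
    ¬ SafeFrom own E w b v c → (v, c) ∈ Attr own E w b i := by
  obtain ⟨i, hi, hst⟩ : ∃ i ≤ Fintype.card V * (b + 1),
      Attr own E w b (i + 1) ⊆ Attr own E w b i := by
    by_contra! hcon
    have hfin : (Set.univ ×ˢ Set.Icc (0 : ℤ) b : Set (V × ℤ)).Finite :=
      Set.finite_univ.prod (Set.finite_Icc _ _)
    have hgrow : ∀ i ≤ Fintype.card V * (b + 1) + 1,
        i ≤ (Attr own E w b i ∩ Set.univ ×ˢ Set.Icc (0 : ℤ) b).ncard := by
      intro i
      induction i with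
      | zero => simp
      | succ i ih =>
        intro hi
        refine Nat.succ_le_of_lt (lt_of_le_of_lt (ih (by omega))
          (Set.ncard_lt_ncard ?_ (hfin.subset Set.inter_subset_right)))
        refine ⟨Set.inter_subset_inter_left _ Set.subset_union_left, fun h => ?_⟩
        refine hcon i (by omega) fun p hp => ?_
        by_cases hpb : 0 ≤ p.2 ∧ p.2 ≤ b
        · exact (h ⟨hp, trivial, hpb⟩).1
        · have : ∀ j, p ∈ Attr own E w b j := by
            intro j
            induction j with
            | zero => exact hpb
            | succ j ih => exact Or.inl ih
          exact this i
    have h1 := hgrow _ le_rfl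
    have h2 := Set.ncard_le_ncard (s := Attr own E w b (Fintype.card V * (b + 1) + 1) ∩
      Set.univ ×ˢ Set.Icc (0 : ℤ) b) Set.inter_subset_right hfin
    have h3 : (Set.univ ×ˢ Set.Icc (0 : ℤ) b : Set (V × ℤ)).ncard = Fintype.card V * (b + 1) := by
      rw [Set.ncard_prod, Set.ncard_univ, Nat.card_eq_fintype_card,
        ← Finset.coe_Icc, Set.ncard_coe_finset, Int.card_Icc]
      congr 1
    omega
  refine ⟨i, hi, fun v c hv => ?_⟩
  by_contra hvc
  refine hv ⟨(Attr own E w b i)ᶜ, ?_, ?_, hvc⟩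
  · intro y e hy
    have hy' : (y, e) ∉ Attr own E w b (i + 1) := fun h => hy (hst h)
    simp only [Attr, Set.mem_union, Set.mem_ofPred_eq, not_or, not_and, not_forall, not_exists] at hy'
    refine ⟨fun h0 => ?_, fun h1 u hu => hy'.2.2 h1 u hu⟩
    obtain ⟨u, hu, hu'⟩ := hy'.2.1 h0
    exact ⟨u, hu, hu'⟩
  · intro p hp
    by_contra hpb
    have : ∀ j, p ∈ Attr own E w b j := by
      intro j
      induction j with
      | zero => exact hpb
      | succ j ih => exact Or.inl ih
    exact hp (this i)

end

/-! ### The threshold problem and bounded energy levels -/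

section
variable {V : Type} (A : Arena V)

open Classical in
/-- The weights of an arena, extended by `0` to all pairs of vertices. -/
noncomputable def weightFun (w : A.Edge → ℤ) (v u : V) : ℤ := if h : A.E v u then w ⟨(v, u), h⟩ else 0

/-- The total weight of the first `n` steps. -/
def levelOf (w : V → V → ℤ) (ρ : ℕ → V) (n : ℕ) : ℤ := ∑ i ∈ Finset.range n, w (ρ i) (ρ (i + 1))

variable {A}

theorem energyLevel_eq (w : A.Edge → ℤ) (ρ : A.Play) (n : ℕ) :
    energyLevel w ρ n = levelOf (weightFun A w) ρ.vert n := by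
  refine Finset.sum_congr rfl fun i _ => ?_
  rw [weightFun, dif_pos (ρ.isPath i)]
  rfl

theorem levelOf_succ (w : V → V → ℤ) (ρ : ℕ → V) (n : ℕ) :
    levelOf w ρ (n + 1) = levelOf w ρ n + w (ρ n) (ρ (n + 1)) := Finset.sum_range_succ _ _

theorem levelOf_congr {w : V → V → ℤ} {ρ ρ' : ℕ → V} {n : ℕ} (h : ∀ i ≤ n, ρ i = ρ' i) :
    levelOf w ρ n = levelOf w ρ' n := by
  refine Finset.sum_congr rfl fun i hi => ?_
  have := Finset.mem_range.1 hi
  rw [h i (by omega), h (i + 1) (by omega)]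

/-- The total weight along the vertices of `l` followed by `v`. -/
def listLevel (w : V → V → ℤ) (l : List V) (v : V) : ℤ :=
  levelOf w (fun i => (l ++ [v]).getD i v) l.length

theorem listLevel_map (w : V → V → ℤ) (ρ : ℕ → V) (n : ℕ) :
    listLevel w ((List.range n).map ρ) (ρ n) = levelOf w ρ n := by
  rw [listLevel, List.length_map, List.length_range]
  refine levelOf_congr fun i hi => ?_
  have : (List.range n).map ρ ++ [ρ n] = (List.range (n + 1)).map ρ := by
    rw [List.range_succ, List.map_append]; rfl
  rw [this, List.getD_eq_getElem _ _ (by simp; omega)]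
  simp

/-- The strategy recomputes the current level from the history and follows the closed set; the bound
on the levels is itself a threshold. -/
theorem exists_player0Wins_of_safeFrom {w : A.Edge → ℤ} {b : ℕ}
    (h : SafeFrom A.owner A.E (weightFun A w) b A.init 0) : A.Player0Wins (AvgEnergyL w b) := by
  classical
  obtain ⟨S, hS, hb, h0⟩ := h
  have hnext : ∀ v e, ∃ u, A.E v u ∧ ((v, e) ∈ S → A.owner v = 0 → (u, e + weightFun A w v u) ∈ S) := by
    intro v e
    by_cases hv : (v, e) ∈ S ∧ A.owner v = 0
    · obtain ⟨u, hu, hu'⟩ := (hS v e hv.1).1 hv.2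
      exact ⟨u, hu, fun _ _ => hu'⟩
    · obtain ⟨u, hu⟩ := A.no_terminal v
      exact ⟨u, hu, fun h1 h2 => absurd ⟨h1, h2⟩ hv⟩
  choose nx hnx1 hnx2 using hnext
  refine ⟨⟨fun l v => nx v (listLevel (weightFun A w) l v), fun l v _ => hnx1 _ _⟩, fun ρ hρ => ?_⟩
  have inv : ∀ n, (ρ.vert n, energyLevel w ρ n) ∈ S := by
    intro n
    induction n with
    | zero => rw [ρ.vert_zero]; simpa [energyLevel] using h0
    | succ n ih =>
      rw [energyLevel_eq, levelOf_succ, ← energyLevel_eq]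
      rcases fin_two_cases (A.owner (ρ.vert n)) with h | h
      · have := hρ n h
        simp only [listLevel_map, ← energyLevel_eq] at this
        rw [this]
        exact hnx2 _ _ ih h
      · exact (hS _ _ ih).2 h _ (ρ.isPath n)
  refine ⟨fun n => (hb _ (inv n)).1, ?_⟩
  change Filter.limsup (fun n : ℕ => (((1 / (n : ℝ)) *
    ∑ i ∈ Finset.range n, (energyLevel w ρ i : ℝ) : ℝ) : EReal)) Filter.atTop ≤ ((b : ℝ) : EReal)
  refine Filter.limsup_le_of_le (by isBoundedDefault) (Filter.Eventually.of_forall fun n => ?_)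
  rw [EReal.coe_le_coe_iff]
  have hsum : ∑ i ∈ Finset.range n, (energyLevel w ρ i : ℝ) ≤ n * b := by
    have : ∑ i ∈ Finset.range n, (energyLevel w ρ i : ℝ) ≤ ∑ i ∈ Finset.range n, (b : ℝ) :=
      Finset.sum_le_sum fun i _ => by exact_mod_cast (hb _ (inv i)).2
    simpa using this
  rcases Nat.eq_zero_or_pos n with rfl | hn
  · simp
  · have hn' : (0 : ℝ) < n := by exact_mod_cast hn
    rw [one_div, inv_mul_le_iff₀ hn']
    exact hsum

/-! ### Player 1 forces high averages against a given strategy -/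

/-- The first `T` steps of `ρ` form a path from the initial vertex that is consistent with `s`. -/
def ConsistentUpTo (s : A.Strategy 0) (ρ : ℕ → V) (T : ℕ) : Prop :=
  ρ 0 = A.init ∧ ∀ i < T, A.E (ρ i) (ρ (i + 1)) ∧
    (A.owner (ρ i) = 0 → ρ (i + 1) = s.next ((List.range i).map ρ) (ρ i))

theorem ConsistentUpTo.congr {s : A.Strategy 0} {ρ ρ' : ℕ → V} {T T' : ℕ}
    (h : ConsistentUpTo s ρ T) (hT : T' ≤ T) (hρ : ∀ i ≤ T', ρ' i = ρ i) :
    ConsistentUpTo s ρ' T' := by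
  refine ⟨by rw [hρ 0 (Nat.zero_le _)]; exact h.1, fun i hi => ?_⟩
  rw [hρ i (by omega), hρ (i + 1) (by omega)]
  rw [List.map_congr_left fun j hj => hρ j (by have := List.mem_range.1 hj; omega)]
  exact h.2 i (by omega)

theorem ConsistentUpTo.extend {s : A.Strategy 0} {ρ : ℕ → V} {T : ℕ} (h : ConsistentUpTo s ρ T)
    {u : V} (hu : A.E (ρ T) u) (hs : A.owner (ρ T) = 0 → u = s.next ((List.range T).map ρ) (ρ T)) :
    ConsistentUpTo s (Function.update ρ (T + 1) u) (T + 1) := by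
  have hρ : ∀ i ≤ T, Function.update ρ (T + 1) u i = ρ i := fun i hi =>
    Function.update_of_ne (by omega) _ _
  have h' := h.congr le_rfl hρ
  refine ⟨h'.1, fun i hi => ?_⟩
  by_cases hiT : i < T
  · exact h'.2 i hiT
  · have : i = T := by omega
    subst this
    rw [hρ i le_rfl, Function.update_self,
      List.map_congr_left fun j hj => hρ j (by have := List.mem_range.1 hj; omega)]
    exact ⟨hu, hs⟩

/-- Finite paths that can be extended again and again have a limit. -/
theorem exists_limit_play {s : A.Strategy 0} {G : (ℕ → V) → ℕ → Prop}
    (hG : ∀ ρ T, G ρ T → ConsistentUpTo s ρ T)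
    (hext : ∀ ρ T, G ρ T → ∃ ρ' T', G ρ' T' ∧ T < T' ∧ ∀ i ≤ T, ρ' i = ρ i) {ρ₀ : ℕ → V} {T₀ : ℕ}
    (h₀ : G ρ₀ T₀) : ∃ π : A.Play, π.Consistent s ∧ (∀ i ≤ T₀, π.vert i = ρ₀ i) ∧
      ∀ k, ∃ ρ T, G ρ T ∧ k ≤ T ∧ ∀ i ≤ T, π.vert i = ρ i := by
  have hstep : ∀ p : {p : (ℕ → V) × ℕ // G p.1 p.2}, ∃ q : {p : (ℕ → V) × ℕ // G p.1 p.2},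
      p.1.2 < q.1.2 ∧ ∀ i ≤ p.1.2, q.1.1 i = p.1.1 i := by
    rintro ⟨⟨ρ, T⟩, h⟩
    obtain ⟨ρ', T', h1, h2, h3⟩ := hext ρ T h
    exact ⟨⟨(ρ', T'), h1⟩, h2, h3⟩
  choose nx hnx1 hnx2 using hstep
  -- The lengths increase strictly, so the `i`-th path has length at least `i` and fixes the `i`-th
  -- vertex of the limit.
  set F : ℕ → {p : (ℕ → V) × ℕ // G p.1 p.2} := fun k => nx^[k] ⟨(ρ₀, T₀), h₀⟩ with hF
  have hFs : ∀ k, F (k + 1) = nx (F k) := fun k => Function.iterate_succ_apply' _ _ _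
  have hT : ∀ k, k ≤ (F k).1.2 := by
    intro k
    induction k with
    | zero => exact Nat.zero_le _
    | succ k ih => rw [hFs]; exact lt_of_le_of_lt ih (hnx1 _)
  have hmono : ∀ k d, (F k).1.2 ≤ (F (k + d)).1.2 ∧
      ∀ i ≤ (F k).1.2, (F (k + d)).1.1 i = (F k).1.1 i := by
    intro k d
    induction d with
    | zero => exact ⟨le_rfl, fun _ _ => rfl⟩
    | succ d ih =>
      rw [← add_assoc, hFs]
      exact ⟨ih.1.trans (hnx1 _).le, fun i hi => (hnx2 _ i (hi.trans ih.1)).trans (ih.2 i hi)⟩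
  have hlim : ∀ k, ∀ i ≤ (F k).1.2, (F i).1.1 i = (F k).1.1 i := by
    intro k i hi
    rcases le_total i k with h | h
    · obtain ⟨d, rfl⟩ := Nat.exists_eq_add_of_le h
      exact ((hmono i d).2 i (hT i)).symm
    · obtain ⟨d, rfl⟩ := Nat.exists_eq_add_of_le h
      exact (hmono k d).2 _ hi
  have hcons : ∀ T, ConsistentUpTo s (fun i => (F i).1.1 i) T := fun T =>
    (hG _ _ (F T).2).congr (hT T) fun i hi => hlim T i (hi.trans (hT T))
  exact ⟨⟨fun i => (F i).1.1 i, (hcons 0).1, fun n => ((hcons (n + 1)).2 n n.lt_succ_self).1⟩,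
    fun n => ((hcons (n + 1)).2 n n.lt_succ_self).2, fun i hi => hlim 0 i hi,
    fun k => ⟨(F k).1.1, (F k).1.2, (F k).2, hT k, hlim k⟩⟩

theorem ConsistentUpTo.exists_extend {s : A.Strategy 0} {ρ : ℕ → V} {T : ℕ}
    (h : ConsistentUpTo s ρ T) :
    ∃ ρ' T', ConsistentUpTo s ρ' T' ∧ T < T' ∧ ∀ i ≤ T, ρ' i = ρ i := by
  have : ∃ u, A.E (ρ T) u ∧ (A.owner (ρ T) = 0 → u = s.next ((List.range T).map ρ) (ρ T)) := by
    by_cases h0 : A.owner (ρ T) = 0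
    · exact ⟨_, s.follows _ _ h0, fun _ => rfl⟩
    · obtain ⟨u, hu⟩ := A.no_terminal (ρ T)
      exact ⟨u, hu, fun h => absurd h h0⟩
  obtain ⟨u, hu, hs⟩ := this
  exact ⟨_, T + 1, h.extend hu hs, T.lt_succ_self, fun i hi => Function.update_of_ne (by omega) _ _⟩

/-- The finite path extends to a full consistent play, whose levels are nonnegative. Hence an escape
from `[0, b]` can only be through the top. -/
theorem ConsistentUpTo.level_nonneg {w : A.Edge → ℤ} {s : A.Strategy 0}
    (hs : ∀ ρ : A.Play, ρ.Consistent s → ρ ∈ EnergyL w) {ρ : ℕ → V} {T : ℕ}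
    (h : ConsistentUpTo s ρ T) : 0 ≤ levelOf (weightFun A w) ρ T := by
  obtain ⟨π, hπ, hag, -⟩ := exists_limit_play (fun _ _ h => h)
    (fun _ _ => ConsistentUpTo.exists_extend) h
  rw [← levelOf_congr hag, ← energyLevel_eq]
  exact hs π hπ T

/-- Player 1 forces a high energy level. -/
theorem ConsistentUpTo.exists_high {w : A.Edge → ℤ} {W : ℕ}
    (hW : ∀ v u, A.E v u → |weightFun A w v u| ≤ W) {s : A.Strategy 0}
    (hs : ∀ ρ : A.Play, ρ.Consistent s → ρ ∈ EnergyL w) {b h : ℤ} (hb : h ≤ b) :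
    ∀ (i : ℕ) (ρ : ℕ → V) (T : ℕ), ConsistentUpTo s ρ T → levelOf (weightFun A w) ρ T ≤ h + W →
      (ρ T, levelOf (weightFun A w) ρ T) ∈ Attr A.owner A.E (weightFun A w) b i →
      ∃ ρ' T', ConsistentUpTo s ρ' T' ∧ T ≤ T' ∧ T' ≤ T + i ∧ (∀ i ≤ T, ρ' i = ρ i) ∧
        h ≤ levelOf (weightFun A w) ρ' T' ∧ levelOf (weightFun A w) ρ' T' ≤ h + W ∧
        ¬ SafeFrom A.owner A.E (weightFun A w) b (ρ' T') (levelOf (weightFun A w) ρ' T') := by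
  intro i
  induction i with
  | zero =>
    intro ρ T hc hle hmem
    have := hc.level_nonneg hs
    refine ⟨ρ, T, hc, le_rfl, le_rfl, fun _ _ => rfl, ?_, hle, Attr.not_safeFrom hmem⟩
    simp only [Attr, Set.mem_ofPred_eq, not_and, not_le] at hmem
    exact hb.trans (hmem this).le
  | succ i ih =>
    intro ρ T hc hle hmem
    -- The path stops as soon as the level reaches `h`. It is then overshot by at most `W`, and the
    -- configuration is still in the attractor, hence unsafe for `b`.
    by_cases hh : h ≤ levelOf (weightFun A w) ρ T
    · exact ⟨ρ, T, hc, le_rfl, by omega, fun _ _ => rfl, hh, hle, Attr.not_safeFrom hmem⟩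
    · have go : ∀ u, A.E (ρ T) u →
          (A.owner (ρ T) = 0 → u = s.next ((List.range T).map ρ) (ρ T)) →
          (u, levelOf (weightFun A w) ρ T + weightFun A w (ρ T) u) ∈
            Attr A.owner A.E (weightFun A w) b i →
          ∃ ρ' T', ConsistentUpTo s ρ' T' ∧ T ≤ T' ∧ T' ≤ T + (i + 1) ∧ (∀ i ≤ T, ρ' i = ρ i) ∧
            h ≤ levelOf (weightFun A w) ρ' T' ∧ levelOf (weightFun A w) ρ' T' ≤ h + W ∧
            ¬ SafeFrom A.owner A.E (weightFun A w) b (ρ' T')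
              (levelOf (weightFun A w) ρ' T') := by
        intro u hu hsu hmem
        have hag : ∀ i ≤ T, Function.update ρ (T + 1) u i = ρ i := fun i hi =>
          Function.update_of_ne (by omega) _ _
        have hlev : levelOf (weightFun A w) (Function.update ρ (T + 1) u) (T + 1) =
            levelOf (weightFun A w) ρ T + weightFun A w (ρ T) u := by
          rw [levelOf_succ, levelOf_congr hag, hag T le_rfl, Function.update_self]
        have := abs_le.1 (hW _ _ hu)
        obtain ⟨ρ', T', h1, h2, h3, h4, h5⟩ := ih _ (T + 1) (hc.extend hu hsu)
          (by rw [hlev]; linarith) (by rw [hlev, Function.update_self]; exact hmem)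
        exact ⟨ρ', T', h1, by omega, by omega,
          fun i hi => (h4 i (by omega)).trans (hag i hi), h5⟩
      rcases hmem with hmem | ⟨h0, hmem⟩ | ⟨h1, u, hu, hmem⟩
      · obtain ⟨ρ', T', h1, h2, h3, h4⟩ := ih ρ T hc hle hmem
        exact ⟨ρ', T', h1, h2, by omega, h4⟩
      · exact go _ (s.follows _ _ h0) (fun _ => rfl) (hmem _ (s.follows _ _ h0))
      · exact go u hu (fun h0 => by simp only at h1; rw [h0] at h1; exact absurd h1 (by decide)) hmem

theorem levelOf_add_ge {w : V → V → ℤ} {W : ℕ} (hW : ∀ v u, A.E v u → |w v u| ≤ W) (π : A.Play)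
    (T j : ℕ) : levelOf w π.vert T - j * W ≤ levelOf w π.vert (T + j) := by
  induction j with
  | zero => simp
  | succ j ih =>
    have := abs_le.1 (hW _ _ (π.isPath (T + j)))
    rw [← add_assoc, levelOf_succ]
    push_cast
    linarith

/-- By `SafeFrom.capBound_add`, unsafety for `capBound` at level `0` means unsafety for all bounds,
and reaching level at most `h + W` while unsafe for `h + W + C` does so again. The attack can thus
be iterated within one play consistent with `s`. -/
theorem safeFrom_of_player0Wins [Fintype V] {w : A.Edge → ℤ} {W t : ℕ}
    (hW : ∀ v u, A.E v u → |weightFun A w v u| ≤ W) (h : A.Player0Wins (AvgEnergyL w t)) :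
    SafeFrom A.owner A.E (weightFun A w) (capBound (Fintype.card V) W) A.init 0 := by
  obtain ⟨s, hs⟩ := h
  have hsE : ∀ ρ : A.Play, ρ.Consistent s → ρ ∈ EnergyL w := fun ρ hρ => (hs ρ hρ).1
  by_contra hcon
  set N := Fintype.card V with hN
  set C := capBound N W with hC
  set K := 3 + 2 * N * (W + 1) with hK
  -- The data `q` says that the level is so high that it stays at least `q` during the next `q`
  -- steps, while `T + q` is only linear in `q`. The sum is then at least `q * q`, and `q ≥ (t + 1)
  -- * K` makes the average at least `t + 1`.
  set G : (ℕ → V) → ℕ → Prop := fun ρ T => ConsistentUpTo s ρ T ∧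
    (∀ b, ¬ SafeFrom A.owner A.E (weightFun A w) b (ρ T) (levelOf (weightFun A w) ρ T)) ∧
    (T = 0 ∨ ∃ q : ℕ, (2 * (W + 1) * q : ℤ) ≤ levelOf (weightFun A w) ρ T ∧ T + q ≤ K * q ∧
      (t + 1) * K ≤ q) with hG
  have h0 : G (fun _ => A.init) 0 := by
    refine ⟨⟨rfl, by simp⟩, fun b hb => hcon ?_, Or.inl rfl⟩
    have hl : levelOf (weightFun A w) (fun _ => A.init) 0 = 0 := by simp [levelOf]
    rw [hl] at hb
    simpa using hb.capBound_add hW A.no_terminal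
  have hext : ∀ ρ T, G ρ T → ∃ ρ' T', G ρ' T' ∧ T < T' ∧ ∀ i ≤ T, ρ' i = ρ i := by
    rintro ρ T ⟨hc, hns, -⟩
    have hl0 := hc.level_nonneg hsE
    obtain ⟨l, hl⟩ := Int.eq_ofNat_of_zero_le hl0
    -- Large enough to absorb the elapsed time `T`, the constant part of the attractor's length and
    -- the threshold; the summand `l + 1` makes `h` exceed the current level, so that the path
    -- really grows.
    set q : ℕ := (t + 1) * K + T + N * (2 * W + C + 1) + l + 1 with hq
    set h : ℕ := 2 * (W + 1) * q with hh
    have hlt : l < h := by rw [hh]; nlinarith [Nat.zero_le ((W + 1) * (2 * q)), Nat.zero_le (W * q)]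
    obtain ⟨i, hi, hattr⟩ := exists_attr (own := A.owner) (E := A.E) (w := weightFun A w)
      (h + W + C)
    obtain ⟨ρ', T', h1, h2, h3, h4, h5, h6, h7⟩ := ConsistentUpTo.exists_high hW hsE
      (b := ((h + W + C : ℕ) : ℤ)) (h := h) (by push_cast; omega) i ρ T hc
      (by rw [hl]; omega) (hattr _ _ (hns _))
    refine ⟨ρ', T', ⟨h1, fun b hb => h7 ?_, Or.inr ⟨q, ?_, ?_, ?_⟩⟩, ?_, h4⟩
    · refine (hb.capBound_add hW A.no_terminal).mono ?_
      push_cast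
      linarith
    · have : ((h : ℕ) : ℤ) = 2 * (W + 1) * q := by rw [hh]; push_cast; ring
      rw [← this]
      exact h5
    · have e1 : T' ≤ T + N * (h + W + C + 1) := h3.trans (Nat.add_le_add_left hi T)
      have e2 : N * (h + W + C + 1) ≤ 2 * N * (W + 1) * q + N * (2 * W + C + 1) := by
        rw [hh]; nlinarith [Nat.zero_le (N * W)]
      have e3 : K * q = 3 * q + 2 * N * (W + 1) * q := by rw [hK]; ring
      rw [e3]
      omega
    · omega
    · rcases h2.lt_or_eq with h | h
      · exact h
      · subst h
        rw [levelOf_congr h4, hl] at h5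
        omega
  obtain ⟨π, hπ, -, hlim⟩ := exists_limit_play (fun _ _ h => h.1) hext h0
  obtain ⟨hπE, hπA⟩ := hs π hπ
  have hfreq : ∃ᶠ n : ℕ in Filter.atTop, (((t + 1 : ℝ) : EReal)) ≤
      (((1 / (n : ℝ)) * ∑ i ∈ Finset.range n, (energyLevel w π i : ℝ) : ℝ) : EReal) := by
    rw [Filter.frequently_atTop]
    intro k
    obtain ⟨ρ, T, ⟨-, -, hGq⟩, hkT, hag⟩ := hlim (k + 1)
    obtain hT0 | ⟨q, hq1, hq2, hq3⟩ := hGq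
    · omega
    refine ⟨T + q, by omega, ?_⟩
    rw [EReal.coe_le_coe_iff]
    rw [← levelOf_congr hag] at hq1
    -- The level falls by at most `W` per step, and `2 * (W + 1) * q - q * W ≥ q`.
    have hge : ∀ j < q, ((q : ℕ) : ℤ) ≤ energyLevel w π (T + j) := by
      intro j hj
      have h1 := levelOf_add_ge hW π T j
      rw [energyLevel_eq]
      have h2 : (j : ℤ) * W ≤ q * W := by
        have : (j : ℤ) ≤ q := by exact_mod_cast hj.le
        exact mul_le_mul_of_nonneg_right this (by positivity)
      have h3 : (0 : ℤ) ≤ q * W := by positivity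
      nlinarith
    have hsum : ((q : ℝ) * q) ≤ ∑ i ∈ Finset.range (T + q), (energyLevel w π i : ℝ) := by
      rw [Finset.sum_range_add]
      have h1 : (0 : ℝ) ≤ ∑ i ∈ Finset.range T, (energyLevel w π i : ℝ) :=
        Finset.sum_nonneg fun i _ => by exact_mod_cast hπE i
      have h2 : ∑ j ∈ Finset.range q, (q : ℝ) ≤
          ∑ j ∈ Finset.range q, (energyLevel w π (T + j) : ℝ) :=
        Finset.sum_le_sum fun j hj => by exact_mod_cast hge j (Finset.mem_range.1 hj)
      simp only [Finset.sum_const, Finset.card_range, nsmul_eq_mul] at h2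
      linarith
    have hpos : (0 : ℝ) < ((T + q : ℕ) : ℝ) := by
      have : 0 < T + q := by omega
      exact_mod_cast this
    rw [one_div, le_inv_mul_iff₀ hpos]
    refine le_trans ?_ hsum
    have hnat : (T + q) * (t + 1) ≤ q * q := by
      calc (T + q) * (t + 1) ≤ (K * q) * (t + 1) := Nat.mul_le_mul_right _ hq2
        _ = ((t + 1) * K) * q := by ring
        _ ≤ q * q := Nat.mul_le_mul_right _ hq3
    exact_mod_cast hnat
  have h1 : ((t + 1 : ℝ) : EReal) ≤ ((t : ℝ) : EReal) :=
    (Filter.le_limsup_of_frequently_le' hfreq).trans hπA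
  rw [EReal.coe_le_coe_iff] at h1
  linarith

theorem Instance.hasThreshold_iff (I : Instance) {W : ℕ}
    (hW : ∀ v u, I.arena.E v u → |weightFun I.arena I.weight v u| ≤ W) {b : ℕ}
    (hb : capBound I.n W ≤ b) :
    I.HasThreshold ↔ SafeFrom I.arena.owner I.arena.E (weightFun I.arena I.weight) b
      I.arena.init 0 := by
  constructor
  · rintro ⟨t, ht⟩
    refine (safeFrom_of_player0Wins hW ht).mono ?_
    rw [Fintype.card_fin]
    exact_mod_cast hb
  · intro h
    exact ⟨b, exists_player0Wins_of_safeFrom h⟩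

end

end EnergyGame

namespace EnergyGame

/-! ### The threshold problem as a bounded arithmetical formula -/

/-- The `i`-th digit of `T` in base `4 ^ k`, with powers cut off at `B`. -/
def dig (B k T i : ℕ) : ℕ := T / min (4 ^ (k * i)) B % min (4 ^ k) B

/-- Append a digit to a number in base `7`, cut off at `B`. -/
def pushDigit (B a d : ℕ) : ℕ := min (7 * a + d) B

/-- Append the digits that represent the binary notation of `z`. -/
def pushBits (B a z : ℕ) : ℕ :=
  Nat.rec (motive := fun _ => ℕ) a
    (fun j acc => if z / 2 ^ j = 0 then acc else pushDigit B acc (2 + z / 2 ^ j % 2)) z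

/-- Append the digits that represent an entry with number `e`. Odd numbers `2 * k + 1` stand for
weight `k`, positive even numbers `2 * k` for weight `-k`, and `0` stands for no edge. -/
def pushEntry (B a e : ℕ) : ℕ :=
  if e = 0 then a else pushBits B (pushDigit B a (if e % 2 = 0 then 3 else 2)) (e / 2)

/-- Append the digits that represent the row of vertex `v`. -/
def pushRow (B k n O i₀ T a v : ℕ) : ℕ :=
  Nat.rec (motive := fun _ => ℕ)
    (pushDigit B (pushDigit B (pushDigit B a 4) (if dig B 1 O v = 0 then 2 else 3))
      (if v = i₀ then 3 else 2))
    (fun u acc => pushEntry B (pushDigit B acc 6) (dig B k T (v * n + u))) n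

/-- The number that represents the encoding of the input that is given by numbers. -/
def encodeNum (B k n O i₀ T : ℕ) : ℕ :=
  Nat.rec (motive := fun _ => ℕ) 0 (fun v acc => pushRow B k n O i₀ T acc v) n

/-- An edge with number `e` leads from energy level `c` into a configuration at `u` in `S`. -/
def MoveInto (B b S e c u : ℕ) : Prop :=
  e ≠ 0 ∧ (e % 2 ≠ 0 → c + e / 2 ≤ b ∧ dig B 1 S (u * (b + 1) + (c + e / 2)) ≠ 0) ∧
    (e % 2 = 0 → e / 2 ≤ c ∧ dig B 1 S (u * (b + 1) + (c - e / 2)) ≠ 0)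

/-- The digits of `S` describe a closed set that contains the initial configuration. -/
def SafeNum (B k b n O i₀ T S : ℕ) : Prop :=
  dig B 1 S (i₀ * (b + 1)) ≠ 0 ∧ ∀ v < n, ∀ c < b + 1, dig B 1 S (v * (b + 1) + c) ≠ 0 →
    (dig B 1 O v = 0 → ∃ u < n, MoveInto B b S (dig B k T (v * n + u)) c u) ∧
    (dig B 1 O v ≠ 0 → ∀ u < n, dig B k T (v * n + u) ≠ 0 →
      MoveInto B b S (dig B k T (v * n + u)) c u)

/-- `X` represents the encoding, of length `l`, of an input with a positive answer. -/
def PositiveNum (B l X : ℕ) : Prop :=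
  ∃ n < l + 1, ∃ O < B, ∃ i₀ < n, ∃ T < B,
    (∀ v < n, ∃ u < n, dig B (l + 1) T (v * n + u) ≠ 0) ∧ encodeNum B (l + 1) n O i₀ T = X ∧
    ∃ S < B, SafeNum B (l + 1) (min (2 ^ ((l + 3) ^ 2)) B) n O i₀ T S

/-! ### Realizability of the formula -/

section
variable {α : Type} [Env α] {B k n O I T S a b c d e i l u v z : α → ℕ}

theorem Realizable.dig (hB : Realizable B) (hk : Realizable k) (hT : Realizable T)
    (hi : Realizable i) : Realizable (fun x => dig (B x) (k x) (T x) (i x)) :=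
  (hT.div (.min_pow (.const 4) (hk.mul hi) hB fun _ => by norm_num)).mod
    (.min_pow (.const 4) hk hB fun _ => by norm_num)

theorem Realizable.pushDigit (hB : Realizable B) (ha : Realizable a) (hd : Realizable d) :
    Realizable (fun x => pushDigit (B x) (a x) (d x)) :=
  (((Realizable.const 7).mul ha).add hd).min hB

/-- Cutting the power off at `z + 1` is harmless, because both quotients are then `0`. -/
theorem Realizable.div_two_pow (hz : Realizable z) (hi : Realizable i) :
    Realizable (fun x => z x / 2 ^ i x) :=
  (hz.div (.min_pow (.const 2) hi hz.succ fun _ => by norm_num)).congr fun x => by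
    rcases le_total (2 ^ i x) (z x + 1) with h | h
    · rw [min_eq_left h]
    · rw [min_eq_right h, Nat.div_eq_of_lt (by omega), Nat.div_eq_of_lt (by omega)]

theorem pushDigit_le (B a d : ℕ) : EnergyGame.pushDigit B a d ≤ B := min_le_right _ _

/-- The cut-off at `B` prevents the rounds from accumulating. This estimate and its analogues below
supply the bound required by `Realizable.rec`. -/
theorem pushBits_aux_le (B a z i : ℕ) : Nat.rec (motive := fun _ => ℕ) a
    (fun j acc => if z / 2 ^ j = 0 then acc else EnergyGame.pushDigit B acc (2 + z / 2 ^ j % 2)) i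
    ≤ a + B := by
  induction i with
  | zero => exact Nat.le_add_right _ _
  | succ i ih =>
    simp only at ih ⊢
    split_ifs
    · exact ih
    · exact (pushDigit_le _ _ _).trans (Nat.le_add_left _ _)

theorem Realizable.pushBits (hB : Realizable B) (ha : Realizable a) (hz : Realizable z) :
    Realizable (fun x => pushBits (B x) (a x) (z x)) := by
  classical
  have hd : Realizable (fun p : (α × ℕ) × ℕ => z p.1.1 / 2 ^ p.1.2) :=
    hz.fst.fst.div_two_pow Realizable.snd.fst
  have h := Realizable.rec (M := fun x => a x + B x) hz ha
    (step := fun p => if z p.1.1 / 2 ^ p.1.2 = 0 then p.2 else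
      EnergyGame.pushDigit (B p.1.1) p.2 (2 + z p.1.1 / 2 ^ p.1.2 % 2))
    ((Realizable.ite hd.eq_zero .snd (hB.fst.fst.pushDigit .snd
      ((Realizable.const 2).add (hd.mod (.const 2))))).congr fun _ => by congr)
    (ha.1.add hB.1) (fun x i _ => pushBits_aux_le (B x) (a x) (z x) i)
  exact h

theorem pushEntry_le (B a e : ℕ) : EnergyGame.pushEntry B a e ≤ a + 2 * B := by
  unfold EnergyGame.pushEntry
  split_ifs
  · omega
  · have := pushBits_aux_le B (EnergyGame.pushDigit B a 3) (e / 2) (e / 2)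
    have h2 := pushDigit_le B a 3
    change EnergyGame.pushBits _ _ _ ≤ _ at this
    omega
  · have := pushBits_aux_le B (EnergyGame.pushDigit B a 2) (e / 2) (e / 2)
    have h2 := pushDigit_le B a 2
    change EnergyGame.pushBits _ _ _ ≤ _ at this
    omega

theorem Realizable.pushEntry (hB : Realizable B) (ha : Realizable a) (he : Realizable e) :
    Realizable (fun x => pushEntry (B x) (a x) (e x)) := by
  classical
  exact (Realizable.ite he.eq_zero ha (hB.pushBits (hB.pushDigit ha
    (Realizable.ite (he.mod (.const 2)).eq_zero (.const 3) (.const 2)))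
    (he.div (.const 2)))).congr fun x => by unfold EnergyGame.pushEntry; congr

theorem pushRow_aux_le (B k n T v a i : ℕ) : Nat.rec (motive := fun _ => ℕ) a
    (fun u acc => EnergyGame.pushEntry B (EnergyGame.pushDigit B acc 6)
      (EnergyGame.dig B k T (v * n + u))) i ≤ a + 3 * B := by
  cases i with
  | zero => exact Nat.le_add_right _ _
  | succ i =>
    refine (pushEntry_le _ _ _).trans ?_
    refine (Nat.add_le_add_right (pushDigit_le _ _ _) _).trans (by omega)

theorem Realizable.pushRow (hB : Realizable B) (hk : Realizable k) (hn : Realizable n)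
    (hO : Realizable O) (hI : Realizable I) (hT : Realizable T) (ha : Realizable a)
    (hv : Realizable v) :
    Realizable (fun x => pushRow (B x) (k x) (n x) (O x) (I x) (T x) (a x) (v x)) := by
  classical
  have hbase : Realizable (fun x => EnergyGame.pushDigit (B x) (EnergyGame.pushDigit (B x)
      (EnergyGame.pushDigit (B x) (a x) 4) (if EnergyGame.dig (B x) 1 (O x) (v x) = 0 then 2 else 3))
      (if v x = I x then 3 else 2)) :=
    (hB.pushDigit (hB.pushDigit (hB.pushDigit ha (.const 4)) (Realizable.ite
      (hB.dig (.const 1) hO hv).eq_zero (.const 2) (.const 3)))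
      (Realizable.ite (hv.eq hI) (.const 3) (.const 2))).congr fun _ => by congr
  exact Realizable.rec (M := fun x => EnergyGame.pushDigit (B x) (EnergyGame.pushDigit (B x)
      (EnergyGame.pushDigit (B x) (a x) 4) (if EnergyGame.dig (B x) 1 (O x) (v x) = 0 then 2 else 3))
      (if v x = I x then 3 else 2) + 3 * B x) hn hbase
    (step := fun p => EnergyGame.pushEntry (B p.1.1) (EnergyGame.pushDigit (B p.1.1) p.2 6)
      (EnergyGame.dig (B p.1.1) (k p.1.1) (T p.1.1) (v p.1.1 * n p.1.1 + p.1.2)))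
    (hB.fst.fst.pushEntry (hB.fst.fst.pushDigit .snd (.const 6))
      (hB.fst.fst.dig hk.fst.fst hT.fst.fst ((hv.fst.fst.mul hn.fst.fst).add Realizable.snd.fst)))
    (hbase.1.add ((PolyBdd.const 3).mul hB.1)) (fun x i _ =>
      pushRow_aux_le (B x) (k x) (n x) (T x) (v x) _ i)

theorem Realizable.encodeNum (hB : Realizable B) (hk : Realizable k) (hn : Realizable n)
    (hO : Realizable O) (hI : Realizable I) (hT : Realizable T) :
    Realizable (fun x => encodeNum (B x) (k x) (n x) (O x) (I x) (T x)) := by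
  refine Realizable.rec (M := fun x => 4 * B x) hn .zero
    (step := fun p => EnergyGame.pushRow (B p.1.1) (k p.1.1) (n p.1.1) (O p.1.1) (I p.1.1) (T p.1.1)
      p.2 p.1.2)
    (hB.fst.fst.pushRow hk.fst.fst hn.fst.fst hO.fst.fst hI.fst.fst hT.fst.fst .snd
      Realizable.snd.fst) ((PolyBdd.const 4).mul hB.1) (fun x i _ => ?_)
  cases i with
  | zero => exact Nat.zero_le _
  | succ i =>
    refine (pushRow_aux_le _ _ _ _ _ _ _).trans ?_
    refine (Nat.add_le_add_right (pushDigit_le _ _ _) _).trans ?_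
    simp only
    omega

theorem Realizable.moveInto (hB : Realizable B) (hb : Realizable b) (hS : Realizable S)
    (he : Realizable e) (hc : Realizable c) (hu : Realizable u) :
    RealizablePred (fun x => MoveInto (B x) (b x) (S x) (e x) (c x) (u x)) := by
  have h2 := he.div (.const 2)
  have hm := (he.mod (.const 2)).eq_zero
  exact he.eq_zero.not.and ((hm.not.imp (((hc.add h2).le hb).and (hB.dig (.const 1) hS
    ((hu.mul hb.succ).add (hc.add h2))).eq_zero.not)).and (hm.imp ((h2.le hc).and
    (hB.dig (.const 1) hS ((hu.mul hb.succ).add (hc.sub h2))).eq_zero.not)))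

theorem Realizable.safeNum (hB : Realizable B) (hk : Realizable k) (hb : Realizable b)
    (hn : Realizable n) (hO : Realizable O) (hI : Realizable I) (hT : Realizable T)
    (hS : Realizable S) : RealizablePred
      (fun x => SafeNum (B x) (k x) (b x) (n x) (O x) (I x) (T x) (S x)) := by
  have hv : Realizable (fun p : (α × ℕ) × ℕ => p.1.2) := Realizable.snd.fst
  have hc : Realizable (fun p : (α × ℕ) × ℕ => p.2) := Realizable.snd
  have hOv := (hB.fst.fst.dig (.const 1) hO.fst.fst hv).eq_zero
  have hTe := hB.fst.fst.fst.dig hk.fst.fst.fst hT.fst.fst.fst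
    ((hv.fst.mul hn.fst.fst.fst).add Realizable.snd)
  have hmv := hB.fst.fst.fst.moveInto hb.fst.fst.fst hS.fst.fst.fst hTe hc.fst Realizable.snd
  exact (hB.dig (.const 1) hS (hI.mul hb.succ)).eq_zero.not.and
    (RealizablePred.forall_lt hn (RealizablePred.forall_lt hb.fst.succ
      ((hB.fst.fst.dig (.const 1) hS.fst.fst ((hv.mul hb.fst.fst.succ).add hc)).eq_zero.not.imp
        ((hOv.imp (RealizablePred.exists_lt hn.fst.fst hmv)).and
          (hOv.not.imp (RealizablePred.forall_lt hn.fst.fst (hTe.eq_zero.not.imp hmv)))))))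

/-- Every quantifier ranges below `l + 1`, `n` or `B`, so exhaustive search is polynomial in the
size of the environment, of which `B` is a component in the application. -/
theorem Realizable.positiveNum (hB : Realizable B) (hl : Realizable l) (ha : Realizable a) :
    RealizablePred (fun x => PositiveNum (B x) (l x) (a x)) := by
  have vn : Realizable (fun p : (((α × ℕ) × ℕ) × ℕ) × ℕ => p.1.1.1.2) := Realizable.snd.fst.fst.fst
  have vO : Realizable (fun p : (((α × ℕ) × ℕ) × ℕ) × ℕ => p.1.1.2) := Realizable.snd.fst.fst
  have vI : Realizable (fun p : (((α × ℕ) × ℕ) × ℕ) × ℕ => p.1.2) := Realizable.snd.fst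
  have vT : Realizable (fun p : (((α × ℕ) × ℕ) × ℕ) × ℕ => p.2) := Realizable.snd
  have hB4 := hB.fst.fst.fst.fst
  have hl4 := hl.fst.fst.fst.fst
  have hb : Realizable (fun p : (((α × ℕ) × ℕ) × ℕ) × ℕ =>
      Min.min (2 ^ ((l p.1.1.1.1 + 3) ^ 2)) (B p.1.1.1.1)) :=
    .min_pow (.const 2) ((hl4.add (.const 3)).pow 2) hB4 fun _ => by norm_num
  have hvalid := RealizablePred.forall_lt vn (RealizablePred.exists_lt vn.fst
    (hB4.fst.fst.dig hl4.fst.fst.succ vT.fst.fst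
      ((Realizable.snd.fst.mul vn.fst.fst).add Realizable.snd)).eq_zero.not)
  have henc := (hB4.encodeNum hl4.succ vn vO vI vT).eq ha.fst.fst.fst.fst
  have hsafe := RealizablePred.exists_lt hB4 (hB4.fst.safeNum hl4.fst.succ hb.fst vn.fst vO.fst
    vI.fst vT.fst Realizable.snd)
  exact RealizablePred.exists_lt hl.succ (RealizablePred.exists_lt hB.fst
    (RealizablePred.exists_lt Realizable.snd.fst (RealizablePred.exists_lt hB.fst.fst.fst
      (hvalid.and (henc.and hsafe)))))

end

end EnergyGame

namespace EnergyGame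

open Computability

/-! ### Words as numbers -/

/-- Append the symbols of a word to a number in base `7`. -/
def wordNum (a : ℕ) (x : List Γ') : ℕ := x.foldl (fun a c => 7 * a + symNum (some c)) a

theorem wordNum_append (a : ℕ) (x y : List Γ') : wordNum a (x ++ y) = wordNum (wordNum a x) y :=
  List.foldl_append

/-- The variant of `wordNum` that is cut off at `B`. -/
def capNum (B a : ℕ) (x : List Γ') : ℕ := x.foldl (fun a c => pushDigit B a (symNum (some c))) a

theorem capNum_append (B a : ℕ) (x y : List Γ') :
    capNum B a (x ++ y) = capNum B (capNum B a x) y := List.foldl_append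

/-- Appending a digit is monotone and never decreases a number, so cutting off after each digit or
once at the end is the same. -/
theorem capNum_min (B a : ℕ) (x : List Γ') : capNum B (min a B) x = min (wordNum a x) B := by
  induction x generalizing a with
  | nil => rfl
  | cons c x ih =>
    have : pushDigit B (min a B) (symNum (some c)) = min (7 * a + symNum (some c)) B := by
      unfold pushDigit; omega
    simp only [capNum, wordNum, List.foldl_cons, this] at ih ⊢
    exact ih _

theorem symNum_pos (c : Γ') : 1 ≤ symNum (some c) := by
  rcases c with _ | (_ | _) | _ | _ | _ <;> simp [symNum]

theorem symNum_some_injective : Function.Injective fun c : Γ' => symNum (some c) := by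
  rintro (_ | (_ | _) | _ | _ | _) (_ | (_ | _) | _ | _ | _) h <;> simp [symNum] at h <;> rfl

/-- Symbols are digits from `1` to `6` in base `7`; without the digit `0` even the length can be
recovered. -/
theorem wordNum_injective : Function.Injective (wordNum 0) := by
  intro x
  induction x using List.reverseRecOn with
  | nil =>
    intro y h
    induction y using List.reverseRecOn with
    | nil => rfl
    | append_singleton y d _ =>
      rw [wordNum_append] at h
      have := symNum_pos d
      simp only [wordNum, List.foldl_cons, List.foldl_nil] at h
      omega
  | append_singleton x c ih =>
    intro y h
    induction y using List.reverseRecOn with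
    | nil =>
      rw [wordNum_append] at h
      have := symNum_pos c
      simp only [wordNum, List.foldl_cons, List.foldl_nil] at h
      omega
    | append_singleton y d _ =>
      rw [wordNum_append, wordNum_append] at h
      have h1 := symNum_le (some c)
      have h2 := symNum_le (some d)
      change 7 * wordNum 0 x + symNum (some c) = 7 * wordNum 0 y + symNum (some d) at h
      have h3 : symNum (some c) = symNum (some d) := by omega
      rw [ih (show wordNum 0 x = wordNum 0 y by omega), symNum_some_injective h3]

theorem wordNum_lt (x : List Γ') : wordNum 0 x < 7 ^ x.length := by
  induction x using List.reverseRecOn with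
  | nil => simp [wordNum]
  | append_singleton x c ih =>
    rw [wordNum_append, List.length_append, List.length_singleton, pow_succ]
    have := symNum_le (some c)
    change 7 * wordNum 0 x + symNum (some c) < _
    omega

theorem encodePosNum_eq_bits (p : PosNum) : encodePosNum p = Nat.bits (p : ℕ) := by
  induction p with
  | one => simp [encodePosNum]
  | bit1 p ih =>
    rw [encodePosNum, ih, PosNum.cast_bit1, ← two_mul, Nat.bit1_bits]
  | bit0 p ih =>
    rw [encodePosNum, ih, PosNum.cast_bit0, ← two_mul, Nat.bit0_bits _ (PosNum.to_nat_pos p).ne']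

theorem encodeNat_eq_bits (n : ℕ) : encodeNat n = n.bits := by
  have : ∀ m : Num, Computability.encodeNum m = Nat.bits (m : ℕ) := by
    intro m
    cases m with
    | zero => simp [Computability.encodeNum]
    | pos p => exact encodePosNum_eq_bits p
  rw [encodeNat, this, Num.to_of_nat]

/-- `encodeNat` lists bits from the least significant one, so round `j` appends bit `j`; the test `z
/ 2 ^ j = 0` detects that the bits are exhausted, and `z` rounds suffice since `z < 2 ^ z`. -/
theorem pushBits_eq (B a z : ℕ) : pushBits B a z = capNum B a ((encodeNat z).map Γ'.bit) := by
  have key : ∀ k, Nat.rec (motive := fun _ => ℕ) a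
      (fun j acc => if z / 2 ^ j = 0 then acc else pushDigit B acc (2 + z / 2 ^ j % 2)) k =
      capNum B a ((z.bits.take k).map Γ'.bit) := by
    intro k
    induction k with
    | zero => rfl
    | succ k ih =>
      simp only at ih ⊢
      rw [ih]
      by_cases hk : k < z.bits.length
      · have h1 : z / 2 ^ k ≠ 0 := by
          rw [Nat.size_eq_bits_len, Nat.lt_size] at hk
          exact (Nat.div_pos hk (by positivity)).ne'
        have h2 : z.bits[k] = z.testBit k := by
          rw [Nat.testBit_eq_inth, List.getI_eq_getElem _ hk]
        rw [if_neg h1, List.take_succ_eq_append_getElem hk, List.map_append, capNum_append, h2]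
        have h3 : symNum (some (Γ'.bit (z.testBit k))) = 2 + z / 2 ^ k % 2 := by
          rw [Nat.testBit_eq_decide_div_mod_eq]
          rcases Nat.mod_two_eq_zero_or_one (z / 2 ^ k) with h | h <;> simp [h, symNum]
        simp only [capNum, List.map_cons, List.map_nil, List.foldl_cons, List.foldl_nil, h3]
      · have h1 : z / 2 ^ k = 0 := by
          rw [Nat.size_eq_bits_len, Nat.lt_size] at hk
          exact Nat.div_eq_of_lt (not_le.1 hk)
        rw [if_pos h1, List.take_of_length_le (by omega), List.take_of_length_le (by omega)]
  have hlen : z.bits.length ≤ z := by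
    rw [Nat.size_eq_bits_len, Nat.size_le]
    exact Nat.lt_two_pow_self
  rw [pushBits, key, List.take_of_length_le hlen, encodeNat_eq_bits]

/-- The weight with a given number. -/
def weightOf (e : ℕ) : ℤ := if e % 2 = 0 then -((e / 2 : ℕ) : ℤ) else ((e / 2 : ℕ) : ℤ)

/-- The entry with a given number. -/
def entryOf (e : ℕ) : Option ℤ := if e = 0 then none else some (weightOf e)

theorem pushEntry_eq (B a e : ℕ) : pushEntry B a e = capNum B a (encodeEntry (entryOf e)) := by
  unfold pushEntry entryOf
  by_cases h0 : e = 0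
  · simp [h0, encodeEntry, capNum]
  · rw [if_neg h0, if_neg h0, pushBits_eq]
    have h1 : (weightOf e).natAbs = e / 2 := by unfold weightOf; split_ifs <;> omega
    have h2 : decide (weightOf e < 0) = decide (e % 2 = 0) := by
      rw [decide_eq_decide]; unfold weightOf; split_ifs <;> omega
    rw [encodeEntry, h1, h2]
    by_cases h : e % 2 = 0 <;> simp [h, capNum, symNum]

theorem exists_entryOf (o : Option ℤ) : ∃ e, entryOf e = o ∧ ∀ z ∈ o, e ≤ 2 * z.natAbs + 1 := by
  cases o with
  | none => exact ⟨0, rfl, by simp⟩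
  | some z =>
    by_cases h : z < 0
    · refine ⟨2 * z.natAbs, ?_, by simp⟩
      unfold entryOf weightOf
      rw [if_neg (by omega), if_pos (by omega)]
      congr 1
      omega
    · refine ⟨2 * z.natAbs + 1, ?_, by simp⟩
      unfold entryOf weightOf
      rw [if_neg (by omega), if_neg (by omega)]
      congr 1
      omega

theorem exists_digits (k : ℕ) : ∀ (m : ℕ) (f : ℕ → ℕ), (∀ i < m, f i < 4 ^ k) →
    ∃ T < 4 ^ (k * m), ∀ i < m, T / 4 ^ (k * i) % 4 ^ k = f i := by
  intro m
  induction m with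
  | zero => exact fun f _ => ⟨0, by simp, by simp⟩
  | succ m ih =>
    intro f hf
    obtain ⟨T, hT, h⟩ := ih (fun i => f (i + 1)) fun i hi => hf (i + 1) (by omega)
    have h0 := hf 0 (by omega)
    refine ⟨f 0 + 4 ^ k * T, ?_, fun i hi => ?_⟩
    · have : 4 ^ (k * (m + 1)) = 4 ^ k * 4 ^ (k * m) := by ring
      rw [this]
      calc f 0 + 4 ^ k * T < 4 ^ k + 4 ^ k * T := by omega
        _ = 4 ^ k * (T + 1) := by ring
        _ ≤ 4 ^ k * 4 ^ (k * m) := Nat.mul_le_mul_left _ hT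
    · cases i with
      | zero => simp [Nat.mod_eq_of_lt h0]
      | succ i =>
        have : 4 ^ (k * (i + 1)) = 4 ^ k * 4 ^ (k * i) := by ring
        rw [this, ← Nat.div_div_eq_div_mul, Nat.add_mul_div_left _ _ (by positivity),
          Nat.div_eq_of_lt h0, zero_add]
        exact h i (by omega)

/-- If all `m` digits fit below `B`, the cut-offs in `dig` have no effect. -/
theorem exists_dig {B k m : ℕ} (hB : 4 ^ (k * m) ≤ B) (f : ℕ → ℕ) (hf : ∀ i < m, f i < 4 ^ k) :
    ∃ T < B, ∀ i < m, dig B k T i = f i := by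
  obtain ⟨T, hT, h⟩ := exists_digits k m f hf
  refine ⟨T, hT.trans_le hB, fun i hi => ?_⟩
  have h1 : 4 ^ (k * i) ≤ B :=
    (Nat.pow_le_pow_right (by norm_num) (Nat.mul_le_mul_left _ hi.le)).trans hB
  have h2 : 4 ^ k ≤ B :=
    (Nat.pow_le_pow_right (by norm_num) (Nat.le_mul_of_pos_right k (by omega))).trans hB
  rw [dig, min_eq_left h1, min_eq_left h2, h i hi]

/-! ### Inputs as numbers -/

/-- The numbers `O`, `i₀`, `T` describe the input `I`. -/
structure Describes (B k O i₀ T : ℕ) (I : Instance) : Prop where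
  owner : ∀ v : Fin I.n, dig B 1 O v = 0 ↔ I.arena.owner v = 0
  init : (I.arena.init : ℕ) = i₀
  entry : ∀ v u : Fin I.n, entryOf (dig B k T (v * I.n + u)) = I.entry v u

theorem flatten_ofFn_eq {β : Type} (n : ℕ) (F : Fin n → List β) (g : ℕ → List β)
    (h : ∀ i : Fin n, F i = g i) : (List.ofFn F).flatten = ((List.range n).map g).flatten := by
  congr 1
  apply List.ext_getElem
  · simp
  · intro i h1 h2
    simp [h]

theorem rec_capNum (B a n : ℕ) (g : ℕ → List Γ') :
    Nat.rec (motive := fun _ => ℕ) a (fun u acc => capNum B acc (g u)) n =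
      capNum B a ((List.range n).map g).flatten := by
  induction n with
  | zero => rfl
  | succ n ih =>
    simp only at ih ⊢
    rw [ih, List.range_succ, List.map_append, List.flatten_append, capNum_append]
    simp

section
variable {B k O i₀ T : ℕ} {I : Instance}

/-- This replaces parsing: the search guesses an input, and its encoding is compared with the given
word as a number. -/
theorem Describes.encodeNum_eq (h : Describes B k O i₀ T I) :
    encodeNum B k I.n O i₀ T = min (wordNum 0 I.encode) B := by
  set row : ℕ → List Γ' := fun v => Γ'.bit (decide (dig B 1 O v ≠ 0)) :: Γ'.bit (decide (v = i₀)) ::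
    ((List.range I.n).map fun u =>
      Γ'.comma :: encodeEntry (entryOf (dig B k T (v * I.n + u)))).flatten with hrow
  have h1 : I.encode = ((List.range I.n).map fun v => Γ'.bra :: row v).flatten := by
    refine flatten_ofFn_eq _ _ _ fun v => ?_
    rw [Instance.encodeRow, hrow]
    congr 2
    · congr 1
      rw [decide_eq_decide]
      have := h.owner v
      rcases fin_two_cases (I.arena.owner v) with h' | h' <;> simp [h'] at this ⊢ <;> exact this
    · congr 1
      · congr 1
        rw [decide_eq_decide, ← h.init, Fin.ext_iff]
      · exact flatten_ofFn_eq _ _ _ fun u => by rw [h.entry]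
  have h2 : ∀ a v, pushRow B k I.n O i₀ T a v = capNum B a (Γ'.bra :: row v) := by
    intro a v
    unfold pushRow
    have h3 : ∀ u acc, pushEntry B (pushDigit B acc 6) (dig B k T (v * I.n + u)) =
        capNum B acc (Γ'.comma :: encodeEntry (entryOf (dig B k T (v * I.n + u)))) := by
      intro u acc
      rw [pushEntry_eq]
      rfl
    simp only [h3]
    rw [rec_capNum]
    change _ = capNum B (pushDigit B (pushDigit B (pushDigit B a (symNum (some Γ'.bra)))
      (symNum (some (Γ'.bit (decide (dig B 1 O v ≠ 0))))))
      (symNum (some (Γ'.bit (decide (v = i₀)))))) _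
    congr 1
    generalize dig B 1 O v = d
    by_cases h4 : d = 0 <;> by_cases h5 : v = i₀ <;> simp [h4, h5, symNum]
  rw [h1, encodeNum]
  simp only [h2]
  rw [rec_capNum]
  have := capNum_min B 0 ((List.range I.n).map fun v => Γ'.bra :: row v).flatten
  rwa [Nat.zero_min] at this

theorem Describes.edge_iff (h : Describes B k O i₀ T I) (v u : Fin I.n) :
    dig B k T (v * I.n + u) ≠ 0 ↔ I.arena.E v u := by
  have := h.entry v u
  unfold entryOf Instance.entry at this
  split_ifs at this with h1 h2
  · simp [h1, h2]
  · rename_i h2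
    simp [h1, h2]

theorem Describes.weightFun_eq (h : Describes B k O i₀ T I) {v u : Fin I.n}
    (hE : I.arena.E v u) :
    weightFun I.arena I.weight v u = weightOf (dig B k T (v * I.n + u)) := by
  have h1 := h.entry v u
  have h2 := (h.edge_iff v u).2 hE
  unfold entryOf Instance.entry at h1
  rw [if_neg h2, dif_pos hE] at h1
  rw [weightFun, dif_pos hE]
  exact (Option.some.inj h1).symm

/-- The set of configurations that is described by the digits of `S`. -/
def configSet (B b n S : ℕ) : Set (Fin n × ℤ) :=
  {p | 0 ≤ p.2 ∧ p.2 ≤ b ∧ dig B 1 S (p.1 * (b + 1) + p.2.toNat) ≠ 0}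

theorem Describes.moveInto_iff (h : Describes B k O i₀ T I) {b S : ℕ} {v u : Fin I.n} {c : ℕ}
    (hc : c ≤ b) : MoveInto B b S (dig B k T (v * I.n + u)) c u ↔
      I.arena.E v u ∧ (u, (c : ℤ) + weightFun I.arena I.weight v u) ∈ configSet B b I.n S := by
  rw [MoveInto, h.edge_iff]
  refine and_congr_right fun hE => ?_
  rw [h.weightFun_eq hE]
  set e := dig B k T (v * I.n + u)
  unfold configSet weightOf
  simp only [Set.mem_ofPred_eq]
  by_cases he : e % 2 = 0
  · simp only [he, if_true, ne_eq, not_true_eq_false, false_implies, true_and, true_implies]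
    constructor
    · rintro ⟨h1, h2⟩
      refine ⟨by omega, by omega, ?_⟩
      rwa [show ((c : ℤ) + -((e / 2 : ℕ) : ℤ)).toNat = c - e / 2 by omega]
    · rintro ⟨h1, h2, h3⟩
      refine ⟨by omega, ?_⟩
      rwa [show ((c : ℤ) + -((e / 2 : ℕ) : ℤ)).toNat = c - e / 2 by omega] at h3
  · simp only [he, if_false, ne_eq, not_false_eq_true, true_implies, false_implies, and_true]
    constructor
    · rintro ⟨h1, h2⟩
      refine ⟨by omega, by omega, ?_⟩
      rwa [show ((c : ℤ) + ((e / 2 : ℕ) : ℤ)).toNat = c + e / 2 by omega]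
    · rintro ⟨h1, h2, h3⟩
      refine ⟨by omega, ?_⟩
      rwa [show ((c : ℤ) + ((e / 2 : ℕ) : ℤ)).toNat = c + e / 2 by omega] at h3

theorem Describes.safeNum_iff (h : Describes B k O i₀ T I) {b S : ℕ} :
    SafeNum B k b I.n O i₀ T S ↔ (I.arena.init, 0) ∈ configSet B b I.n S ∧
      ClosedSet I.arena.owner I.arena.E (weightFun I.arena I.weight) (configSet B b I.n S) := by
  have hmem : ∀ (v : Fin I.n) (c : ℕ), c ≤ b →
      ((v, (c : ℤ)) ∈ configSet B b I.n S ↔ dig B 1 S (v * (b + 1) + c) ≠ 0) := by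
    intro v c hc
    simp only [configSet, Set.mem_ofPred_eq, Int.toNat_natCast]
    constructor
    · exact fun h => h.2.2
    · exact fun h => ⟨by omega, by omega, h⟩
  refine and_congr ?_ ⟨fun hs => ?_, fun hs => ?_⟩
  · have := hmem I.arena.init 0 (Nat.zero_le _)
    rw [← h.init]
    simpa using this.symm
  · intro v e he
    obtain ⟨c, rfl⟩ := Int.eq_ofNat_of_zero_le he.1
    have hc : c ≤ b := by have := he.2.1; simp only at this; omega
    obtain ⟨h0, h1⟩ := hs v v.2 c (by omega) ((hmem v c hc).1 he)
    refine ⟨fun ho => ?_, fun ho u hu => ?_⟩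
    · obtain ⟨u, hu, hm⟩ := h0 ((h.owner v).2 ho)
      exact ⟨⟨u, hu⟩, (h.moveInto_iff (u := ⟨u, hu⟩) hc).1 hm⟩
    · exact ((h.moveInto_iff hc).1 (h1 (fun h' => by
        have := (h.owner v).1 h'; rw [this] at ho; exact absurd ho (by decide)) u u.2
        ((h.edge_iff v u).2 hu))).2
  · intro v hv c hc hd
    have hc : c ≤ b := by omega
    have := hs ⟨v, hv⟩ c ((hmem ⟨v, hv⟩ c hc).2 hd)
    refine ⟨fun ho => ?_, fun ho u hu hd => ?_⟩
    · obtain ⟨u, hu, hu'⟩ := this.1 ((h.owner ⟨v, hv⟩).1 ho)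
      exact ⟨u, u.2, (h.moveInto_iff (v := ⟨v, hv⟩) hc).2 ⟨hu, hu'⟩⟩
    · have hE : I.arena.E ⟨v, hv⟩ ⟨u, hu⟩ := (h.edge_iff ⟨v, hv⟩ ⟨u, hu⟩).1 hd
      have ho' : I.arena.owner ⟨v, hv⟩ = 1 :=
        (fin_two_cases _).resolve_left fun h' => ho ((h.owner ⟨v, hv⟩).2 h')
      exact (h.moveInto_iff (v := ⟨v, hv⟩) (u := ⟨u, hu⟩) hc).2 ⟨hE, this.2 ho' _ hE⟩

/-- A closed set inside the box is given by one digit for each of its `I.n * (b + 1)`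
configurations, so it has a code below `B`. -/
theorem Describes.exists_safeNum_iff (h : Describes B k O i₀ T I) {b : ℕ}
    (hB : 4 ^ (1 * (I.n * (b + 1))) ≤ B) : (∃ S < B, SafeNum B k b I.n O i₀ T S) ↔
      SafeFrom I.arena.owner I.arena.E (weightFun I.arena I.weight) b I.arena.init 0 := by
  classical
  constructor
  · rintro ⟨S, -, hS⟩
    obtain ⟨h1, h2⟩ := h.safeNum_iff.1 hS
    exact ⟨_, h2, fun p hp => ⟨hp.1, hp.2.1⟩, h1⟩
  · rintro ⟨S₀, h1, h2, h3⟩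
    obtain ⟨S, hSB, hS⟩ := exists_dig hB (fun i => if ∃ (v : Fin I.n) (c : ℕ), (v, (c : ℤ)) ∈ S₀ ∧
      i = v * (b + 1) + c then 1 else 0) (fun i _ => by split_ifs <;> norm_num)
    have : configSet B b I.n S = S₀ := by
      ext ⟨v, e⟩
      have key : ∀ c : ℕ, c ≤ b → (dig B 1 S (v * (b + 1) + c) ≠ 0 ↔ (v, (c : ℤ)) ∈ S₀) := by
        intro c hc
        have hlt : v * (b + 1) + c < I.n * (b + 1) := by
          have : (v + 1) * (b + 1) ≤ I.n * (b + 1) := Nat.mul_le_mul_right _ v.2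
          have h' : (v + 1) * (b + 1) = (v : ℕ) * (b + 1) + (b + 1) := by ring
          omega
        rw [hS _ hlt]
        constructor
        · intro hd
          split_ifs at hd with hex
          · obtain ⟨v', c', hm, heq⟩ := hex
            have hc' := (h2 _ hm).2
            simp only at hc'
            have hc'' : c' < b + 1 := by omega
            have e1 : v = v' := by
              have := congrArg (· / (b + 1)) heq
              simp only [mul_comm _ (b + 1)] at this
              rw [Nat.mul_add_div (by omega), Nat.mul_add_div (by omega),
                Nat.div_eq_of_lt (show c < b + 1 by omega), Nat.div_eq_of_lt hc''] at this
              exact Fin.ext (by simpa using this)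
            subst e1
            have e2 : c = c' := by omega
            rw [e2]
            exact hm
          · exact absurd rfl hd
        · intro hm
          rw [if_pos ⟨v, c, hm, rfl⟩]
          norm_num
      constructor
      · rintro ⟨he0, heb, hd⟩
        obtain ⟨c, rfl⟩ := Int.eq_ofNat_of_zero_le he0
        exact (key c (by simp only at heb; omega)).1 hd
      · intro hm
        have := h2 _ hm
        obtain ⟨c, rfl⟩ := Int.eq_ofNat_of_zero_le this.1
        exact ⟨this.1, this.2, (key c (by have := this.2; simp only at this; omega)).2 hm⟩
    exact ⟨S, hSB, h.safeNum_iff.2 ⟨by rwa [this], by rwa [this]⟩⟩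

end

theorem exists_describes_of_instance {B k : ℕ} (I : Instance)
    (hB : 4 ^ (k * (I.n * I.n)) ≤ B) (hB' : 4 ^ (1 * I.n) ≤ B)
    (hk : ∀ v u : Fin I.n, ∀ z ∈ I.entry v u, 2 * z.natAbs + 1 < 4 ^ k) :
    ∃ O < B, ∃ T < B, Describes B k O I.arena.init T I := by
  classical
  obtain ⟨O, hOB, hO⟩ := exists_dig hB' (fun i => if h : i < I.n then
    (I.arena.owner ⟨i, h⟩ : ℕ) else 0) (fun i _ => by split_ifs; all_goals omega)
  choose c hc1 hc2 using fun v u => exists_entryOf (I.entry v u)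
  have hn : 0 < I.n := I.arena.init.pos
  obtain ⟨T, hTB, hT⟩ := exists_dig hB (fun i => if h : i / I.n < I.n then
    c ⟨i / I.n, h⟩ ⟨i % I.n, Nat.mod_lt _ hn⟩ else 0) (fun i _ => by
      split_ifs with h
      · rcases he : I.entry ⟨i / I.n, h⟩ ⟨i % I.n, Nat.mod_lt _ hn⟩ with _ | z
        · have := hc1 ⟨i / I.n, h⟩ ⟨i % I.n, Nat.mod_lt _ hn⟩
          rw [he] at this
          unfold entryOf at this
          split_ifs at this with h0
          rw [h0]
          positivity
        · exact (hc2 _ _ z (by rw [he]; rfl)).trans_lt (hk _ _ z (by rw [he]; rfl))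
      · positivity)
  refine ⟨O, hOB, T, hTB, fun v => ?_, rfl, fun v u => ?_⟩
  · rw [hO v v.2, dif_pos v.2, Fin.ext_iff]
    rfl
  · have hlt : v * I.n + u < I.n * I.n := by
      have : (v + 1) * I.n ≤ I.n * I.n := Nat.mul_le_mul_right _ v.2
      have h' : (v + 1) * I.n = (v : ℕ) * I.n + I.n := by ring
      have := u.2
      omega
    have h1 : (v * I.n + u) / I.n = v := by
      rw [mul_comm, Nat.mul_add_div hn, Nat.div_eq_of_lt u.2, add_zero]
    have h2 : (v * I.n + u) % I.n = u := by
      rw [mul_comm, Nat.mul_add_mod, Nat.mod_eq_of_lt u.2]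
    rw [hT _ hlt]
    simp only [h1, h2, v.2, dif_pos]
    exact hc1 v u

theorem exists_instance_describes {B k n O i₀ T : ℕ} (hi : i₀ < n)
    (hv : ∀ v < n, ∃ u < n, dig B k T (v * n + u) ≠ 0) :
    ∃ I : Instance, I.n = n ∧ Describes B k O i₀ T I := by
  classical
  refine ⟨⟨n, ⟨fun v => if dig B 1 O v = 0 then 0 else 1, fun v u => dig B k T (v * n + u) ≠ 0,
    fun v => ?_, ⟨i₀, hi⟩⟩, fun e => weightOf (dig B k T (e.1.1 * n + e.1.2))⟩, rfl, ?_, rfl, ?_⟩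
  · obtain ⟨u, hu, h⟩ := hv v v.2
    exact ⟨⟨u, hu⟩, h⟩
  · intro v
    by_cases h : dig B 1 O v = 0 <;> simp [h]
  · intro v u
    unfold entryOf Instance.entry
    by_cases h : dig B k T (v * n + u) = 0 <;> simp [h]

theorem Instance.n_le_length (I : Instance) : I.n ≤ I.encode.length := by
  rw [Instance.encode, List.length_flatten]
  have : ∀ L : List (List Γ'), (∀ l ∈ L, 1 ≤ l.length) → L.length ≤ (L.map List.length).sum := by
    intro L
    induction L with
    | nil => simp
    | cons a L ih =>
      intro h
      have h1 := h a (by simp)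
      have h2 := ih fun l hl => h l (by simp [hl])
      simp only [List.length_cons, List.map_cons, List.sum_cons]
      omega
  refine le_trans (by simp) (this _ ?_)
  intro l hl
  obtain ⟨v, rfl⟩ := List.mem_ofFn.1 hl
  simp

open scoped List in
-- The binary notation of the weight is a sublist of the encoding.
theorem Instance.natAbs_lt (I : Instance) {v u : Fin I.n} {z : ℤ} (hz : z ∈ I.entry v u) :
    z.natAbs < 2 ^ I.encode.length := by
  have hz' : I.entry v u = some z := hz
  have h1 : encodeEntry (I.entry v u) <+ Γ'.comma :: encodeEntry (I.entry v u) :=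
    List.sublist_cons_self _ _
  have h2 : (Γ'.comma :: encodeEntry (I.entry v u)) <+
      (List.ofFn fun u => Γ'.comma :: encodeEntry (I.entry v u)).flatten :=
    List.sublist_flatten_of_mem (List.mem_ofFn.2 ⟨u, rfl⟩)
  have h3 : (List.ofFn fun u => Γ'.comma :: encodeEntry (I.entry v u)).flatten <+
      Γ'.bra :: I.encodeRow v :=
    (List.sublist_cons_self _ _).trans ((List.sublist_cons_self _ _).trans (List.sublist_cons_self _ _))
  have h4 : (Γ'.bra :: I.encodeRow v) <+ I.encode :=
    List.sublist_flatten_of_mem (List.mem_ofFn.2 ⟨v, rfl⟩)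
  have h5 := (h1.trans (h2.trans (h3.trans h4))).length_le
  rw [hz'] at h5
  simp only [encodeEntry, List.length_cons, List.length_map, encodeNat_eq_bits,
    Nat.size_eq_bits_len] at h5
  exact (Nat.lt_size_self _).trans_le (Nat.pow_le_pow_right (by norm_num) (by omega))

/-! ### Estimates -/

theorem capBound_le {n l : ℕ} (hn : n ≤ l) : capBound n (2 ^ l) ≤ 2 ^ ((l + 3) ^ 2) := by
  have hl : n ≤ 2 ^ l := hn.trans Nat.lt_two_pow_self.le
  have h1 : walkBound n (2 ^ l) ≤ 2 ^ (3 * l + 3) := by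
    unfold walkBound
    have e1 : (2 * n * 2 ^ l + 1) * n ≤ (2 * 2 ^ l * 2 ^ l + 1) * 2 ^ l := by gcongr
    have e2 : 2 ^ (3 * l + 3) = 8 * (2 ^ l * 2 ^ l * 2 ^ l) := by ring
    have e3 : 1 ≤ 2 ^ l := Nat.one_le_two_pow
    have e4 : 2 ^ l ≤ 2 ^ l * 2 ^ l * 2 ^ l := by nlinarith
    have e5 : (2 * 2 ^ l * 2 ^ l + 1) * 2 ^ l = 2 * (2 ^ l * 2 ^ l * 2 ^ l) + 2 ^ l := by ring
    omega
  have h2 : windowBound n (2 ^ l) (n * n) ≤ 2 ^ (l * l + 4 * l + 4) := by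
    unfold windowBound
    calc 2 ^ (n * n) * (2 * (2 ^ l * walkBound n (2 ^ l)))
        ≤ 2 ^ (l * l) * (2 * (2 ^ l * 2 ^ (3 * l + 3))) := by
          gcongr
          · norm_num
      _ = 2 ^ (l * l + 4 * l + 4) := by ring
  have h3 : 2 ^ l ≤ 2 ^ (l * l + 4 * l + 4) := Nat.pow_le_pow_right (by norm_num) (by omega)
  unfold capBound
  calc 2 * windowBound n (2 ^ l) (n * n) + 2 ^ l ≤ 4 * 2 ^ (l * l + 4 * l + 4) := by omega
    _ = 2 ^ (l * l + 4 * l + 6) := by ring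
    _ ≤ 2 ^ ((l + 3) ^ 2) := Nat.pow_le_pow_right (by norm_num) (by ring_nf; omega)

theorem four_pow_le {a l : ℕ} (h : 2 * a ≤ 2 ^ ((l + 4) ^ 2)) : 4 ^ a ≤ 2 ^ 2 ^ ((l + 4) ^ 2) := by
  rw [show (4 : ℕ) = 2 ^ 2 by norm_num, ← pow_mul]
  exact Nat.pow_le_pow_right (by norm_num) h

/-- The weights are at most `2 ^ l` and there are at most `l` vertices, so `capBound_le` justifies
the bound `2 ^ (l + 3) ^ 2` on the levels. Passing from `l + 3` to `l + 4` leaves room for codes of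
sets of configurations. -/
theorem positiveNum_iff (x : List Γ') :
    PositiveNum (2 ^ 2 ^ ((x.length + 4) ^ 2)) x.length (wordNum 0 x) ↔ x ∈ thresholdProblem := by
  set l := x.length with hl
  set B := 2 ^ 2 ^ ((l + 4) ^ 2) with hB
  set b := 2 ^ ((l + 3) ^ 2) with hb
  have hsq : (l + 4) ^ 2 = (l + 3) ^ 2 + 2 * l + 7 := by ring
  have hll : l < 2 ^ l := Nat.lt_two_pow_self
  have hl1 : l + 1 ≤ 2 ^ l := hll
  have hbB : min b B = b := by
    refine min_eq_left ?_
    rw [hB, hb]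
    refine Nat.pow_le_pow_right (by norm_num) ?_
    exact (Nat.pow_le_pow_left (by omega) 2).trans Nat.lt_two_pow_self.le
  have hB1 : ∀ n ≤ l, 4 ^ (1 * (n * (b + 1))) ≤ B := by
    intro n hn
    apply four_pow_le
    have h1 : b + 1 ≤ 2 * b := by have : 1 ≤ b := Nat.one_le_two_pow; omega
    calc 2 * (1 * (n * (b + 1))) ≤ 2 * (1 * (2 ^ l * (2 * b))) := by gcongr; omega
      _ = 2 ^ ((l + 3) ^ 2 + l + 2) := by rw [hb]; ring
      _ ≤ 2 ^ ((l + 4) ^ 2) := Nat.pow_le_pow_right (by norm_num) (by omega)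
  have hB2 : ∀ n ≤ l, 4 ^ (1 * n) ≤ B := fun n hn =>
    (Nat.pow_le_pow_right (by norm_num)
      (Nat.mul_le_mul_left _ (Nat.le_mul_of_pos_right _ b.succ_pos))).trans (hB1 n hn)
  have hB3 : ∀ n ≤ l, 4 ^ ((l + 1) * (n * n)) ≤ B := by
    intro n hn
    apply four_pow_le
    calc 2 * ((l + 1) * (n * n)) ≤ 2 * (2 ^ l * (2 ^ l * 2 ^ l)) := by gcongr <;> omega
      _ = 2 ^ (3 * l + 1) := by ring
      _ ≤ 2 ^ ((l + 4) ^ 2) := Nat.pow_le_pow_right (by norm_num) (by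
        have : l + 3 ≤ (l + 3) ^ 2 := Nat.le_self_pow (by norm_num) _
        omega)
  have hXB : wordNum 0 x < B := by
    refine (wordNum_lt x).trans_le ?_
    rw [← hl]
    calc 7 ^ l ≤ (2 ^ 3) ^ l := Nat.pow_le_pow_left (by norm_num) l
      _ = 2 ^ (3 * l) := by rw [← pow_mul]
      _ ≤ B := Nat.pow_le_pow_right (by norm_num) (le_trans (by
        have : l + 3 ≤ (l + 3) ^ 2 := Nat.le_self_pow (by norm_num) _
        omega) Nat.lt_two_pow_self.le)
  have hW : ∀ I : Instance, I.encode = x → ∀ v u, I.arena.E v u →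
      |weightFun I.arena I.weight v u| ≤ ((2 ^ l : ℕ) : ℤ) := by
    intro I hI v u hE
    have := I.natAbs_lt (v := v) (u := u) (z := I.weight ⟨(v, u), hE⟩) (by
      rw [Instance.entry, dif_pos hE]; rfl)
    rw [hI, ← hl] at this
    rw [weightFun, dif_pos hE, Int.abs_eq_natAbs]
    exact_mod_cast this.le
  unfold PositiveNum
  rw [← hb, hbB]
  constructor
  · rintro ⟨n, hn, O, -, i₀, hi, T, -, hval, henc, hsafe⟩
    obtain ⟨I, rfl, hI⟩ := exists_instance_describes (O := O) hi hval
    rw [hI.encodeNum_eq] at henc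
    -- The number of the word is below `B`, so equality of the cut-off numbers is equality.
    have hIx : I.encode = x := wordNum_injective (by omega)
    refine ⟨I, hIx, ?_⟩
    rw [I.hasThreshold_iff (hW I hIx) (capBound_le (by omega))]
    exact (hI.exists_safeNum_iff (hB1 _ (by omega))).1 hsafe
  · rintro ⟨I, hIx, hI⟩
    have hn : I.n ≤ l := by have := I.n_le_length; rwa [hIx] at this
    obtain ⟨O, hO, T, hT, hd⟩ := exists_describes_of_instance (k := l + 1) I (hB3 _ hn) (hB2 _ hn)
      (fun v u z hz => by
        have := I.natAbs_lt hz
        rw [hIx, ← hl] at this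
        have h4 : 4 ^ (l + 1) = 4 * (2 ^ l * 2 ^ l) := by
          rw [pow_succ, show (4 : ℕ) = 2 * 2 by norm_num, mul_pow]; ring
        have h1 : 1 ≤ 2 ^ l := Nat.one_le_two_pow
        have h5 : 2 ^ l ≤ 2 ^ l * 2 ^ l := Nat.le_mul_of_pos_left _ h1
        omega)
    refine ⟨I.n, by omega, O, hO, I.arena.init, I.arena.init.2, T, hT, fun v hv => ?_, ?_, ?_⟩
    · obtain ⟨u, hu⟩ := I.arena.no_terminal ⟨v, hv⟩
      exact ⟨u, u.2, (hd.edge_iff ⟨v, hv⟩ u).2 hu⟩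
    · rw [hd.encodeNum_eq, hIx]
      exact min_eq_left hXB.le
    · rw [hd.exists_safeNum_iff (hB1 _ hn)]
      exact (I.hasThreshold_iff (hW I hIx) (capBound_le hn)).1 hI

end EnergyGame

namespace EnergyGame

open Computability

/-! ### The decision procedure -/

/-- Add the constant `k` to counter `i`. -/
def Prog.addConst (i : ℕ) : ℕ → Prog
  | 0 => .skip
  | k + 1 => .seq (.inc i) (Prog.addConst i k)

theorem Run.addConst_le (i : ℕ) (x : List Γ') : ∀ (k : ℕ) (s : ℕ → ℕ),
    ∃ t ≤ k + 1, Run (.addConst i k) (x, s) (x, Function.update s i (s i + k)) t := by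
  intro k
  induction k with
  | zero => exact fun s => ⟨1, le_rfl, by simpa [Prog.addConst] using Run.skip (x, s)⟩
  | succ k ih =>
    intro s
    obtain ⟨t, ht, h⟩ := Run.seq_le (Run.inc_le i (x := x) (s := s) rfl)
      (ih (Function.update s i (s i + 1)))
    rw [Function.update_idem, Function.update_self, add_assoc, add_comm 1 k] at h
    exact ⟨t, by omega, h⟩

/-- Add `2` to the power of counter `i` to the empty counter `j` and set counter `i` to zero, by
means of the empty counter `k`. -/
def Prog.twoPow (i j k : ℕ) : Prog :=
  .seq (.inc j) (.loop i (.seq (.loop j (.addConst k 2)) (.move k j)))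

theorem Run.twoPow_le {i j k : ℕ} (hij : i ≠ j) (hik : i ≠ k) (hjk : j ≠ k) {x : List Γ'}
    {s s' : ℕ → ℕ} (hj : s j = 0) (hk : s k = 0)
    (h : s' = Function.update (Function.update s i 0) j (2 ^ s i)) :
    ∃ t ≤ 10 * 2 ^ s i * (s i + 1), Run (.twoPow i j k) (x, s) (x, s') t := by
  set e := s i with he
  have h1 := Run.inc_le j (x := x) (s := s)
    (s' := Function.update (Function.update s i (e - 0)) j (2 ^ 0)) (by
      rw [Nat.sub_zero, he, Function.update_eq_self, hj]; rfl)
  -- Before round `n` counter `j` holds `2 ^ n`; a round doubles it through `k`.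
  have h2 := Run.loop_le (i := i) (P := .seq (.loop j (.addConst k 2)) (.move k j)) x
    (7 * 2 ^ e + 2) e (fun n => Function.update (Function.update s i (e - n)) j (2 ^ n))
    (by intro n _; simp [hij]) (by
      intro n hn
      have hpow : 2 ^ (n + 1) ≤ 2 ^ e := Nat.pow_le_pow_right (by norm_num) hn
      rw [pow_succ] at hpow
      have f1 := Run.loop_le (i := j) (P := .addConst k 2) x 3 (2 ^ n)
        (fun m => Function.update (Function.update (Function.update s i (e - n - 1)) j (2 ^ n - m))
          k (2 * m)) (by intro m _; simp [hjk]) (by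
          intro m _
          obtain ⟨t, ht, f⟩ := Run.addConst_le k x 2 (Function.update
            (Function.update (Function.update (Function.update s i (e - n - 1)) j (2 ^ n - m))
            k (2 * m)) j (2 ^ n - m - 1))
          refine ⟨t, ht, ?_⟩
          convert f using 2
          funext l
          by_cases l1 : l = k
          · subst l1; simp [hjk.symm]; ring
          · by_cases l2 : l = j
            · subst l2; simp [l1, Nat.sub_sub]
            · simp [l1, l2])
      have f2 := Run.move_le (i := k) (j := j) hjk.symm (x := x)
        (s := Function.update (Function.update (Function.update s i (e - n - 1)) j
          (2 ^ n - 2 ^ n)) k (2 * 2 ^ n))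
        (s' := Function.update (Function.update s i (e - (n + 1))) j (2 ^ (n + 1))) (by
          funext l
          by_cases l1 : l = k
          · subst l1; simp [hjk.symm, hik.symm, hk]
          · by_cases l2 : l = j
            · subst l2; simp [l1, pow_succ, mul_comm]
            · simp [l1, l2, Nat.sub_sub])
      obtain ⟨t, ht, f⟩ := Run.seq_le f1 f2
      refine ⟨t, ht.trans ?_, ?_⟩
      · simp only [Function.update_self]
        omega
      · convert f using 2
        funext l
        by_cases l1 : l = k
        · subst l1; simp [hjk.symm, hik.symm, hk]
        · by_cases l2 : l = j
          · subst l2; simp [l1, hij.symm]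
          · by_cases l3 : l = i
            · subst l3; simp [l1, l2]
            · simp [l1, l2, l3])
  obtain ⟨t, ht, f⟩ := Run.seq_le h1 h2
  subst h
  rw [Nat.sub_self] at f
  refine ⟨t, ht.trans ?_, f⟩
  have : 1 ≤ 2 ^ e := Nat.one_le_two_pow
  nlinarith [Nat.zero_le (e * 2 ^ e)]

/-- Process the input symbol whose number, decreased by one, is in counter `3`, and read the next
symbol. Counter `0` holds the number of the word read so far, and counter `1` its length. -/
def Prog.readStep : Prog :=
  .seq (.inc 2) (.seq (.move 3 2) (.seq (.loop 0 (.addConst 2 7)) (.seq (.move 2 0)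
    (.seq (.inc 1) (.read 3)))))

/-- The surrounding loop on counter `3` has already decremented the symbol number, so `inc 2`
restores the missing one. The `read` at the end prepares the next loop test, and reading the end of
the input yields `0` and stops the loop. -/
theorem Run.readStep_le (x : List Γ') (X l d : ℕ) : ∃ t ≤ 23 * X + 4 * d + 10,
    Run .readStep (x, setFour (fun _ => 0) 0 X l 0 d)
      (x.tail, setFour (fun _ => 0) 0 (7 * X + (d + 1)) (l + 1) 0 (symNum x.head?)) t := by
  have f1 := Run.inc_le 2 (x := x) (s := setFour (fun _ => 0) 0 X l 0 d)
    (s' := setFour (fun _ => 0) 0 X l 1 d) (by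
      funext j
      rcases j with _ | _ | _ | _ | j <;> simp [setFour])
  have f2 := Run.move_le (i := 3) (j := 2) (by norm_num) (x := x)
    (s := setFour (fun _ => 0) 0 X l 1 d)
    (s' := setFour (fun _ => 0) 0 (X - 0) l (d + 1 + 7 * 0) 0) (by
      funext j
      rcases j with _ | _ | _ | _ | j <;> simp [setFour] <;> omega)
  have f3 := Run.loop_le (i := 0) (P := .addConst 2 7) x 8 X
    (fun m => setFour (fun _ => 0) 0 (X - m) l (d + 1 + 7 * m) 0) (by intro m _; rfl) (by
      intro m _
      obtain ⟨t, ht, f⟩ := Run.addConst_le 2 x 7 (Function.update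
        (setFour (fun _ => 0) 0 (X - m) l (d + 1 + 7 * m) 0) 0 (X - m - 1))
      refine ⟨t, ht, ?_⟩
      convert f using 2
      funext j
      rcases j with _ | _ | _ | _ | j <;> simp [setFour] <;> omega)
  have f4 := Run.move_le (i := 2) (j := 0) (by norm_num) (x := x)
    (s := setFour (fun _ => 0) 0 (X - X) l (d + 1 + 7 * X) 0)
    (s' := setFour (fun _ => 0) 0 (7 * X + (d + 1)) l 0 0) (by
      funext j
      rcases j with _ | _ | _ | _ | j <;> simp [setFour] <;> omega)
  have f5 := Run.inc_le 1 (x := x) (s := setFour (fun _ => 0) 0 (7 * X + (d + 1)) l 0 0)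
    (s' := setFour (fun _ => 0) 0 (7 * X + (d + 1)) (l + 1) 0 0) (by
      funext j
      rcases j with _ | _ | _ | _ | j <;> simp [setFour])
  have f6 : ∃ t ≤ 1, Run (.read 3) (x, setFour (fun _ => 0) 0 (7 * X + (d + 1)) (l + 1) 0 0)
      (x.tail, setFour (fun _ => 0) 0 (7 * X + (d + 1)) (l + 1) 0 (symNum x.head?)) t := by
    refine ⟨1, le_rfl, ?_⟩
    convert Run.read 3 x (setFour (fun _ => 0) 0 (7 * X + (d + 1)) (l + 1) 0 0) using 2
    funext j
    rcases j with _ | _ | _ | _ | j <;> simp [setFour]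
  obtain ⟨t, ht, f⟩ := Run.seq_le f1 (Run.seq_le f2 (Run.seq_le f3 (Run.seq_le f4
    (Run.seq_le f5 f6))))
  refine ⟨t, ht.trans ?_, f⟩
  have e1 : setFour (fun _ => 0) 0 X l 1 d 3 = d := rfl
  have e2 : setFour (fun _ => 0) 0 (X - X) l (d + 1 + 7 * X) 0 2 = d + 1 + 7 * X := rfl
  rw [e1, e2]
  omega

theorem le_wordNum (a : ℕ) (x : List Γ') : a ≤ wordNum a x := by
  induction x generalizing a with
  | nil => exact le_rfl
  | cons c x ih => exact le_trans (by omega) (ih (7 * a + symNum (some c)))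

theorem Run.readLoop_le {D : ℕ} : ∀ (x : List Γ') (X l : ℕ), wordNum X x ≤ D →
    ∃ t ≤ x.length * (23 * D + 40) + 1, Run (.loop 3 .readStep)
      (x.tail, setFour (fun _ => 0) 0 X l 0 (symNum x.head?))
      ([], setFour (fun _ => 0) 0 (wordNum X x) (l + x.length) 0 0) t := by
  intro x
  induction x with
  | nil => exact fun X l _ => ⟨1, by simp, .loop_zero rfl⟩
  | cons c x ih =>
    intro X l hD
    have hc := symNum_pos c
    have hc' := symNum_le (some c)
    have e : symNum (some c) - 1 + 1 = symNum (some c) := by omega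
    obtain ⟨t₁, ht₁, h₁⟩ := Run.readStep_le x X l (symNum (some c) - 1)
    rw [e] at h₁
    obtain ⟨t₂, ht₂, h₂⟩ := ih (7 * X + symNum (some c)) (l + 1) hD
    have hX : X ≤ D := (le_wordNum X (c :: x)).trans hD
    refine ⟨1 + t₁ + t₂, ?_, ?_⟩
    · rw [List.length_cons, add_mul, one_mul]
      omega
    · rw [List.length_cons, ← add_assoc, add_right_comm]
      refine .loop_succ (n := symNum (some c) - 1) (s₂ := (x.tail, setFour (fun _ => 0) 0
        (7 * X + symNum (some c)) (l + 1) 0 (symNum x.head?))) ?_ ?_ h₂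
      · exact e.symm
      · change Run .readStep (x, _) _ _
        convert h₁ using 2
        funext j
        rcases j with _ | _ | _ | _ | j <;> simp [setFour]

theorem Run.readAll_le (x : List Γ') : ∃ t ≤ x.length * (23 * wordNum 0 x + 40) + 2,
    Run (.seq (.read 3) (.loop 3 .readStep)) (x, fun _ => 0)
      ([], setFour (fun _ => 0) 0 (wordNum 0 x) x.length 0 0) t := by
  have f1 : ∃ t ≤ 1, Run (.read 3) (x, fun _ => 0)
      (x.tail, setFour (fun _ => 0) 0 0 0 0 (symNum x.head?)) t := by
    refine ⟨1, le_rfl, ?_⟩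
    convert Run.read 3 x (fun _ => 0) using 2
    funext j
    rcases j with _ | _ | _ | _ | j <;> simp [setFour]
  obtain ⟨t, ht, f⟩ := Run.seq_le f1 (Run.readLoop_le x 0 0 le_rfl)
  rw [zero_add] at f
  exact ⟨t, by omega, f⟩

open Classical in
-- Counters `0`, `1`, `2` receive the number `X` of the word, its length `l` and, by two
-- exponentiations of `(l + 4) ^ 2`, the bound `B`. The formula is evaluated into counter `3`; the
-- rest brings the counters into the form demanded of the output.
theorem exists_prog_thresholdProblem : ∃ (P : Prog) (C : ℕ), ∀ x : List Γ',
    ∃ t, t + 1 ≤ (2 ^ 2 ^ ((x.length + 4) ^ 2)) ^ C ∧ Run P (x, fun _ => 0)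
      ([], Function.update (fun _ => 0) 0 (if x ∈ thresholdProblem then 1 else 0)) t := by
  have hq : Realizable (fun p : Unit × ℕ => (p.2 + 4) ^ 2) :=
    (Realizable.snd.add (.const 4)).pow 2
  have hF : RealizablePred (fun p : ((Unit × ℕ) × ℕ) × ℕ => PositiveNum p.2 p.1.2 p.1.1.2) :=
    Realizable.positiveNum Realizable.snd Realizable.snd.fst Realizable.snd.fst.fst
  obtain ⟨-, c₁, ⟨C₁, hC₁⟩, h₁⟩ := hq
  obtain ⟨-, c₂, ⟨C₂, hC₂⟩, h₂⟩ := hF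
  obtain ⟨P₁, hP₁⟩ := h₁ [1] 2 (by simp)
  obtain ⟨P₂, hP₂⟩ := h₂ [2, 1, 0] 3 (by simp)
  refine ⟨.seq (.seq (.read 3) (.loop 3 .readStep)) (.seq P₁ (.seq (.twoPow 2 3 4)
    (.seq (.twoPow 3 2 4) (.seq P₂ (.seq (.clear 0) (.seq (.clear 1) (.seq (.clear 2)
      -- Each phase costs a small multiple of a power of `B` with exponent at most `C₁ + 2 * C₂ +
      -- 3`; one more factor `B ≥ 256` absorbs the coefficients.
      (.move 3 0)))))))), C₁ + 2 * C₂ + 4, fun x => ?_⟩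
  set l := x.length with hl
  set X := wordNum 0 x with hX
  set q := (l + 4) ^ 2 with hqdef
  set B := 2 ^ 2 ^ q with hB
  set r := if x ∈ thresholdProblem then 1 else 0 with hr
  have g1 : ∃ t ≤ l * (23 * X + 40) + 2, Run _ _ _ t := Run.readAll_le x
  have g2 := hP₁ ((), l) [] (setFour (fun _ => 0) 0 X l 0 0) rfl (by
    intro j hj; simp only [setFour]; split_ifs <;> omega)
  have g3 : ∃ t ≤ 10 * 2 ^ q * (q + 1), Run _ _ _ t := Run.twoPow_le (i := 2) (j := 3) (k := 4) (by norm_num) (by norm_num) (by norm_num)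
    (x := []) (s := Function.update (setFour (fun _ => 0) 0 X l 0 0) 2 q)
    (s' := setFour (fun _ => 0) 0 X l 0 (2 ^ q)) rfl rfl (by
      funext j
      rcases j with _ | _ | _ | _ | j <;> simp [setFour])
  have g4 : ∃ t ≤ 10 * B * (2 ^ q + 1), Run _ _ _ t := Run.twoPow_le (i := 3) (j := 2) (k := 4) (by norm_num) (by norm_num) (by norm_num)
    (x := []) (s := setFour (fun _ => 0) 0 X l 0 (2 ^ q))
    (s' := setFour (fun _ => 0) 0 X l B 0) rfl rfl (by
      funext j
      rcases j with _ | _ | _ | _ | j <;> simp [setFour] <;> omega)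
  have g5 := hP₂ ((((), X), l), B) [] (setFour (fun _ => 0) 0 X l B 0) rfl (by
    intro j hj; simp only [setFour]; split_ifs <;> omega)
  have hpos : (if PositiveNum B l X then 1 else 0) = r := by
    rw [hr]
    exact if_congr (positiveNum_iff x) rfl rfl
  simp only at g5
  rw [hpos] at g5
  have hs5 : Function.update (setFour (fun _ => 0) 0 X l B 0) 3 r = setFour (fun _ => 0) 0 X l B r := by
    funext j
    rcases j with _ | _ | _ | _ | j <;> simp [setFour]
  rw [hs5] at g5
  have g6 : ∃ t ≤ X * 2 + 1, Run _ _ _ t := Run.clear_le 0 (x := []) (s := setFour (fun _ => 0) 0 X l B r)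
    (s' := setFour (fun _ => 0) 0 0 l B r) (by
      funext j
      rcases j with _ | _ | _ | _ | j <;> simp [setFour])
  have g7 : ∃ t ≤ l * 2 + 1, Run _ _ _ t := Run.clear_le 1 (x := []) (s := setFour (fun _ => 0) 0 0 l B r)
    (s' := setFour (fun _ => 0) 0 0 0 B r) (by
      funext j
      rcases j with _ | _ | _ | _ | j <;> simp [setFour])
  have g8 : ∃ t ≤ B * 2 + 1, Run _ _ _ t := Run.clear_le 2 (x := []) (s := setFour (fun _ => 0) 0 0 0 B r)
    (s' := setFour (fun _ => 0) 0 0 0 0 r) (by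
      funext j
      rcases j with _ | _ | _ | _ | j <;> simp [setFour])
  have g9 : ∃ t ≤ r * 2 + 1, Run _ _ _ t := Run.move_le (i := 3) (j := 0) (by norm_num) (x := [])
    (s := setFour (fun _ => 0) 0 0 0 0 r) (s' := Function.update (fun _ => 0) 0 r) (by
      funext j
      rcases j with _ | _ | _ | _ | j <;> simp [setFour])
  obtain ⟨t, ht, g⟩ := Run.seq_le g1 (Run.seq_le g2 (Run.seq_le g3 (Run.seq_le g4 (Run.seq_le g5
    (Run.seq_le g6 (Run.seq_le g7 (Run.seq_le g8 g9)))))))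
  refine ⟨t, ?_, g⟩
  have hr1 : r ≤ 1 := by rw [hr]; split_ifs <;> omega
  have hq16 : 3 * l + 16 ≤ q := by rw [hqdef]; nlinarith
  have hq2 : q < 2 ^ q := Nat.lt_two_pow_self
  have h2qB : 2 ^ q < B := Nat.lt_two_pow_self
  have hXB : X ≤ B := by
    have h1 : X < 7 ^ l := wordNum_lt x
    have h2 : 7 ^ l ≤ (2 ^ 3) ^ l := Nat.pow_le_pow_left (by norm_num) l
    rw [← pow_mul] at h2
    have h3 : 2 ^ (3 * l) ≤ B := Nat.pow_le_pow_right (by norm_num) (by omega)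
    omega
  have hB256 : 256 ≤ B := by
    calc 256 = 2 ^ 8 := by norm_num
      _ ≤ B := Nat.pow_le_pow_right (by norm_num) (by omega)
  have k1 : c₁ ((), l) ≤ B ^ C₁ := by
    refine (hC₁ _).trans (Nat.pow_le_pow_left ?_ _)
    simp only [Env.size, Env.vals, List.sum_cons, List.sum_nil]
    omega
  -- The size `X + l + B + 2` of the environment is at most `B ^ 2`, hence the factor `2` in the
  -- exponent.
  have k2 : c₂ ((((), X), l), B) ≤ B ^ (2 * C₂) := by
    refine (hC₂ _).trans ?_
    rw [pow_mul]
    refine Nat.pow_le_pow_left ?_ _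
    simp only [Env.size, Env.vals, List.sum_cons, List.sum_nil]
    nlinarith
  have k3 : 10 * 2 ^ q * (q + 1) ≤ 10 * B * B :=
    Nat.mul_le_mul (Nat.mul_le_mul_left _ h2qB.le) (by omega)
  have k4 : 10 * B * (2 ^ q + 1) ≤ 10 * B * B := Nat.mul_le_mul_left _ h2qB
  have k5 : l * (23 * X + 40) ≤ B * (63 * B) := Nat.mul_le_mul (by omega) (by omega)
  have k6 : B ^ C₁ ≤ B ^ (C₁ + 2 * C₂ + 3) := Nat.pow_le_pow_right (by omega) (by omega)
  have k7 : B ^ (2 * C₂) ≤ B ^ (C₁ + 2 * C₂ + 3) := Nat.pow_le_pow_right (by omega) (by omega)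
  have k8 : B ^ 2 ≤ B ^ (C₁ + 2 * C₂ + 3) := Nat.pow_le_pow_right (by omega) (by omega)
  have k9 : 256 * B ^ (C₁ + 2 * C₂ + 3) ≤ B ^ (C₁ + 2 * C₂ + 4) := by
    rw [pow_succ B (C₁ + 2 * C₂ + 3), mul_comm]
    exact Nat.mul_le_mul_left _ hB256
  have k10 : 256 * B ≤ B ^ 2 := by rw [pow_two]; exact Nat.mul_le_mul_right _ hB256
  have k11 : 10 * B * B = 10 * B ^ 2 := by ring
  have k12 : B * (63 * B) = 63 * B ^ 2 := by ring
  omega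

theorem inTwoExpTime_thresholdProblem : InTwoExpTime thresholdProblem := by
  obtain ⟨P, C, hP⟩ := exists_prog_thresholdProblem
  obtain ⟨M, hM⟩ := exists_tm2ComputableInTime_of_run P thresholdProblem
    (fun n => (2 ^ 2 ^ ((n + 4) ^ 2)) ^ C) hP
  refine ⟨M, (Polynomial.X + 4) ^ 2 + Polynomial.C C, fun n => ?_⟩
  rw [hM]
  change (2 ^ 2 ^ ((n + 4) ^ 2)) ^ C ≤ _
  rw [← pow_mul]
  refine Nat.pow_le_pow_right (by norm_num) ?_
  have : Polynomial.eval n ((Polynomial.X + 4) ^ 2 + Polynomial.C C : Polynomial ℕ) =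
      (n + 4) ^ 2 + C := by simp
  rw [this, pow_add]
  -- The power `C` of `B` multiplies the inner exponential by `C ≤ 2 ^ C`, which adds only a
  -- constant to the polynomial.
  exact Nat.mul_le_mul_left _ Nat.lt_two_pow_self.le

end EnergyGame

theorem mainTheorem1 : EnergyGame.InTwoExpTime EnergyGame.thresholdProblem :=
  EnergyGame.inTwoExpTime_thresholdProblem
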